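/- Let $c,\kappa>0$, $\beta_n=\frac{\kappa^2}{c^2}(n+1)$ for $n\ge 0$, and $\gamma=\kappa/c$ (so $\gamma^2=\beta_0$). Define coefficients $a_{n,k}$, $0\le k\le n$, by $a_{n,0}=1$, $a_{n,n}=-\frac{1}{2\gamma n}\beta_1a_{n-1,n-1}$ for $n\ge1$, and $$a_{n,k}=\frac{1}{2\gamma k}\Big\{4\Big\lfloor\tfrac{k+1}{2}\Big\rfloor^2a_{n,k+1}-\sum_{m=k-1}^{n-1}\beta_{n-m}a_{m,k-1}\Big\},\qquad k=n-1,\dots,1,$$ and for $r>0$ put $$\Phi_n(r)=K_0(\gamma r)\sum_{0\le 2k\le n}a_{n,2k}r^{2k}+K_1(\gamma r)\sum_{1\le 2k+1\le n}a_{n,2k+1}r^{2k+1},$$ where $K_0,K_1$ are the modified Bessel functions of the second kind (Macdonald functions). Let $\Gamma\subset\mathbb R^2$ be a simple closed curve of class $C^3$, with a $2\pi$-periodic parametrization $x\in C^3(\mathbb R,\mathbb R^2)$ that is injective on $[0,2\pi)$ and satisfies $|x'(s)|>0$ for all $s$; let $\nu$ be a continuous unit normal to $\Gamma$. Put $$Q_n(s,\sigma)=\frac{2}{|x'(s)|}\frac{\partial}{\partial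 s}\Phi_n(|x(s)-x(\sigma)|),\qquad \tilde W_n(s,\sigma)=\nu(x(s))\cdot\nu(x(\sigma))\sum_{k=0}^n\beta_{n-k}\,2|x'(\sigma)|\,\Phi_k(|x(s)-x(\sigma)|),$$ $$(H_n\varphi)(s)=\frac1{2\pi}\,\mathrm{p.v.}\!\int_0^{2\pi}\varphi'(\sigma)Q_n(s,\sigma)\,d\sigma,\qquad (L_n\varphi)(s)=\frac1{2\pi}\int_0^{2\pi}\varphi(\sigma)\tilde W_n(s,\sigma)\,d\sigma,$$ where the first integral is a Cauchy principal value (with respect to the singularity $\sigma\equiv s \bmod 2\pi$). Let $0<\alpha<1$. Let $C^{0,\alpha}[0,2\pi]$ be the space of $2\pi$-periodic real functions that are Hölder continuous with exponent $\alpha$, and let $C^{1,\alpha}[0,2\pi]$ be the space of $2\pi$-periodic $C^1$ functions with derivative in $C^{0,\alpha}[0,2\pi]$. Theorem. For all $n\ge0$, $\varphi\in C^{1,\alpha}[0,2\pi]$ and $s\in\mathbb R$, the principal value and the (Lebesgue) integral that define $(H_n\varphi)(s)$ and $(L_n\varphi)(s)$ exist. For any $f_n\in C^{0,\alpha}[0,2\pi]$,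 $n=0,1,2,\dots$, there is exactly one sequence of functions $\psi_n\in C^{1,\alpha}[0,2\pi]$, $n=0,1,2,\dots$, such that $$((H_0-L_0)\psi_n)(s)=f_n(s)-\sum_{m=0}^{n-1}\big((H_{n-m}-L_{n-m})\psi_m\big)(s),\qquad s\in[0,2\pi],\quad n=0,1,2,\dots$$ -/

import Mathlib

open Filter Topology MeasureTheory
open scoped NNReal

noncomputable section

namespace LaguerreBIE

/-! ### Modified Bessel and Hankel (Macdonald) functions of orders 0 and 1 -/

/-- `I₀(z) = ∑ (z/2)^{2n} / (n!)²`. -/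
def I0 (z : ℝ) : ℝ := ∑' n : ℕ, 1 / ((n.factorial : ℝ) ^ 2) * (z / 2) ^ (2 * n)

/-- `I₁(z) = ∑ (z/2)^{2n+1} / (n! (n+1)!)`. -/
def I1 (z : ℝ) : ℝ :=
  ∑' n : ℕ, 1 / ((n.factorial : ℝ) * ((n + 1).factorial : ℝ)) * (z / 2) ^ (2 * n + 1)

/-- `K₀(z)`, for `z > 0`; `harmonic n = 1 + 1/2 + ⋯ + 1/n`, so the term `n = 0` of the series
vanishes. -/
def K0 (z : ℝ) : ℝ :=
  -(Real.log (z / 2) + Real.eulerMascheroniConstant) * I0 z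
    + ∑' n : ℕ, (harmonic n : ℝ) / ((n.factorial : ℝ) ^ 2) * (z / 2) ^ (2 * n)

/-- `K₁(z)`, for `z > 0`. -/
def K1 (z : ℝ) : ℝ :=
  1 / z + (Real.log (z / 2) + Real.eulerMascheroniConstant) * I1 z
    - 1 / 2 * ∑' n : ℕ, ((harmonic (n + 1) : ℝ) + (harmonic n : ℝ))
        / ((n.factorial : ℝ) * ((n + 1).factorial : ℝ)) * (z / 2) ^ (2 * n + 1)

/-! ### The fundamental sequence -/

/-- `β_n = (κ²/c²)(n+1)`. -/
def beta (c κ : ℝ) (n : ℕ) : ℝ := κ ^ 2 / c ^ 2 * (n + 1)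

/-- `γ`, the positive root of `γ² = β₀`. -/
def gamma (c κ : ℝ) : ℝ := κ / c

theorem gamma_sq (c κ : ℝ) : gamma c κ ^ 2 = beta c κ 0 := by
  simp [gamma, beta, div_pow]

/-- The coefficients `a_{n,k}`, `0 ≤ k ≤ n` (and `0` for `k > n`); the recursion is restated in
`coeff_zero`, `coeff_self`, `coeff_of_lt`. -/
def coeff (c κ : ℝ) (n k : ℕ) : ℝ :=
  if k = 0 then 1
  else if n < k then 0
  else if k = n then -(1 / (2 * gamma c κ * n)) * beta c κ 1 * coeff c κ (n - 1) (n - 1)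
  else 1 / (2 * gamma c κ * k) *
    (4 * (((k + 1) / 2 : ℕ) : ℝ) ^ 2 * coeff c κ n (k + 1)
      - ∑ m : Fin n, if k - 1 ≤ (m : ℕ) then beta c κ (n - m) * coeff c κ m (k - 1) else 0)
termination_by (n, n + 1 - k)
decreasing_by
  all_goals simp_wf
  all_goals first
    | (apply Prod.Lex.left; omega)
    | (apply Prod.Lex.right; omega)

theorem coeff_zero (c κ : ℝ) (n : ℕ) : coeff c κ n 0 = 1 := by
  rw [coeff]; simp

theorem coeff_self (c κ : ℝ) (n : ℕ) (hn : 1 ≤ n) :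
    coeff c κ n n = -(1 / (2 * gamma c κ * n)) * beta c κ 1 * coeff c κ (n - 1) (n - 1) := by
  rw [coeff]; simp [show n ≠ 0 by omega]

theorem coeff_of_lt (c κ : ℝ) (n k : ℕ) (hk : 1 ≤ k) (hkn : k < n) :
    coeff c κ n k = 1 / (2 * gamma c κ * k) *
      (4 * (((k + 1) / 2 : ℕ) : ℝ) ^ 2 * coeff c κ n (k + 1)
        - ∑ m ∈ Finset.Ico (k - 1) n, beta c κ (n - m) * coeff c κ m (k - 1)) := by
  rw [coeff, if_neg (by omega), if_neg (by omega), if_neg (by omega)]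
  congr 2
  rw [Fin.sum_univ_eq_sum_range
    (fun m => if k - 1 ≤ m then beta c κ (n - m) * coeff c κ m (k - 1) else 0) n,
    ← Finset.sum_filter]
  apply Finset.sum_congr _ (fun _ _ => rfl)
  ext m
  simp only [Finset.mem_filter, Finset.mem_range, Finset.mem_Ico]
  omega

/-- `v_n(r) = ∑_{k=0}^{⌊n/2⌋} a_{n,2k} r^{2k}`. -/
def v (c κ : ℝ) (n : ℕ) (r : ℝ) : ℝ :=
  ∑ k ∈ Finset.range (n / 2 + 1), coeff c κ n (2 * k) * r ^ (2 * k)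

/-- `w_n(r) = ∑_{k=0}^{⌊(n-1)/2⌋} a_{n,2k+1} r^{2k+1}`, with `w_0 = 0`. For `n ≥ 1` the sum has
`⌊(n-1)/2⌋ + 1 = ⌊(n+1)/2⌋` terms, and for `n = 0` it is empty. -/
def w (c κ : ℝ) (n : ℕ) (r : ℝ) : ℝ :=
  ∑ k ∈ Finset.range ((n + 1) / 2), coeff c κ n (2 * k + 1) * r ^ (2 * k + 1)

/-- `Φ_n(r) = K₀(γr) v_n(r) + K₁(γr) w_n(r)`, for `r > 0`. -/
def Phi (c κ : ℝ) (n : ℕ) (r : ℝ) : ℝ :=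
  K0 (gamma c κ * r) * v c κ n r + K1 (gamma c κ * r) * w c κ n r

/-! ### The boundary curve and the kernels -/

/-- A `2π`-periodic regular `C³` parametrization of a simple closed plane curve. -/
structure IsBoundaryParam (x : ℝ → EuclideanSpace ℝ (Fin 2)) : Prop where
  contDiff : ContDiff ℝ 3 x
  periodic : Function.Periodic x (2 * Real.pi)
  regular : ∀ s, deriv x s ≠ 0
  simple : Set.InjOn x (Set.Ico 0 (2 * Real.pi))

/-- Unit normal `ν(x(s)) = (x₂'(s), -x₁'(s)) / |x'(s)|`: the outward one when the curve runs
counterclockwise, the inward one otherwise. It enters only through products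
`ν(x(s)) · ν(x(σ))`, which do not see the sign. -/
def normal (x : ℝ → EuclideanSpace ℝ (Fin 2)) (s : ℝ) : EuclideanSpace ℝ (Fin 2) :=
  (1 / ‖deriv x s‖) • !₂[deriv x s 1, -(deriv x s 0)]

/-- `W_n(s,σ) = 2 |x'(σ)| Φ_n(|x(s) - x(σ)|)`. -/
def W (c κ : ℝ) (x : ℝ → EuclideanSpace ℝ (Fin 2)) (n : ℕ) (s σ : ℝ) : ℝ :=
  2 * ‖deriv x σ‖ * Phi c κ n ‖x s - x σ‖

/-- `W̃_n(s,σ) = ν(x(s)) · ν(x(σ)) ∑_{k=0}^n β_{n-k} W_k(s,σ)`. -/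
def Wtilde (c κ : ℝ) (x : ℝ → EuclideanSpace ℝ (Fin 2)) (n : ℕ) (s σ : ℝ) : ℝ :=
  inner ℝ (normal x s) (normal x σ) *
    ∑ k ∈ Finset.range (n + 1), beta c κ (n - k) * W c κ x k s σ

/-- `Q_n(s,σ) = (2 / |x'(s)|) ∂/∂s Φ_n(|x(s) - x(σ)|)`. -/
def Q (c κ : ℝ) (x : ℝ → EuclideanSpace ℝ (Fin 2)) (n : ℕ) (s σ : ℝ) : ℝ :=
  2 / ‖deriv x s‖ * deriv (fun t => Phi c κ n ‖x t - x σ‖) s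

/-! ### The operators -/

/-- `l` is the Cauchy principal value, over one period, of the integral of the `2π`-periodic
function `g` with a singularity at `s`: the period `[s, s + 2π]` is cut by `ε` at both ends, which
by periodicity removes the symmetric interval `(s - ε, s + ε)` modulo `2π`. -/
def HasPVIntegral (g : ℝ → ℝ) (s l : ℝ) : Prop :=
  Tendsto (fun ε : ℝ => ∫ σ in (s + ε)..(s + 2 * Real.pi - ε), g σ) (𝓝[>] 0) (𝓝 l)

/-- The principal value of the integral of `g` over one period (meaningful when it exists). -/
def pvIntegral (g : ℝ → ℝ) (s : ℝ) : ℝ :=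
  limUnder (𝓝[>] (0 : ℝ)) (fun ε : ℝ => ∫ σ in (s + ε)..(s + 2 * Real.pi - ε), g σ)

theorem HasPVIntegral.pvIntegral_eq {g : ℝ → ℝ} {s l : ℝ} (h : HasPVIntegral g s l) :
    pvIntegral g s = l :=
  Tendsto.limUnder_eq h

/-- `(H_n f)(s) = (1/2π) p.v. ∫₀^{2π} f'(σ) Q_n(s,σ) dσ`. -/
def H (c κ : ℝ) (x : ℝ → EuclideanSpace ℝ (Fin 2)) (n : ℕ) (f : ℝ → ℝ) (s : ℝ) : ℝ :=
  1 / (2 * Real.pi) * pvIntegral (fun σ => deriv f σ * Q c κ x n s σ) s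

/-- `(L_n f)(s) = (1/2π) ∫₀^{2π} f(σ) W̃_n(s,σ) dσ`. -/
def L (c κ : ℝ) (x : ℝ → EuclideanSpace ℝ (Fin 2)) (n : ℕ) (f : ℝ → ℝ) (s : ℝ) : ℝ :=
  1 / (2 * Real.pi) * ∫ σ in (0 : ℝ)..(2 * Real.pi), f σ * Wtilde c κ x n s σ

/-! ### Hölder spaces of `2π`-periodic functions -/

/-- `g ∈ C^{0,α}[0,2π]`: `2π`-periodic and Hölder continuous with exponent `α`. -/
def MemC0 (α : ℝ≥0) (g : ℝ → ℝ) : Prop :=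
  Function.Periodic g (2 * Real.pi) ∧ ∃ C : ℝ≥0, HolderWith C α g

/-- `g ∈ C^{1,α}[0,2π]`: `2π`-periodic and continuously differentiable, with a derivative that is
Hölder continuous with exponent `α`. -/
def MemC1 (α : ℝ≥0) (g : ℝ → ℝ) : Prop :=
  Function.Periodic g (2 * Real.pi) ∧ ContDiff ℝ 1 g ∧ ∃ C : ℝ≥0, HolderWith C α (deriv g)

end LaguerreBIE

end

/-!
All `Φ_n` have the same logarithmic singularity: by `exists_Phi_eq`, `Φ_n(r) = -log r (1 + r²
A(r²)) + B(r²)` with smooth `A` and `B`. On the curve, `Φ_n(|x(s) - x(σ)|)` is therefore `-½ log (4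
sin² ((s - σ) / 2))` plus a kernel with a Hölder continuous `s`-derivative
(`IsBoundaryParam.exists_regularPart`). Consequently `|x'| (H_n - L_n) φ = -hilb φ' + R_n φ`, where
`hilb` is the conjugation operator on the circle and `R_n` is smoothing
(`IsBoundaryParam.mul_H_sub_L`). The integrals exist for this reason, and Privalov's theorem
`exists_isHolder_hilb` shows that `H_n - L_n` maps `C^{1,α}` to `C^{0,α}`. The equations form a
lower triangular system with `H_0 - L_0` on the diagonal, so it remains to show that `H_0 - L_0` is
a bijection from `C^{1,α}` to `C^{0,α}`.

*Injectivity.* Integration by parts gives (`IsBoundaryParam.energy_identity`) `-π ∫ φ |x'| (H_0 -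
L_0) φ = E(φ') + β_0 (E(φ x_1') + E(φ x_2'))`, where `E` is the quadratic form of the kernel
`Φ_0(|x(s) - x(σ)|) = K_0(γ |x(s) - x(σ)|)`. This form is strictly positive
(`IsBoundaryParam.PhiForm_pos`): since `K_0(z) = ½ ∫_0^∞ exp(-τ - z² / (4τ)) dτ / τ`
(`K0_eq_integral`), it is a mixture of the forms of Gaussian kernels, and these are sums of squares
of polynomial moments of a weighted density on the curve, which by the Stone–Weierstrass theorem do
not all vanish. The integral formula for `K_0` follows from the Bessel equation, written as a
first-order system, and the behaviour of both sides at `0`.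

*Surjectivity.* As `hilb (hilb g) = mean g - g` (`IsHolder.hilb_hilb`), the operator `mean - hilb`
has the inverse `mean + hilb`. With `φ` replaced by a mean-corrected primitive of a new unknown
`ρ`, the equation `-hilb φ' + R_0 φ = F` becomes `ρ + Y ρ = G`, where `Y` maps bounded sets of
continuous functions to bounded sets of Hölder continuous ones and is therefore compact
(`IsBoundaryParam.exists_solution`). By the Fredholm alternative (`exists_add_eq_of_injective`),
injectivity is enough.
-/

noncomputable section

namespace LaguerreBIE

/-! ### Power series with factorially decaying coefficients -/

/-- The sum of the power series with coefficients `c`. -/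
def powerSum (c : ℕ → ℝ) (u : ℝ) : ℝ := ∑' n : ℕ, c n * u ^ n

/-- The coefficients are `O(1 / n!)`, which makes the series and all its derivatives converge
everywhere; the condition is stable under term-by-term differentiation. -/
def FactorialDecay (c : ℕ → ℝ) : Prop := ∃ C : ℝ, ∀ n : ℕ, |c n| ≤ C / (n.factorial : ℝ)

/-- The coefficients of the derived series. -/
def shiftCoeff (c : ℕ → ℝ) (n : ℕ) : ℝ := (n + 1) * c (n + 1)

theorem FactorialDecay.summable {c : ℕ → ℝ} (hc : FactorialDecay c) (u : ℝ) :
    Summable fun n : ℕ => c n * u ^ n := by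
  obtain ⟨C, hC⟩ := hc
  refine Summable.of_norm_bounded ((Real.summable_pow_div_factorial |u|).mul_left C) fun n => ?_
  rw [Real.norm_eq_abs, abs_mul, abs_pow]
  calc |c n| * |u| ^ n ≤ C / (n.factorial : ℝ) * |u| ^ n := by gcongr; exact hC n
    _ = C * (|u| ^ n / (n.factorial : ℝ)) := by ring

theorem FactorialDecay.shiftCoeff {c : ℕ → ℝ} (hc : FactorialDecay c) :
    FactorialDecay (shiftCoeff c) := by
  obtain ⟨C, hC⟩ := hc
  refine ⟨C, fun n => ?_⟩
  have h := hC (n + 1)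
  rw [LaguerreBIE.shiftCoeff, abs_mul, abs_of_pos (by positivity : (0 : ℝ) < n + 1)]
  rw [Nat.factorial_succ, Nat.cast_mul, le_div_iff₀ (by positivity)] at h
  rw [le_div_iff₀ (by positivity)]
  push_cast at h
  linarith

theorem FactorialDecay.hasDerivAt {c : ℕ → ℝ} (hc : FactorialDecay c) (u : ℝ) :
    HasDerivAt (powerSum c) (powerSum (LaguerreBIE.shiftCoeff c) u) u := by
  have hc' := hc
  obtain ⟨C, hC⟩ := hc
  set R : ℝ := |u| + 1
  have hsum : Summable fun n : ℕ => C / (n.factorial : ℝ) * (n * R ^ (n - 1)) := by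
    rw [← summable_nat_add_iff 1]
    refine ((Real.summable_pow_div_factorial R).mul_left C).congr fun n => ?_
    rw [Nat.factorial_succ]
    push_cast
    have : (n.factorial : ℝ) ≠ 0 := by positivity
    field_simp
  have key := hasDerivAt_tsum_of_isPreconnected (t := Metric.ball (0 : ℝ) R)
    (g := fun n z => c n * z ^ n) (g' := fun n z => c n * (n * z ^ (n - 1))) (y₀ := 0) (y := u)
    hsum Metric.isOpen_ball (convex_ball (0 : ℝ) R).isPreconnected
    (fun n y _ => (hasDerivAt_pow n y).const_mul (c n))
    (fun n y hy => by
      rw [mem_ball_zero_iff, Real.norm_eq_abs] at hy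
      rw [Real.norm_eq_abs, abs_mul, abs_mul, abs_pow, Nat.abs_cast]
      gcongr
      · exact (abs_nonneg _).trans (hC n)
      · exact hC n)
    (by simp [R]; positivity) (hc'.summable 0) (by simp [R])
  suffices h : powerSum (LaguerreBIE.shiftCoeff c) u
      = ∑' n : ℕ, c n * (n * u ^ (n - 1)) by rw [h]; exact key
  rw [Summable.tsum_eq_zero_add]
  · simp only [powerSum, LaguerreBIE.shiftCoeff, Nat.cast_zero, zero_mul, mul_zero, zero_add,
      Nat.add_sub_cancel]
    refine tsum_congr fun n => ?_
    push_cast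
    ring
  · rw [← summable_nat_add_iff 1]
    refine (hc'.shiftCoeff.summable u).congr fun n => ?_
    simp only [LaguerreBIE.shiftCoeff, Nat.add_sub_cancel]
    push_cast
    ring

theorem FactorialDecay.contDiff {c : ℕ → ℝ} (hc : FactorialDecay c) (n : ℕ) :
    ContDiff ℝ n (powerSum c) := by
  induction n generalizing c with
  | zero =>
    exact contDiff_zero.2 (continuous_iff_continuousAt.2 fun u => (hc.hasDerivAt u).continuousAt)
  | succ n ih =>
    push_cast
    rw [contDiff_succ_iff_deriv]
    refine ⟨fun u => (hc.hasDerivAt u).differentiableAt, by simp, ?_⟩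
    rw [show deriv (powerSum c) = powerSum (LaguerreBIE.shiftCoeff c) from
      funext fun u => (hc.hasDerivAt u).deriv]
    exact ih hc.shiftCoeff

theorem powerSum_zero (c : ℕ → ℝ) : powerSum c 0 = c 0 := by
  rw [powerSum, tsum_eq_single 0]
  · simp
  · intro n hn; simp [hn]

theorem FactorialDecay.powerSum_eq {c : ℕ → ℝ} (hc : FactorialDecay c) (u : ℝ) :
    powerSum c u = c 0 + u * powerSum (fun n => c (n + 1)) u := by
  rw [powerSum, (hc.summable u).tsum_eq_zero_add, powerSum, ← tsum_mul_left]
  simp only [pow_zero, mul_one]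
  congr 1
  exact tsum_congr fun n => by ring

theorem FactorialDecay.tail {c : ℕ → ℝ} (hc : FactorialDecay c) :
    FactorialDecay fun n => c (n + 1) := by
  obtain ⟨C, hC⟩ := hc
  have hC0 : 0 ≤ C := by simpa using (abs_nonneg _).trans (hC 0)
  refine ⟨C, fun n => (hC (n + 1)).trans ?_⟩
  gcongr
  omega

/-! ### The power series of the modified Bessel functions -/

/-- Coefficients of `I₀` in `u = z² / 4`. -/
def cI0 (n : ℕ) : ℝ := 1 / (n.factorial : ℝ) ^ 2

/-- Coefficients of `2 I₁(z) / z` in `u = z² / 4`. -/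
def cI1 (n : ℕ) : ℝ := 1 / ((n.factorial : ℝ) * ((n + 1).factorial : ℝ))

/-- Coefficients of the non-logarithmic part of `K₀` in `u = z² / 4`. -/
def cP0 (n : ℕ) : ℝ := (harmonic n : ℝ) / (n.factorial : ℝ) ^ 2

/-- Coefficients of the series in `K₁(z)`, divided by `z / 2`, in `u = z² / 4`. -/
def cP1 (n : ℕ) : ℝ :=
  ((harmonic (n + 1) : ℝ) + (harmonic n : ℝ)) / ((n.factorial : ℝ) * ((n + 1).factorial : ℝ))

theorem harmonic_nonneg_real (n : ℕ) : (0 : ℝ) ≤ (harmonic n : ℝ) := by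
  have : (0 : ℚ) ≤ harmonic n := by
    unfold harmonic
    positivity
  exact_mod_cast this

theorem harmonic_le_factorial (n : ℕ) : (harmonic n : ℝ) ≤ (n.factorial : ℝ) := by
  have h : ∀ n : ℕ, harmonic n ≤ n := by
    intro n
    induction n with
    | zero => simp
    | succ n ih =>
      rw [harmonic_succ]
      push_cast
      have : ((n : ℚ) + 1)⁻¹ ≤ 1 := inv_le_one_of_one_le₀ (by linarith [n.cast_nonneg (α := ℚ)])
      linarith
  have h1 : (harmonic n : ℝ) ≤ n := by exact_mod_cast h n
  exact h1.trans (by exact_mod_cast n.self_le_factorial)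

theorem factorialDecay_cI0 : FactorialDecay cI0 := by
  refine ⟨1, fun n => ?_⟩
  have : (1 : ℝ) ≤ n.factorial := by exact_mod_cast n.factorial_pos
  rw [cI0, abs_of_nonneg (by positivity)]
  gcongr
  nlinarith

theorem factorialDecay_cI1 : FactorialDecay cI1 := by
  refine ⟨1, fun n => ?_⟩
  have : (1 : ℝ) ≤ (n + 1).factorial := by exact_mod_cast (n + 1).factorial_pos
  have h : (0 : ℝ) < n.factorial := by positivity
  rw [cI1, abs_of_nonneg (by positivity)]
  gcongr
  nlinarith

theorem factorialDecay_cP0 : FactorialDecay cP0 := by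
  refine ⟨1, fun n => ?_⟩
  have h : (0 : ℝ) < n.factorial := by positivity
  rw [cP0, abs_of_nonneg (div_nonneg (harmonic_nonneg_real n) (by positivity)),
    div_le_div_iff₀ (by positivity) h]
  nlinarith [harmonic_le_factorial n]

theorem factorialDecay_cP1 : FactorialDecay cP1 := by
  refine ⟨2, fun n => ?_⟩
  have h : (0 : ℝ) < n.factorial := by positivity
  have h1 : (0 : ℝ) < (n + 1).factorial := by positivity
  have h2 := harmonic_le_factorial n
  have h3 := harmonic_le_factorial (n + 1)
  have h4 : (n.factorial : ℝ) ≤ (n + 1).factorial := by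
    exact_mod_cast Nat.factorial_le (Nat.le_succ n)
  rw [cP1, abs_of_nonneg (div_nonneg
    (add_nonneg (harmonic_nonneg_real _) (harmonic_nonneg_real n)) (by positivity)),
    div_le_div_iff₀ (by positivity) h]
  nlinarith

theorem I0_eq (z : ℝ) : I0 z = powerSum cI0 (z ^ 2 / 4) := by
  refine tsum_congr fun n => ?_
  rw [cI0, pow_mul, show (z / 2) ^ 2 = z ^ 2 / 4 by ring]

theorem I1_eq (z : ℝ) : I1 z = z / 2 * powerSum cI1 (z ^ 2 / 4) := by
  rw [powerSum, ← tsum_mul_left]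
  refine tsum_congr fun n => ?_
  rw [cI1, pow_succ, pow_mul, show (z / 2) ^ 2 = z ^ 2 / 4 by ring]
  ring

theorem K0_eq (z : ℝ) :
    K0 z = -(Real.log (z / 2) + Real.eulerMascheroniConstant) * powerSum cI0 (z ^ 2 / 4)
      + powerSum cP0 (z ^ 2 / 4) := by
  rw [K0, I0_eq]
  congr 1
  refine tsum_congr fun n => ?_
  rw [cP0, pow_mul, show (z / 2) ^ 2 = z ^ 2 / 4 by ring]

theorem K1_eq (z : ℝ) :
    K1 z = 1 / z + (Real.log (z / 2) + Real.eulerMascheroniConstant)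
        * (z / 2 * powerSum cI1 (z ^ 2 / 4))
      - 1 / 2 * (z / 2 * powerSum cP1 (z ^ 2 / 4)) := by
  rw [K1, I1_eq]
  congr 2
  rw [powerSum, ← tsum_mul_left]
  refine tsum_congr fun n => ?_
  rw [cP1, pow_succ, pow_mul, show (z / 2) ^ 2 = z ^ 2 / 4 by ring]
  ring

/-! ### The logarithmic singularity of the fundamental sequence -/

/-- Every `Φ_n` has the same leading singularity `-log r`: since `a_{n,0} = 1`, the factor of
`-log r` is `1 + O(r²)`, and `K₁` enters only multiplied by odd powers of `r`, which absorb its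
pole. -/
theorem exists_Phi_eq {c κ : ℝ} (hc : 0 < c) (hκ : 0 < κ) (n : ℕ) :
    ∃ A B : ℝ → ℝ, ContDiff ℝ 2 A ∧ ContDiff ℝ 2 B ∧
      ∀ r : ℝ, 0 < r →
        Phi c κ n r = -Real.log r * (1 + r ^ 2 * A (r ^ 2)) + B (r ^ 2) := by
  set g := gamma c κ with hg
  have hg0 : 0 < g := div_pos hκ hc
  let V' : ℝ → ℝ := fun u =>
    ∑ k ∈ Finset.range (n / 2), coeff c κ n (2 * (k + 1)) * u ^ k
  let W' : ℝ → ℝ := fun u =>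
    ∑ k ∈ Finset.range ((n + 1) / 2), coeff c κ n (2 * k + 1) * u ^ k
  have hv : ∀ r, v c κ n r = 1 + r ^ 2 * V' (r ^ 2) := by
    intro r
    rw [v, Finset.sum_range_succ', add_comm]
    simp only [mul_zero, coeff_zero, pow_zero, mul_one, V', Finset.mul_sum]
    congr 1
    refine Finset.sum_congr rfl fun k _ => ?_
    rw [pow_mul, pow_succ]; ring
  have hw : ∀ r, w c κ n r = r * W' (r ^ 2) := by
    intro r
    simp only [w, W', Finset.mul_sum]
    refine Finset.sum_congr rfl fun k _ => ?_
    rw [pow_succ, pow_mul]; ring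
  have hV' : ContDiff ℝ 2 V' := by
    refine ContDiff.sum fun k _ => ?_
    fun_prop
  have hW' : ContDiff ℝ 2 W' := by
    refine ContDiff.sum fun k _ => ?_
    fun_prop
  have hcomp : ∀ {d : ℕ → ℝ}, FactorialDecay d →
      ContDiff ℝ 2 fun u : ℝ => powerSum d (g ^ 2 * u / 4) := by
    intro d hd
    exact (hd.contDiff 2).comp (by fun_prop : ContDiff ℝ 2 fun u : ℝ => g ^ 2 * u / 4)
  let a : ℝ → ℝ := fun u =>
    g ^ 2 / 4 * powerSum (fun n => cI0 (n + 1)) (g ^ 2 * u / 4)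
      + powerSum cI0 (g ^ 2 * u / 4) * V' u - g / 2 * powerSum cI1 (g ^ 2 * u / 4) * W' u
  let b : ℝ → ℝ := fun u =>
    -(Real.log (g / 2) + Real.eulerMascheroniConstant) * (1 + u * a u)
      + powerSum cP0 (g ^ 2 * u / 4) * (1 + u * V' u) + 1 / g * W' u
      - g / 4 * u * powerSum cP1 (g ^ 2 * u / 4) * W' u
  have ha : ContDiff ℝ 2 a := by
    have h1 := hcomp factorialDecay_cI0
    have h2 := hcomp factorialDecay_cI1
    have h3 := hcomp factorialDecay_cI0.tail
    fun_prop
  have hb : ContDiff ℝ 2 b := by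
    have h1 := hcomp factorialDecay_cP0
    have h2 := hcomp factorialDecay_cP1
    fun_prop
  refine ⟨a, b, ha, hb, fun r hr => ?_⟩
  have hlog : Real.log (g * r / 2) = Real.log r + Real.log (g / 2) := by
    rw [← Real.log_mul hr.ne' (by positivity)]
    congr 1
    ring
  have hI0 := factorialDecay_cI0.powerSum_eq (g ^ 2 * r ^ 2 / 4)
  have hc0 : cI0 0 = 1 := by simp [cI0]
  have hA : 1 + r ^ 2 * a (r ^ 2) = powerSum cI0 (g ^ 2 * r ^ 2 / 4) * v c κ n r
      - g / 2 * r * powerSum cI1 (g ^ 2 * r ^ 2 / 4) * w c κ n r := by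
    simp only [a, hv, hw]
    rw [hI0, hc0]
    ring
  have hA' := hA
  simp only [hv, hw] at hA'
  rw [Phi, K0_eq, K1_eq, ← hg, hlog, mul_pow]
  simp only [b, hv, hw]
  rw [hA']
  field_simp
  ring

/-! ### An integral representation of `K₀` -/

/-- The weight of the heat-kernel representation of `K₀`. -/
def heatWeight (u τ : ℝ) : ℝ := Real.exp (-τ - u / τ)

theorem heatWeight_pos (u τ : ℝ) : 0 < heatWeight u τ := Real.exp_pos _

theorem measurable_heatWeight (u : ℝ) : Measurable (heatWeight u) := by
  unfold heatWeight
  fun_prop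

theorem heatWeight_div_pow_le {u τ : ℝ} (hu : 0 < u) (hτ : 0 < τ) (k : ℕ) :
    heatWeight u τ / τ ^ k ≤ (k.factorial : ℝ) / u ^ k * Real.exp (-τ) := by
  have h := Real.pow_div_factorial_le_exp (x := u / τ) (by positivity) k
  rw [heatWeight, sub_eq_add_neg, Real.exp_add, Real.exp_neg (u / τ)]
  rw [div_pow, div_div, div_le_iff₀ (by positivity)] at h
  have hk : (0 : ℝ) < k.factorial := by positivity
  have he := Real.exp_pos (u / τ)
  calc Real.exp (-τ) * (Real.exp (u / τ))⁻¹ / τ ^ k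
      = 1 / (Real.exp (u / τ) * τ ^ k) * Real.exp (-τ) := by field_simp
    _ ≤ (k.factorial : ℝ) / u ^ k * Real.exp (-τ) := by
      refine mul_le_mul_of_nonneg_right ?_ (Real.exp_pos _).le
      rw [div_le_div_iff₀ (by positivity) (by positivity)]
      linarith

theorem heatWeight_le_exp {u τ : ℝ} (hu : 0 ≤ u) (hτ : 0 < τ) :
    heatWeight u τ ≤ Real.exp (-τ) := by
  refine Real.exp_le_exp.2 ?_
  have : 0 ≤ u / τ := by positivity
  linarith

theorem integrableOn_mul_heatWeight_div_pow {h : ℝ → ℝ} (hm : Measurable h)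
    (hh : IntegrableOn (fun τ => h τ * Real.exp (-τ)) (Set.Ioi 0)) {u : ℝ} (hu : 0 < u) (k : ℕ) :
    IntegrableOn (fun τ => h τ * (heatWeight u τ / τ ^ k)) (Set.Ioi 0) := by
  refine Integrable.mono' (hh.norm.const_mul ((k.factorial : ℝ) / u ^ k))
    (hm.mul ((measurable_heatWeight u).div (by fun_prop))).aestronglyMeasurable ?_
  filter_upwards [ae_restrict_mem measurableSet_Ioi] with τ hτ
  have hτ : 0 < τ := hτ
  have := heatWeight_div_pow_le hu hτ k
  have h0 := heatWeight_pos u τ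
  rw [norm_mul, norm_mul, Real.norm_eq_abs (Real.exp _), abs_of_pos (Real.exp_pos _),
    Real.norm_eq_abs (_ / _), abs_of_pos (by positivity)]
  calc ‖h τ‖ * (heatWeight u τ / τ ^ k) ≤ ‖h τ‖ * ((k.factorial : ℝ) / u ^ k * Real.exp (-τ)) := by
        gcongr
    _ = _ := by ring

theorem integrableOn_exp_neg : IntegrableOn (fun τ : ℝ => Real.exp (-τ)) (Set.Ioi 0) :=
  integrableOn_exp_neg_Ioi 0

theorem integrableOn_heatWeight_div_pow {u : ℝ} (hu : 0 < u) (k : ℕ) :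
    IntegrableOn (fun τ => heatWeight u τ / τ ^ k) (Set.Ioi 0) := by
  simpa using integrableOn_mul_heatWeight_div_pow (h := fun _ => 1) measurable_const
    (by simpa using integrableOn_exp_neg) hu k

theorem integral_log_mul_exp_neg :
    ∫ τ in Set.Ioi (0 : ℝ), Real.log τ * Real.exp (-τ) = -Real.eulerMascheroniConstant := by
  have h1 := Complex.hasDerivAt_GammaIntegral (s := 1) (by simp)
  have h2 : HasDerivAt Complex.GammaIntegral (-(Real.eulerMascheroniConstant : ℂ)) 1 := by
    refine Complex.hasDerivAt_Gamma_one.congr_of_eventuallyEq ?_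
    have : ∀ᶠ s : ℂ in 𝓝 1, 0 < s.re :=
      (isOpen_lt continuous_const Complex.continuous_re).mem_nhds (by simp)
    filter_upwards [this] with s hs
    exact (Complex.Gamma_eq_integral hs).symm
  have h3 := h1.unique h2
  have h4 : (∫ t : ℝ in Set.Ioi 0, (t : ℂ) ^ ((1 : ℂ) - 1) * (Real.log t * Real.exp (-t)))
      = ((∫ τ in Set.Ioi (0 : ℝ), Real.log τ * Real.exp (-τ) : ℝ) : ℂ) := by
    rw [← integral_complex_ofReal]
    refine integral_congr_ae (Eventually.of_forall fun t => ?_)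
    simp
  rw [h4] at h3
  exact_mod_cast h3

theorem integrableOn_log_mul_exp_neg :
    IntegrableOn (fun τ : ℝ => Real.log τ * Real.exp (-τ)) (Set.Ioi 0) := by
  -- A non-integrable function would have integral zero, but this integral is `-γ ≠ 0`.
  by_contra h
  have h1 := integral_log_mul_exp_neg
  rw [integral_undef h] at h1
  have := Real.one_half_lt_eulerMascheroniConstant
  linarith

theorem integral_Ioi_deriv_eq_zero {f f' : ℝ → ℝ}
    (hderiv : ∀ τ, 0 < τ → HasDerivAt f (f' τ) τ) (hint : IntegrableOn f' (Set.Ioi 0))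
    (h0 : Tendsto f (𝓝[>] 0) (𝓝 0)) (htop : Tendsto f atTop (𝓝 0)) :
    ∫ τ in Set.Ioi (0 : ℝ), f' τ = 0 := by
  classical
  have key := integral_Ioi_of_hasDerivAt_of_tendsto (f := Function.update f 0 0) (f' := f')
    (a := 0) (m := 0) ?_ ?_ hint ?_
  · simpa using key
  · rw [continuousWithinAt_update_same]
    refine h0.mono_left (nhdsWithin_mono _ ?_)
    intro x hx
    exact lt_of_le_of_ne hx.1 (Ne.symm hx.2)
  · intro τ hτ
    refine (hderiv τ hτ).congr_of_eventuallyEq ?_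
    filter_upwards [lt_mem_nhds hτ] with t ht
    exact Function.update_of_ne ht.ne' _ _
  · refine htop.congr' ?_
    filter_upwards [eventually_gt_atTop 0] with t ht
    exact (Function.update_of_ne ht.ne' _ _).symm

theorem hasDerivAt_heatWeight {u τ : ℝ} (hτ : 0 < τ) :
    HasDerivAt (heatWeight u) (u * (heatWeight u τ / τ ^ 2) - heatWeight u τ) τ := by
  have h : HasDerivAt (fun t : ℝ => -t - u / t) (-1 - -u / τ ^ 2) τ := by
    have h1 := (hasDerivAt_const τ u).div (hasDerivAt_id τ) hτ.ne'
    exact ((hasDerivAt_id τ).neg.sub h1).congr_deriv (by simp)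
  refine h.exp.congr_deriv ?_
  simp only [heatWeight]
  ring

theorem hasDerivAt_heatWeight_param (τ u : ℝ) :
    HasDerivAt (fun u => heatWeight u τ) (-(heatWeight u τ / τ)) u := by
  have h : HasDerivAt (fun u : ℝ => -τ - u / τ) (-(1 / τ)) u := by
    have := ((hasDerivAt_id u).div_const τ).const_sub (-τ)
    simpa using this
  refine h.exp.congr_deriv ?_
  simp only [heatWeight]
  ring

theorem tendsto_exp_neg_atTop : Tendsto (fun τ : ℝ => Real.exp (-τ)) atTop (𝓝 0) :=
  Real.tendsto_exp_neg_atTop_nhds_zero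

theorem tendsto_heatWeight_zero {u : ℝ} (hu : 0 < u) :
    Tendsto (heatWeight u) (𝓝[>] 0) (𝓝 0) := by
  have h1 : Tendsto (fun τ : ℝ => 1 / u * τ) (𝓝[>] 0) (𝓝 0) := by
    have : Tendsto (fun τ : ℝ => 1 / u * τ) (𝓝 0) (𝓝 (1 / u * 0)) :=
      (continuous_const.mul continuous_id).tendsto 0
    rw [mul_zero] at this
    exact this.mono_left nhdsWithin_le_nhds
  refine squeeze_zero' (Eventually.of_forall fun τ => (heatWeight_pos u τ).le) ?_ h1
  filter_upwards [self_mem_nhdsWithin] with τ hτ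
  have hτ : 0 < τ := hτ
  have h := heatWeight_div_pow_le hu hτ 1
  have h2 : Real.exp (-τ) ≤ 1 := Real.exp_le_one_iff.2 (by linarith)
  rw [pow_one, pow_one, Nat.factorial_one, Nat.cast_one, div_le_iff₀ hτ] at h
  refine h.trans ?_
  gcongr
  exact mul_le_of_le_one_right (by positivity) h2

theorem tendsto_heatWeight_atTop {u : ℝ} (hu : 0 < u) :
    Tendsto (heatWeight u) atTop (𝓝 0) := by
  refine squeeze_zero' (Eventually.of_forall fun τ => (heatWeight_pos u τ).le) ?_
    tendsto_exp_neg_atTop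
  filter_upwards [eventually_gt_atTop 0] with τ hτ
  exact heatWeight_le_exp hu.le hτ

theorem tendsto_log_mul_heatWeight_zero {u : ℝ} (hu : 0 < u) :
    Tendsto (fun τ => Real.log τ * heatWeight u τ) (𝓝[>] 0) (𝓝 0) := by
  have h1 : Tendsto (fun τ : ℝ => 1 / u * |Real.log τ * τ|) (𝓝[>] 0) (𝓝 0) := by
    have := (tendsto_log_mul_rpow_nhdsGT_zero zero_lt_one).abs.const_mul (1 / u)
    simpa using this
  refine squeeze_zero_norm' ?_ h1
  filter_upwards [self_mem_nhdsWithin] with τ hτ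
  have hτ : 0 < τ := hτ
  have h := heatWeight_div_pow_le hu hτ 1
  have h2 : Real.exp (-τ) ≤ 1 := Real.exp_le_one_iff.2 (by linarith)
  rw [pow_one, pow_one, Nat.factorial_one, Nat.cast_one, div_le_iff₀ hτ] at h
  rw [norm_mul, Real.norm_eq_abs, Real.norm_eq_abs, abs_of_pos (heatWeight_pos u τ), abs_mul,
    abs_of_pos hτ]
  have h3 : heatWeight u τ ≤ 1 / u * τ := by
    refine h.trans ?_
    gcongr
    exact mul_le_of_le_one_right (by positivity) h2
  calc |Real.log τ| * heatWeight u τ ≤ |Real.log τ| * (1 / u * τ) := by gcongr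
    _ = _ := by ring

theorem tendsto_log_mul_heatWeight_atTop {u : ℝ} (hu : 0 < u) :
    Tendsto (fun τ => Real.log τ * heatWeight u τ) atTop (𝓝 0) := by
  have h1 : Tendsto (fun τ : ℝ => τ * Real.exp (-τ)) atTop (𝓝 0) := by
    simpa using Real.tendsto_pow_mul_exp_neg_atTop_nhds_zero 1
  refine squeeze_zero' ?_ ?_ h1
  · filter_upwards [eventually_ge_atTop 1] with τ hτ
    exact mul_nonneg (Real.log_nonneg hτ) (heatWeight_pos u τ).le
  · filter_upwards [eventually_ge_atTop 1] with τ hτ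
    have : Real.log τ ≤ τ := (Real.log_le_sub_one_of_pos (by linarith)).trans (by linarith)
    have h2 := heatWeight_le_exp (τ := τ) hu.le (by linarith)
    have h3 := (heatWeight_pos u τ).le
    gcongr

/-- `∫ w dτ`, which equals `-2 u d/du K₀` for `u = z² / 4`. -/
def heatG (u : ℝ) : ℝ := ∫ τ in Set.Ioi (0 : ℝ), heatWeight u τ

/-- `∫ w dτ/τ`, which is shown to equal `2 K₀(z)` for `u = z² / 4`. -/
def heatF (u : ℝ) : ℝ := ∫ τ in Set.Ioi (0 : ℝ), heatWeight u τ / τ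

theorem mul_integral_heatWeight_div_sq {u : ℝ} (hu : 0 < u) :
    u * ∫ τ in Set.Ioi (0 : ℝ), heatWeight u τ / τ ^ 2 = heatG u := by
  have h2 := integrableOn_heatWeight_div_pow hu 2
  have h0 := integrableOn_heatWeight_div_pow hu 0
  simp only [pow_zero, div_one] at h0
  have h := integral_Ioi_deriv_eq_zero (fun τ hτ => hasDerivAt_heatWeight (u := u) hτ)
    ((h2.const_mul u).sub h0) (tendsto_heatWeight_zero hu) (tendsto_heatWeight_atTop hu)
  rw [integral_sub (h2.const_mul u) h0, integral_const_mul] at h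
  rw [heatG]
  linarith

theorem hasDerivAt_integral_heatWeight_div_pow {u : ℝ} (hu : 0 < u) (k : ℕ) :
    HasDerivAt (fun u => ∫ τ in Set.Ioi (0 : ℝ), heatWeight u τ / τ ^ k)
      (-∫ τ in Set.Ioi (0 : ℝ), heatWeight u τ / τ ^ (k + 1)) u := by
  have hu2 : 0 < u / 2 := by linarith
  have key := hasDerivAt_integral_of_dominated_loc_of_deriv_le
    (μ := volume.restrict (Set.Ioi (0 : ℝ)))
    (F := fun u τ => heatWeight u τ / τ ^ k) (F' := fun u τ => -(heatWeight u τ / τ ^ (k + 1)))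
    (x₀ := u) (s := Set.Ioi (u / 2)) (bound := fun τ => heatWeight (u / 2) τ / τ ^ (k + 1))
    (Ioi_mem_nhds (by linarith))
    (Eventually.of_forall fun u =>
      ((measurable_heatWeight u).div (by fun_prop)).aestronglyMeasurable)
    (integrableOn_heatWeight_div_pow hu k)
    ((measurable_heatWeight u).div (by fun_prop)).neg.aestronglyMeasurable
    ?_ (integrableOn_heatWeight_div_pow hu2 (k + 1)) ?_
  · rw [← integral_neg]
    exact key.2
  · filter_upwards [ae_restrict_mem measurableSet_Ioi] with τ hτ y hy
    have hτ : 0 < τ := hτ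
    have hy : u / 2 < y := hy
    have h0 := heatWeight_pos y τ
    rw [norm_neg, Real.norm_eq_abs, abs_of_pos (by positivity)]
    gcongr
    exact Real.exp_le_exp.2 (by gcongr)
  · filter_upwards [ae_restrict_mem measurableSet_Ioi] with τ hτ y hy
    have hτ : 0 < τ := hτ
    refine ((hasDerivAt_heatWeight_param τ y).div_const (τ ^ k)).congr_deriv ?_
    rw [pow_succ]
    field_simp

theorem hasDerivAt_heatG {u : ℝ} (hu : 0 < u) : HasDerivAt heatG (-heatF u) u := by
  have h := hasDerivAt_integral_heatWeight_div_pow hu 0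
  simp only [pow_zero, div_one, zero_add, pow_one] at h
  exact h

theorem hasDerivAt_heatF {u : ℝ} (hu : 0 < u) : HasDerivAt heatF (-(heatG u / u)) u := by
  rw [← mul_integral_heatWeight_div_sq hu, mul_div_cancel_left₀ _ hu.ne']
  have h := hasDerivAt_integral_heatWeight_div_pow hu 1
  simp only [pow_one] at h
  exact h

/-- `∫ log τ w dτ`. -/
def heatL (u : ℝ) : ℝ := ∫ τ in Set.Ioi (0 : ℝ), Real.log τ * heatWeight u τ

/-- The substitution `τ ↦ u / τ` preserves the weight. -/
theorem integral_log_mul_heatWeight_div_sq {u : ℝ} (hu : 0 < u) :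
    u * ∫ τ in Set.Ioi (0 : ℝ), Real.log τ * (heatWeight u τ / τ ^ 2)
      = Real.log u * heatG u - heatL u := by
  have h1 := integral_comp_rpow_Ioi
    (fun y => Real.log (u * y) * heatWeight u (u * y)) (p := -1) (by norm_num)
  have h2 := integral_comp_mul_left_Ioi (fun τ => Real.log τ * heatWeight u τ) 0 hu
  rw [mul_zero] at h2
  rw [h2] at h1
  have i2 := integrableOn_heatWeight_div_pow hu 2
  have il := integrableOn_mul_heatWeight_div_pow Real.measurable_log
    integrableOn_log_mul_exp_neg hu 2
  have h3 : ∫ τ in Set.Ioi (0 : ℝ), (|(-1 : ℝ)| * τ ^ ((-1 : ℝ) - 1)) •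
      (Real.log (u * τ ^ (-1 : ℝ)) * heatWeight u (u * τ ^ (-1 : ℝ)))
      = ∫ τ in Set.Ioi (0 : ℝ), (Real.log u * (heatWeight u τ / τ ^ 2)
        - Real.log τ * (heatWeight u τ / τ ^ 2)) := by
    refine setIntegral_congr_fun measurableSet_Ioi fun τ hτ => ?_
    have hτ : 0 < τ := hτ
    have e1 : τ ^ ((-1 : ℝ) - 1) = (τ ^ 2)⁻¹ := by
      rw [show (-1 : ℝ) - 1 = -(2 : ℕ) by norm_num, Real.rpow_neg hτ.le, Real.rpow_natCast]
    have e2 : heatWeight u (u * τ⁻¹) = heatWeight u τ := by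
      rw [heatWeight, heatWeight]
      congr 1
      field_simp
      ring
    simp only [e1, Real.rpow_neg_one, e2, abs_neg, abs_one, one_mul, smul_eq_mul]
    rw [Real.log_mul hu.ne' (by positivity), Real.log_inv]
    ring
  rw [h3, integral_sub (i2.const_mul _) il, integral_const_mul] at h1
  have h4 := mul_integral_heatWeight_div_sq hu
  simp only [smul_eq_mul] at h1
  rw [show (∫ τ in Set.Ioi (0 : ℝ), Real.log τ * heatWeight u τ) = heatL u from rfl] at h1
  have h5 : u * (u⁻¹ * heatL u) = heatL u := by field_simp
  rw [← h5, ← h1, ← h4]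
  ring

theorem heatF_eq {u : ℝ} (hu : 0 < u) : heatF u = 2 * heatL u - Real.log u * heatG u := by
  have i1 := integrableOn_heatWeight_div_pow hu 1
  have il2 := integrableOn_mul_heatWeight_div_pow Real.measurable_log
    integrableOn_log_mul_exp_neg hu 2
  have il0 := integrableOn_mul_heatWeight_div_pow Real.measurable_log
    integrableOn_log_mul_exp_neg hu 0
  simp only [pow_one, pow_zero, div_one] at i1 il0
  have h := integral_Ioi_deriv_eq_zero (f := fun τ => Real.log τ * heatWeight u τ)
    (f' := fun τ => heatWeight u τ / τ +
      (u * (Real.log τ * (heatWeight u τ / τ ^ 2)) - Real.log τ * heatWeight u τ))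
    (fun τ hτ => by
      refine ((Real.hasDerivAt_log hτ.ne').mul
        (hasDerivAt_heatWeight (u := u) hτ)).congr_deriv ?_
      ring)
    (i1.add ((il2.const_mul u).sub il0))
    (tendsto_log_mul_heatWeight_zero hu) (tendsto_log_mul_heatWeight_atTop hu)
  rw [integral_add (g := fun τ => u * (Real.log τ * (heatWeight u τ / τ ^ 2))
      - Real.log τ * heatWeight u τ) i1 ((il2.const_mul u).sub il0),
    integral_sub (il2.const_mul u) il0, integral_const_mul,
    integral_log_mul_heatWeight_div_sq hu] at h
  rw [show (∫ τ in Set.Ioi (0 : ℝ), Real.log τ * heatWeight u τ) = heatL u from rfl] at h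
  rw [heatF]
  linarith

theorem tendsto_heatL : Tendsto heatL (𝓝[>] 0) (𝓝 (-Real.eulerMascheroniConstant)) := by
  rw [← integral_log_mul_exp_neg]
  refine tendsto_integral_filter_of_dominated_convergence
    (fun τ => ‖Real.log τ * Real.exp (-τ)‖) (Eventually.of_forall fun u =>
      (Real.measurable_log.mul (measurable_heatWeight u)).aestronglyMeasurable) ?_
      integrableOn_log_mul_exp_neg.norm ?_
  · filter_upwards [self_mem_nhdsWithin] with u hu
    filter_upwards [ae_restrict_mem measurableSet_Ioi] with τ hτ
    rw [norm_mul, norm_mul]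
    gcongr
    rw [Real.norm_eq_abs, Real.norm_eq_abs, abs_of_pos (heatWeight_pos u τ),
      abs_of_pos (Real.exp_pos _)]
    exact heatWeight_le_exp (le_of_lt hu) hτ
  · filter_upwards [ae_restrict_mem measurableSet_Ioi] with τ hτ
    have : Continuous fun u => Real.log τ * heatWeight u τ := by
      unfold heatWeight
      fun_prop
    have h := (this.tendsto 0).mono_left (nhdsWithin_le_nhds (s := Set.Ioi 0))
    simpa [heatWeight] using h

theorem one_sub_exp_neg_le_sqrt {x : ℝ} (hx : 0 ≤ x) : 1 - Real.exp (-x) ≤ √x := by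
  rcases le_total x 1 with h | h
  · have h1 := Real.add_one_le_exp (-x)
    have h2 : x ≤ √x := Real.le_sqrt_of_sq_le (by nlinarith)
    linarith
  · have h1 := Real.exp_pos (-x)
    have h2 : 1 ≤ √x := Real.one_le_sqrt.2 h
    linarith

theorem abs_one_sub_heatG_le {u : ℝ} (hu : 0 < u) : |1 - heatG u| ≤ √u * Real.Gamma (1 / 2) := by
  have i0 := integrableOn_heatWeight_div_pow hu 0
  simp only [pow_zero, div_one] at i0
  have ig := Real.GammaIntegral_convergent (s := 1 / 2) (by norm_num)
  have h1 : 1 - heatG u = ∫ τ in Set.Ioi (0 : ℝ), (Real.exp (-τ) - heatWeight u τ) := by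
    rw [integral_sub integrableOn_exp_neg i0, integral_exp_neg_Ioi_zero, heatG]
  have h2 : ∀ τ ∈ Set.Ioi (0 : ℝ), 0 ≤ Real.exp (-τ) - heatWeight u τ := fun τ hτ =>
    sub_nonneg.2 (heatWeight_le_exp hu.le hτ)
  rw [h1, abs_of_nonneg (setIntegral_nonneg measurableSet_Ioi h2),
    Real.Gamma_eq_integral (by norm_num), ← integral_const_mul]
  refine setIntegral_mono_on (integrableOn_exp_neg.sub i0) (ig.const_mul _) measurableSet_Ioi ?_
  intro τ hτ
  have hτ : 0 < τ := hτ
  have h3 := one_sub_exp_neg_le_sqrt (x := u / τ) (by positivity)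
  have h4 : heatWeight u τ = Real.exp (-τ) * Real.exp (-(u / τ)) := by
    rw [heatWeight, sub_eq_add_neg, Real.exp_add]
  have h5 : τ ^ ((1 : ℝ) / 2 - 1) = (√τ)⁻¹ := by
    rw [show (1 : ℝ) / 2 - 1 = -(1 / 2) by norm_num, Real.rpow_neg hτ.le, ← Real.sqrt_eq_rpow]
  rw [h4, h5]
  rw [Real.sqrt_div' _ hτ.le] at h3
  calc Real.exp (-τ) - Real.exp (-τ) * Real.exp (-(u / τ))
      = Real.exp (-τ) * (1 - Real.exp (-(u / τ))) := by ring
    _ ≤ Real.exp (-τ) * (√u / √τ) := by gcongr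
    _ = _ := by ring

theorem tendsto_sqrt_zero : Tendsto (fun u : ℝ => √u) (𝓝[>] 0) (𝓝 0) := by
  have := Real.continuous_sqrt.tendsto 0
  rw [Real.sqrt_zero] at this
  exact this.mono_left nhdsWithin_le_nhds

theorem tendsto_heatG : Tendsto heatG (𝓝[>] 0) (𝓝 1) := by
  have h : Tendsto (fun u => 1 - heatG u) (𝓝[>] 0) (𝓝 0) := by
    have h0 := tendsto_sqrt_zero.mul_const (Real.Gamma (1 / 2))
    rw [zero_mul] at h0
    refine squeeze_zero_norm' ?_ h0
    filter_upwards [self_mem_nhdsWithin] with u hu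
    exact abs_one_sub_heatG_le hu
  simpa using h.const_sub 1

theorem tendsto_heatF_add_log :
    Tendsto (fun u => heatF u + Real.log u) (𝓝[>] 0)
      (𝓝 (-(2 * Real.eulerMascheroniConstant))) := by
  have h : Tendsto (fun u => Real.log u * (1 - heatG u)) (𝓝[>] 0) (𝓝 0) := by
    have h1 : Tendsto (fun u => |Real.log u * u ^ ((1 : ℝ) / 2)| * Real.Gamma (1 / 2)) (𝓝[>] 0)
        (𝓝 0) := by
      have := (tendsto_log_mul_rpow_nhdsGT_zero (r := 1 / 2) (by norm_num)).abs.mul_const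
        (Real.Gamma (1 / 2))
      simpa using this
    refine squeeze_zero_norm' ?_ h1
    filter_upwards [self_mem_nhdsWithin] with u hu
    have := abs_one_sub_heatG_le hu
    rw [norm_mul, Real.norm_eq_abs, Real.norm_eq_abs, abs_mul, ← Real.sqrt_eq_rpow,
      abs_of_nonneg (Real.sqrt_nonneg u), mul_assoc]
    gcongr
  have h2 := (tendsto_heatL.const_mul 2).add h
  rw [add_zero, mul_neg] at h2
  refine h2.congr' ?_
  filter_upwards [self_mem_nhdsWithin] with u hu
  rw [heatF_eq hu]
  ring

/-- `2 K₀(z)` as a function of `u = z² / 4`. -/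
def seriesF (u : ℝ) : ℝ :=
  -(Real.log u + 2 * Real.eulerMascheroniConstant) * powerSum cI0 u + 2 * powerSum cP0 u

/-- `-u` times the derivative of `seriesF`. -/
def seriesG (u : ℝ) : ℝ :=
  powerSum cI0 u + (Real.log u + 2 * Real.eulerMascheroniConstant) * (u * powerSum cI1 u)
    - 2 * (u * powerSum (shiftCoeff cP0) u)

theorem FactorialDecay.powerSum_add_mul_shiftCoeff {c : ℕ → ℝ} (hc : FactorialDecay c) (u : ℝ) :
    powerSum c u + u * powerSum (LaguerreBIE.shiftCoeff c) u
      = powerSum (fun n => (n + 1) * c n) u := by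
  have hs : Summable fun n : ℕ => (n : ℝ) * c n * u ^ n := by
    rw [← summable_nat_add_iff 1]
    refine ((hc.shiftCoeff.summable u).mul_left u).congr fun n => ?_
    rw [LaguerreBIE.shiftCoeff]
    push_cast
    ring
  have h : u * powerSum (LaguerreBIE.shiftCoeff c) u = ∑' n : ℕ, (n : ℝ) * c n * u ^ n := by
    rw [hs.tsum_eq_zero_add, powerSum, ← tsum_mul_left]
    simp only [Nat.cast_zero, zero_mul, zero_add]
    refine tsum_congr fun n => ?_
    rw [LaguerreBIE.shiftCoeff]
    push_cast
    ring
  rw [h, powerSum, powerSum, ← (hc.summable u).tsum_add hs]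
  exact tsum_congr fun n => by ring

theorem shiftCoeff_cI0 : shiftCoeff cI0 = cI1 := by
  funext n
  rw [shiftCoeff, cI0, cI1, Nat.factorial_succ]
  have : (n.factorial : ℝ) ≠ 0 := by positivity
  push_cast
  field_simp

theorem succ_mul_cI1 : (fun n : ℕ => ((n : ℝ) + 1) * cI1 n) = cI0 := by
  funext n
  rw [cI0, cI1, Nat.factorial_succ]
  have : (n.factorial : ℝ) ≠ 0 := by positivity
  push_cast
  field_simp

theorem succ_mul_shiftCoeff_cP0 (n : ℕ) :
    ((n : ℝ) + 1) * shiftCoeff cP0 n = cP0 n + cI1 n := by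
  rw [shiftCoeff, cP0, cP0, cI1, Nat.factorial_succ, harmonic_succ]
  have : (n.factorial : ℝ) ≠ 0 := by positivity
  push_cast
  field_simp

theorem hasDerivAt_seriesF {u : ℝ} (hu : 0 < u) : HasDerivAt seriesF (-(seriesG u / u)) u := by
  have h1 := factorialDecay_cI0.hasDerivAt u
  have h2 := factorialDecay_cP0.hasDerivAt u
  rw [shiftCoeff_cI0] at h1
  refine (((((Real.hasDerivAt_log hu.ne').add_const
    (2 * Real.eulerMascheroniConstant)).neg).mul h1).add (h2.const_mul 2)).congr_deriv ?_
  simp only [seriesG, Pi.neg_apply]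
  field_simp
  ring

theorem hasDerivAt_seriesG {u : ℝ} (hu : 0 < u) : HasDerivAt seriesG (-seriesF u) u := by
  have h0 := factorialDecay_cI0.hasDerivAt u
  rw [shiftCoeff_cI0] at h0
  have h1 := (hasDerivAt_id u).mul (factorialDecay_cI1.hasDerivAt u)
  have h2 := (hasDerivAt_id u).mul (factorialDecay_cP0.shiftCoeff.hasDerivAt u)
  have e1 := factorialDecay_cI1.powerSum_add_mul_shiftCoeff u
  rw [succ_mul_cI1] at e1
  have e2 := factorialDecay_cP0.shiftCoeff.powerSum_add_mul_shiftCoeff u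
  have e3 : powerSum (fun n : ℕ => ((n : ℝ) + 1) * shiftCoeff cP0 n) u
      = powerSum cP0 u + powerSum cI1 u := by
    rw [powerSum, powerSum, powerSum, ← (factorialDecay_cP0.summable u).tsum_add
      (factorialDecay_cI1.summable u)]
    exact tsum_congr fun n => by rw [succ_mul_shiftCoeff_cP0]; ring
  rw [e3] at e2
  refine ((h0.add (((Real.hasDerivAt_log hu.ne').add_const
    (2 * Real.eulerMascheroniConstant)).mul h1)).sub (h2.const_mul 2)).congr_deriv ?_
  simp only [seriesF, id_eq, one_mul, Pi.mul_apply]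
  rw [e1, e2]
  field_simp
  ring

theorem tendsto_log_mul_self : Tendsto (fun u : ℝ => Real.log u * u) (𝓝[>] 0) (𝓝 0) := by
  simpa using tendsto_log_mul_rpow_nhdsGT_zero (r := 1) one_pos

theorem FactorialDecay.tendsto_powerSum {c : ℕ → ℝ} (hc : FactorialDecay c) :
    Tendsto (powerSum c) (𝓝[>] 0) (𝓝 (c 0)) := by
  rw [← powerSum_zero c]
  exact ((hc.hasDerivAt 0).continuousAt.tendsto).mono_left nhdsWithin_le_nhds

theorem tendsto_seriesF_add_log :
    Tendsto (fun u => seriesF u + Real.log u) (𝓝[>] 0)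
      (𝓝 (-(2 * Real.eulerMascheroniConstant))) := by
  have h1 := tendsto_log_mul_self.mul factorialDecay_cI0.tail.tendsto_powerSum
  have h2 := factorialDecay_cI0.tendsto_powerSum.const_mul (2 * Real.eulerMascheroniConstant)
  have h3 := factorialDecay_cP0.tendsto_powerSum.const_mul 2
  have h := (h3.sub h2).sub h1
  have e0 : cI0 0 = 1 := by simp [cI0]
  have e1 : cP0 0 = 0 := by simp [cP0]
  rw [e0, e1, zero_mul] at h
  simp only [mul_zero, mul_one, zero_sub, sub_zero] at h
  refine h.congr fun u => ?_
  rw [seriesF, factorialDecay_cI0.powerSum_eq u, e0]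
  ring

theorem tendsto_seriesG : Tendsto seriesG (𝓝[>] 0) (𝓝 1) := by
  have hu : Tendsto (fun u : ℝ => u) (𝓝[>] 0) (𝓝 0) := nhdsWithin_le_nhds
  have h1 := tendsto_log_mul_self.mul factorialDecay_cI1.tendsto_powerSum
  have h2 := (hu.mul factorialDecay_cI1.tendsto_powerSum).const_mul
    (2 * Real.eulerMascheroniConstant)
  have h3 := (hu.mul factorialDecay_cP0.shiftCoeff.tendsto_powerSum).const_mul 2
  have h := ((factorialDecay_cI0.tendsto_powerSum.add h1).add h2).sub h3
  have e0 : cI0 0 = 1 := by simp [cI0]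
  rw [e0] at h
  simp only [zero_mul, mul_zero, add_zero, sub_zero] at h
  refine h.congr fun u => ?_
  rw [seriesG]
  ring

theorem le_zero_of_deriv_nonpos {f f' : ℝ → ℝ} (hf : ∀ u, 0 < u → HasDerivAt f (f' u) u)
    (hf' : ∀ u, 0 < u → f' u ≤ 0) (h0 : Tendsto f (𝓝[>] 0) (𝓝 0)) {u : ℝ} (hu : 0 < u) :
    f u ≤ 0 := by
  have hanti : AntitoneOn f (Set.Ioi 0) := by
    refine antitoneOn_of_deriv_nonpos (convex_Ioi 0)
      (fun x hx => (hf x hx).continuousAt.continuousWithinAt)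
      (fun x hx => ?_) (fun x hx => ?_)
    · rw [interior_Ioi] at hx
      exact (hf x hx).differentiableAt.differentiableWithinAt
    · rw [interior_Ioi] at hx
      rw [(hf x hx).deriv]
      exact hf' x hx
  refine ge_of_tendsto h0 ?_
  filter_upwards [Ioo_mem_nhdsGT hu] with t ht
  exact hanti ht.1 hu ht.2.le

/-- The system `D' = -E / u`, `E' = -D` equivalent to the Bessel equation has no nontrivial
solution that vanishes at `0`. -/
theorem eq_zero_of_bessel_system {D E : ℝ → ℝ}
    (hD : ∀ u, 0 < u → HasDerivAt D (-(E u / u)) u) (hE : ∀ u, 0 < u → HasDerivAt E (-D u) u)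
    (hD0 : Tendsto D (𝓝[>] 0) (𝓝 0)) (hE0 : Tendsto E (𝓝[>] 0) (𝓝 0)) {u : ℝ} (hu : 0 < u) :
    D u = 0 := by
  -- `D E` decreases from `0`, so `D²` increases.
  have hDE : ∀ t, 0 < t → D t * E t ≤ 0 := fun t ht =>
    le_zero_of_deriv_nonpos (f := fun t => D t * E t) (fun s hs => (hD s hs).mul (hE s hs))
      (fun s hs => by
        have : 0 ≤ E s ^ 2 / s := by positivity
        have h2 : -(E s / s) * E s + D s * -D s = -(E s ^ 2 / s) - D s ^ 2 := by ring
        rw [h2]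
        nlinarith [sq_nonneg (D s)])
      (by simpa using hD0.mul hE0) ht
  have hmono : MonotoneOn (fun t => D t ^ 2) (Set.Ioi 0) := by
    have hd : ∀ t, 0 < t → HasDerivAt (fun t => D t ^ 2) (-(2 * (D t * E t) / t)) t :=
      fun t ht => ((hD t ht).pow 2).congr_deriv (by simp; ring)
    refine monotoneOn_of_deriv_nonneg (convex_Ioi 0)
      (fun x hx => (hd x hx).continuousAt.continuousWithinAt)
      (fun x hx => ?_) (fun x hx => ?_)
    · rw [interior_Ioi] at hx
      exact (hd x hx).differentiableAt.differentiableWithinAt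
    · rw [interior_Ioi] at hx
      have hx' : 0 < x := hx
      rw [(hd x hx).deriv, ← neg_div]
      exact div_nonneg (by linarith [hDE x hx]) hx'.le
  have hbound : ∀ t, 0 < t → |E t| ≤ |D t| * t := by
    intro t ht
    have h1 : ∀ ε, ε ∈ Set.Ioo 0 t → |E t - E ε| ≤ |D t| * (t - ε) := by
      intro ε hε
      have := (convex_Icc ε t).norm_image_sub_le_of_norm_hasDerivWithin_le
        (f := E) (f' := fun s => -D s) (C := |D t|) (x := ε) (y := t)
        (fun s hs => (hE s (hε.1.trans_le hs.1)).hasDerivWithinAt)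
        (fun s hs => by
          rw [norm_neg, Real.norm_eq_abs]
          exact sq_le_sq.1 (hmono (hε.1.trans_le hs.1) ht hs.2))
        ⟨le_rfl, hε.2.le⟩ ⟨hε.2.le, le_rfl⟩
      rwa [Real.norm_eq_abs, Real.norm_eq_abs, abs_of_pos (sub_pos.2 hε.2)] at this
    have h2 : Tendsto (fun ε => |E t - E ε|) (𝓝[>] 0) (𝓝 |E t|) := by
      simpa using (hE0.const_sub (E t)).abs
    refine le_of_tendsto h2 ?_
    filter_upwards [Ioo_mem_nhdsGT ht] with ε hε
    refine (h1 ε hε).trans ?_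
    gcongr
    linarith [hε.1]
  have hfin := le_zero_of_deriv_nonpos (f := fun t => D t ^ 2 * Real.exp (-(2 * t)))
    (f' := fun t => (-(2 * (D t * E t) / t) - 2 * D t ^ 2) * Real.exp (-(2 * t)))
    (fun t ht => by
      have h1 := (hD t ht).pow 2
      have h2 := ((hasDerivAt_id t).const_mul 2).neg.exp
      refine (h1.mul h2).congr_deriv ?_
      simp only [Pi.pow_apply, id, Pi.neg_apply]
      simp
      ring)
    (fun t ht => by
      refine mul_nonpos_of_nonpos_of_nonneg ?_ (Real.exp_pos _).le
      have h1 := hbound t ht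
      have h2 : |D t * E t| ≤ D t ^ 2 * t := by
        rw [abs_mul, ← sq_abs (D t)]
        nlinarith [abs_nonneg (D t)]
      have h3 : -(2 * (D t * E t) / t) ≤ 2 * D t ^ 2 := by
        rw [← neg_div, div_le_iff₀ ht]
        linarith [neg_abs_le (D t * E t)]
      linarith)
    (by
      have h1 : Tendsto (fun t : ℝ => Real.exp (-(2 * t))) (𝓝[>] 0) (𝓝 1) := by
        have : Continuous fun t : ℝ => Real.exp (-(2 * t)) := by fun_prop
        simpa using (this.tendsto 0).mono_left (nhdsWithin_le_nhds (s := Set.Ioi 0))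
      simpa using (hD0.pow 2).mul h1) hu
  have h4 : D u ^ 2 ≤ 0 := by
    have := Real.exp_pos (-(2 * u))
    by_contra h
    push Not at h
    have := mul_pos h this
    linarith
  exact pow_eq_zero_iff two_ne_zero |>.1 (le_antisymm h4 (sq_nonneg _))

/-- `K₀(z) = ½ ∫₀^∞ exp(-τ - z² / (4τ)) dτ/τ`: both sides solve the modified Bessel equation and
have the same behaviour at `0`. -/
theorem K0_eq_integral {z : ℝ} (hz : 0 < z) :
    K0 z = 1 / 2 * ∫ τ in Set.Ioi (0 : ℝ), heatWeight (z ^ 2 / 4) τ / τ := by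
  have h : heatF (z ^ 2 / 4) - seriesF (z ^ 2 / 4) = 0 :=
    eq_zero_of_bessel_system (D := fun u => heatF u - seriesF u) (E := fun u => heatG u - seriesG u)
      (fun u hu => ((hasDerivAt_heatF hu).sub (hasDerivAt_seriesF hu)).congr_deriv (by ring))
      (fun u hu => ((hasDerivAt_heatG hu).sub (hasDerivAt_seriesG hu)).congr_deriv (by ring))
      (by
        have := tendsto_heatF_add_log.sub tendsto_seriesF_add_log
        rw [sub_self] at this
        exact this.congr fun u => by ring)
      (by simpa using tendsto_heatG.sub tendsto_seriesG) (by positivity)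
  have hlog : Real.log (z ^ 2 / 4) = 2 * Real.log (z / 2) := by
    rw [show z ^ 2 / 4 = (z / 2) ^ 2 by ring, Real.log_pow]
    norm_num
  rw [show (∫ τ in Set.Ioi (0 : ℝ), heatWeight (z ^ 2 / 4) τ / τ) = heatF (z ^ 2 / 4) from rfl,
    sub_eq_zero.1 h, seriesF, K0_eq, hlog]
  ring

/-! ### The conjugation operator on periodic Hölder functions -/

/-- Hölder continuity on the whole real line, with real constant and exponent. No periodicity is
included. -/
def IsHolder (C α : ℝ) (g : ℝ → ℝ) : Prop := ∀ s t, |g s - g t| ≤ C * |s - t| ^ α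

/-- `cot (t / 2)`, the periodic Cauchy kernel. -/
def cotHalf (t : ℝ) : ℝ := Real.cos (t / 2) / Real.sin (t / 2)

theorem measurable_cotHalf : Measurable cotHalf := by
  unfold cotHalf
  fun_prop

theorem cotHalf_neg (t : ℝ) : cotHalf (-t) = -cotHalf t := by
  rw [cotHalf, cotHalf, neg_div, Real.cos_neg, Real.sin_neg, div_neg]

theorem cotHalf_periodic : Function.Periodic cotHalf (2 * Real.pi) := by
  intro t
  rw [cotHalf, cotHalf, show (t + 2 * Real.pi) / 2 = t / 2 + Real.pi by ring, Real.cos_add_pi,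
    Real.sin_add_pi, neg_div_neg_eq]

theorem div_pi_le_sin_half {t : ℝ} (h0 : 0 ≤ t) (h1 : t ≤ Real.pi) :
    t / Real.pi ≤ Real.sin (t / 2) := by
  have := Real.mul_le_sin (x := t / 2) (by linarith) (by linarith)
  calc t / Real.pi = 2 / Real.pi * (t / 2) := by ring
    _ ≤ _ := this

theorem abs_cotHalf_le {t : ℝ} (h0 : 0 < t) (h1 : t ≤ Real.pi) : |cotHalf t| ≤ Real.pi / t := by
  have hs := div_pi_le_sin_half h0.le h1
  have hp : 0 < t / Real.pi := div_pos h0 Real.pi_pos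
  rw [cotHalf, abs_div, abs_of_pos (hp.trans_le hs)]
  calc |Real.cos (t / 2)| / Real.sin (t / 2) ≤ 1 / (t / Real.pi) := by
        gcongr
        exact Real.abs_cos_le_one _
    _ = Real.pi / t := by rw [one_div_div]

theorem sin_half_pos {t : ℝ} (h0 : 0 < t) (h1 : t < 2 * Real.pi) : 0 < Real.sin (t / 2) :=
  Real.sin_pos_of_pos_of_lt_pi (by linarith) (by linarith)

theorem hasDerivAt_cotHalf {t : ℝ} (h : Real.sin (t / 2) ≠ 0) :
    HasDerivAt cotHalf (-(1 / (2 * Real.sin (t / 2) ^ 2))) t := by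
  have h1 : HasDerivAt (fun t : ℝ => t / 2) (1 / 2) t := (hasDerivAt_id t).div_const 2
  refine ((h1.cos).div h1.sin h).congr_deriv ?_
  have := Real.sin_sq_add_cos_sq (t / 2)
  field_simp
  linarith

theorem abs_mul_cotHalf_le {C α x t : ℝ} (hx : |x| ≤ C * t ^ α) (h0 : 0 < t)
    (h1 : t ≤ Real.pi) : |x * cotHalf t| ≤ C * Real.pi * t ^ (α - 1) := by
  have hC : 0 ≤ C * t ^ α := (abs_nonneg x).trans hx
  rw [abs_mul, Real.rpow_sub_one h0.ne']
  calc |x| * |cotHalf t| ≤ C * t ^ α * (Real.pi / t) := by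
        gcongr
        exact abs_cotHalf_le h0 h1
    _ = _ := by ring

theorem intervalIntegrable_mul_cotHalf {C α : ℝ} (hα : 0 < α) {h : ℝ → ℝ} (hm : Measurable h)
    (hh : ∀ t, 0 < t → t ≤ Real.pi → |h t| ≤ C * t ^ α) {a b : ℝ} (ha : 0 ≤ a) (hab : a ≤ b)
    (hb : b ≤ Real.pi) :
    IntervalIntegrable (fun t => h t * cotHalf t) volume a b := by
  have h1 : IntervalIntegrable (fun t => C * Real.pi * t ^ (α - 1)) volume a b :=
    (intervalIntegral.intervalIntegrable_rpow' (by linarith)).const_mul _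
  rw [intervalIntegrable_iff_integrableOn_Ioc_of_le hab] at h1 ⊢
  refine Integrable.mono' h1 (hm.mul measurable_cotHalf).aestronglyMeasurable ?_
  filter_upwards [ae_restrict_mem measurableSet_Ioc] with t ht
  exact abs_mul_cotHalf_le (hh t (ha.trans_lt ht.1) (ht.2.trans hb)) (ha.trans_lt ht.1)
    (ht.2.trans hb)

theorem abs_integral_mul_cotHalf_le {C α : ℝ} (hα : 0 < α) {h : ℝ → ℝ}
    (hh : ∀ t, 0 < t → t ≤ Real.pi → |h t| ≤ C * t ^ α) {η : ℝ} (h0 : 0 ≤ η)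
    (h1 : η ≤ Real.pi) :
    |∫ t in (0 : ℝ)..η, h t * cotHalf t| ≤ C * Real.pi / α * η ^ α := by
  have h2 : IntervalIntegrable (fun t => C * Real.pi * t ^ (α - 1)) volume 0 η :=
    (intervalIntegral.intervalIntegrable_rpow' (by linarith)).const_mul _
  have h3 := intervalIntegral.norm_integral_le_of_norm_le (f := fun t => h t * cotHalf t) h0
    (ae_of_all _ fun t ht => abs_mul_cotHalf_le (hh t ht.1 (ht.2.trans h1)) ht.1 (ht.2.trans h1)) h2
  rw [intervalIntegral.integral_const_mul, integral_rpow (Or.inl (by linarith)),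
    sub_add_cancel, Real.zero_rpow hα.ne', sub_zero] at h3
  calc _ ≤ _ := h3
    _ = _ := by ring

theorem IsHolder.continuous {C α : ℝ} {g : ℝ → ℝ} (hα : 0 < α) (hg : IsHolder C α g) :
    Continuous g := by
  refine continuous_iff_continuousAt.2 fun s => ?_
  refine tendsto_iff_dist_tendsto_zero.2 ?_
  have h : Tendsto (fun t => C * |t - s| ^ α) (𝓝 s) (𝓝 0) := by
    have : Continuous fun t : ℝ => C * |t - s| ^ α :=
      continuous_const.mul ((continuous_abs.comp (continuous_id.sub continuous_const)).rpow_const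
        fun _ => Or.inr hα.le)
    have h := this.tendsto s
    simpa [Real.zero_rpow hα.ne'] using h
  exact squeeze_zero (fun _ => dist_nonneg) (fun t => hg t s) h

theorem IsHolder.nonneg {C α : ℝ} {g : ℝ → ℝ} (hg : IsHolder C α g) : 0 ≤ C := by
  have := (abs_nonneg _).trans (hg 1 0)
  simpa using this

theorem IsHolder.abs_sub_le {C α : ℝ} {g : ℝ → ℝ} (hα1 : α < 1)
    (hg : IsHolder C α g) (s : ℝ) {t : ℝ} (ht : 0 < t) :
    |g (s - t) - g (s + t)| ≤ 2 * C * t ^ α := by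
  refine (hg _ _).trans ?_
  rw [show s - t - (s + t) = -(2 * t) by ring, abs_neg, abs_of_pos (by linarith),
    Real.mul_rpow (by norm_num) ht.le]
  have h2 : (2 : ℝ) ^ α ≤ 2 := by
    calc (2 : ℝ) ^ α ≤ 2 ^ (1 : ℝ) := Real.rpow_le_rpow_of_exponent_le (by norm_num) hα1.le
      _ = 2 := Real.rpow_one 2
  have h3 := hg.nonneg
  have h4 : 0 ≤ t ^ α := by positivity
  nlinarith [mul_nonneg h3 h4]

/-- The conjugation operator (periodic Hilbert transform)
`(1/2π) p.v. ∫ g(σ) cot ((s - σ) / 2) dσ`, written as an absolutely convergent integral by pairing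
`s - t` with `s + t`. -/
def hilb (g : ℝ → ℝ) (s : ℝ) : ℝ :=
  1 / (2 * Real.pi) * ∫ t in (0 : ℝ)..Real.pi, (g (s - t) - g (s + t)) * cotHalf t

theorem IsHolder.intervalIntegrable_hilb {C α : ℝ} {g : ℝ → ℝ} (hα : 0 < α) (hα1 : α < 1)
    (hg : IsHolder C α g) (s : ℝ) {a b : ℝ} (ha : 0 ≤ a) (hab : a ≤ b) (hb : b ≤ Real.pi) :
    IntervalIntegrable (fun t => (g (s - t) - g (s + t)) * cotHalf t) volume a b := by
  have hc := hg.continuous hα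
  exact intervalIntegrable_mul_cotHalf hα (by fun_prop) (fun t ht _ => hg.abs_sub_le hα1 s ht)
    ha hab hb

theorem hilb_periodic {g : ℝ → ℝ} (hg : Function.Periodic g (2 * Real.pi)) :
    Function.Periodic (hilb g) (2 * Real.pi) := by
  intro s
  rw [hilb, hilb]
  congr 1
  refine intervalIntegral.integral_congr fun t _ => ?_
  rw [show s + 2 * Real.pi - t = s - t + 2 * Real.pi by ring,
    show s + 2 * Real.pi + t = s + t + 2 * Real.pi by ring, hg, hg]

theorem hilb_const (c : ℝ) (s : ℝ) : hilb (fun _ => c) s = 0 := by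
  simp [hilb]

theorem IsHolder.hilb_add {C D α : ℝ} {f g : ℝ → ℝ} (hα : 0 < α) (hα1 : α < 1)
    (hf : IsHolder C α f) (hg : IsHolder D α g) (s : ℝ) :
    hilb (fun t => f t + g t) s = hilb f s + hilb g s := by
  rw [hilb, hilb, hilb, ← mul_add, ← intervalIntegral.integral_add
    (hf.intervalIntegrable_hilb hα hα1 s le_rfl Real.pi_pos.le le_rfl)
    (hg.intervalIntegrable_hilb hα hα1 s le_rfl Real.pi_pos.le le_rfl)]
  congr 1
  exact intervalIntegral.integral_congr fun t _ => by ring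

theorem hilb_const_mul (c : ℝ) (g : ℝ → ℝ) (s : ℝ) :
    hilb (fun t => c * g t) s = c * hilb g s := by
  rw [hilb, hilb, mul_left_comm, ← intervalIntegral.integral_const_mul (c)]
  congr 1
  exact intervalIntegral.integral_congr fun t _ => by ring

theorem IsHolder.add {C D α : ℝ} {f g : ℝ → ℝ} (hf : IsHolder C α f) (hg : IsHolder D α g) :
    IsHolder (C + D) α fun t => f t + g t := by
  intro s t
  calc |f s + g s - (f t + g t)| = |(f s - f t) + (g s - g t)| := by ring_nf
    _ ≤ |f s - f t| + |g s - g t| := abs_add_le _ _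
    _ ≤ C * |s - t| ^ α + D * |s - t| ^ α := add_le_add (hf s t) (hg s t)
    _ = _ := by ring

theorem IsHolder.const_mul {C α : ℝ} {f : ℝ → ℝ} (hf : IsHolder C α f) (c : ℝ) :
    IsHolder (|c| * C) α fun t => c * f t := by
  intro s t
  rw [← mul_sub, abs_mul, mul_assoc]
  exact mul_le_mul_of_nonneg_left (hf s t) (abs_nonneg c)

theorem IsHolder.const (c α : ℝ) : IsHolder 0 α fun _ => c := by
  intro s t
  simp

/-- The principal value integral against the periodic Cauchy kernel exists and is given by the
conjugation operator. -/
theorem IsHolder.hasPVIntegral_cotHalf {C α : ℝ} {g : ℝ → ℝ} (hα : 0 < α) (hα1 : α < 1)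
    (hg : IsHolder C α g) (hper : Function.Periodic g (2 * Real.pi)) (s : ℝ) :
    HasPVIntegral (fun σ => g σ * cotHalf (s - σ)) s (2 * Real.pi * hilb g s) := by
  have hπ := Real.pi_pos
  have hc := hg.continuous hα
  have key : ∀ ε ∈ Set.Ioo 0 Real.pi,
      ∫ σ in (s + ε)..(s + 2 * Real.pi - ε), g σ * cotHalf (s - σ)
        = 2 * Real.pi * hilb g s
          - ∫ t in (0 : ℝ)..ε, (g (s - t) - g (s + t)) * cotHalf t := by
    intro ε hε
    have hcont : ContinuousOn (fun t => cotHalf t) (Set.Icc ε Real.pi) := fun t ht =>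
      (hasDerivAt_cotHalf (sin_half_pos (hε.1.trans_le ht.1)
        (by linarith [ht.2])).ne').continuousAt.continuousWithinAt
    have hI : ∀ f : ℝ → ℝ, Continuous f →
        IntervalIntegrable (fun t => f t * cotHalf t) volume ε Real.pi := fun f hf =>
      ContinuousOn.intervalIntegrable (by
        rw [Set.uIcc_of_le hε.2.le]
        exact hf.continuousOn.mul hcont)
    have e1 : ∫ σ in (s + ε)..(s + Real.pi), g σ * cotHalf (s - σ)
        = -∫ t in ε..Real.pi, g (s + t) * cotHalf t := by
      rw [← intervalIntegral.integral_comp_add_left (fun σ => g σ * cotHalf (s - σ)) s,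
        ← intervalIntegral.integral_neg]
      refine intervalIntegral.integral_congr fun t _ => ?_
      rw [show s - (s + t) = -t by ring, cotHalf_neg]
      ring
    have e2 : ∫ σ in (s + Real.pi)..(s + 2 * Real.pi - ε), g σ * cotHalf (s - σ)
        = ∫ t in ε..Real.pi, g (s - t) * cotHalf t := by
      have h := intervalIntegral.integral_comp_sub_left (a := ε) (b := Real.pi)
        (fun σ => g σ * cotHalf (s - σ)) (s + 2 * Real.pi)
      rw [show s + 2 * Real.pi - Real.pi = s + Real.pi by ring] at h
      rw [← h]
      refine intervalIntegral.integral_congr fun t _ => ?_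
      rw [show s + 2 * Real.pi - t = s - t + 2 * Real.pi by ring, hper,
        show s - (s - t + 2 * Real.pi) = t - 2 * Real.pi by ring, cotHalf_periodic.sub_eq]
    have i1 : IntervalIntegrable (fun σ => g σ * cotHalf (s - σ)) volume (s + ε)
        (s + Real.pi) := by
      refine ContinuousOn.intervalIntegrable ?_
      rw [Set.uIcc_of_le (by linarith [hε.2])]
      refine hc.continuousOn.mul fun σ hσ => ?_
      have h1 : Real.sin ((s - σ) / 2) ≠ 0 := by
        have := sin_half_pos (t := σ - s) (by linarith [hσ.1, hε.1]) (by linarith [hσ.2])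
        rw [show (s - σ) / 2 = -((σ - s) / 2) by ring, Real.sin_neg]
        linarith
      exact ((hasDerivAt_cotHalf h1).continuousAt.comp (f := fun σ => s - σ)
        (by fun_prop)).continuousWithinAt
    have i2 : IntervalIntegrable (fun σ => g σ * cotHalf (s - σ)) volume (s + Real.pi)
        (s + 2 * Real.pi - ε) := by
      refine ContinuousOn.intervalIntegrable ?_
      rw [Set.uIcc_of_le (by linarith [hε.2])]
      refine hc.continuousOn.mul fun σ hσ => ?_
      have h1 : Real.sin ((s - σ) / 2) ≠ 0 := by
        have := sin_half_pos (t := σ - s) (by linarith [hσ.1, hε.1]) (by linarith [hσ.2, hε.1])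
        rw [show (s - σ) / 2 = -((σ - s) / 2) by ring, Real.sin_neg]
        linarith
      exact ((hasDerivAt_cotHalf h1).continuousAt.comp (f := fun σ => s - σ)
        (by fun_prop)).continuousWithinAt
    rw [← intervalIntegral.integral_add_adjacent_intervals i1 i2, e1, e2, neg_add_eq_sub,
      ← intervalIntegral.integral_sub (hI (fun t => g (s - t)) (by fun_prop))
        (hI (fun t => g (s + t)) (by fun_prop))]
    have h3 := intervalIntegral.integral_add_adjacent_intervals
      (hg.intervalIntegrable_hilb hα hα1 s le_rfl hε.1.le hε.2.le)
      (hg.intervalIntegrable_hilb hα hα1 s hε.1.le hε.2.le le_rfl)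
    have h4 : 2 * Real.pi * hilb g s
        = ∫ t in (0 : ℝ)..Real.pi, (g (s - t) - g (s + t)) * cotHalf t := by
      rw [hilb]
      field_simp
    rw [h4, ← h3, add_sub_cancel_left]
    exact intervalIntegral.integral_congr fun t _ => by ring
  have hlim : Tendsto (fun ε => ∫ t in (0 : ℝ)..ε, (g (s - t) - g (s + t)) * cotHalf t)
      (𝓝[>] 0) (𝓝 0) := by
    have h1 : Tendsto (fun ε : ℝ => 2 * C * Real.pi / α * ε ^ α) (𝓝[>] 0) (𝓝 0) := by
      have : Continuous fun ε : ℝ => 2 * C * Real.pi / α * ε ^ α :=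
        continuous_const.mul (continuous_id.rpow_const fun _ => Or.inr hα.le)
      have h := (this.tendsto 0).mono_left (nhdsWithin_le_nhds (s := Set.Ioi 0))
      simpa [Real.zero_rpow hα.ne'] using h
    refine squeeze_zero_norm' ?_ h1
    filter_upwards [Ioo_mem_nhdsGT hπ] with ε hε
    exact abs_integral_mul_cotHalf_le hα (fun t ht _ => hg.abs_sub_le hα1 s ht) hε.1.le hε.2.le
  have h2 := hlim.const_sub (2 * Real.pi * hilb g s)
  rw [sub_zero] at h2
  refine h2.congr' ?_
  filter_upwards [Ioo_mem_nhdsGT hπ] with ε hε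
  exact (key ε hε).symm

/-! ### Privalov's theorem -/

/-- Integration by parts in the part of the conjugation operator away from the singularity: with a
primitive `G` of `g`, only the second difference of `G` enters. -/
theorem integral_mul_cotHalf_eq_second_difference {g : ℝ → ℝ} (hg : Continuous g) {G : ℝ → ℝ}
    (hG : ∀ s, HasDerivAt G (g s) s) (s : ℝ) {η : ℝ} (h0 : 0 < η) (h1 : η ≤ Real.pi) :
    ∫ t in η..Real.pi, (g (s - t) - g (s + t)) * cotHalf t
      = (G (s - η) + G (s + η) - 2 * G s) * cotHalf η
        - ∫ t in η..Real.pi,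
          (G (s - t) + G (s + t) - 2 * G s) * (1 / (2 * Real.sin (t / 2) ^ 2)) := by
  have hsin : ∀ t ∈ Set.uIcc η Real.pi, Real.sin (t / 2) ≠ 0 := by
    intro t ht
    rw [Set.uIcc_of_le h1] at ht
    exact (sin_half_pos (h0.trans_le ht.1) (by linarith [ht.2, Real.pi_pos])).ne'
  have hv : ∀ t, HasDerivAt (fun t => G (s - t) + G (s + t) - 2 * G s)
      (-(g (s - t) - g (s + t))) t := by
    intro t
    have h2 := (hG (s - t)).comp t ((hasDerivAt_id t).const_sub s)
    have h3 := (hG (s + t)).comp t ((hasDerivAt_id t).const_add s)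
    exact ((h2.add h3).sub_const _).congr_deriv (by ring)
  have hcd : ContinuousOn (fun t : ℝ => -(1 / (2 * Real.sin (t / 2) ^ 2)))
      (Set.uIcc η Real.pi) := by
    refine (ContinuousOn.div continuousOn_const (by fun_prop) fun t ht => ?_).neg
    have := hsin t ht
    positivity
  have key := intervalIntegral.integral_mul_deriv_eq_deriv_mul (a := η) (b := Real.pi)
    (fun t ht => hasDerivAt_cotHalf (hsin t ht)) (fun t _ => hv t)
    hcd.intervalIntegrable (Continuous.intervalIntegrable (by fun_prop) _ _)
  have hπ : cotHalf Real.pi = 0 := by simp [cotHalf]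
  rw [hπ, zero_mul] at key
  have e1 : ∫ t in η..Real.pi, (g (s - t) - g (s + t)) * cotHalf t
      = -∫ t in η..Real.pi, cotHalf t * -(g (s - t) - g (s + t)) := by
    rw [← intervalIntegral.integral_neg]
    exact intervalIntegral.integral_congr fun t _ => by ring
  have e2 : ∫ t in η..Real.pi, (G (s - t) + G (s + t) - 2 * G s) * (1 / (2 * Real.sin (t / 2) ^ 2))
      = -∫ t in η..Real.pi, -(1 / (2 * Real.sin (t / 2) ^ 2))
        * (G (s - t) + G (s + t) - 2 * G s) := by
    rw [← intervalIntegral.integral_neg]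
    exact intervalIntegral.integral_congr fun t _ => by ring
  rw [e1, e2, key]
  ring

theorem abs_second_difference_sub_le {C α : ℝ} {g : ℝ → ℝ} (hg : IsHolder C α g) {G : ℝ → ℝ}
    (hG : ∀ s, HasDerivAt G (g s) s) (s s' : ℝ) {t : ℝ} (ht : 0 < t) :
    |(G (s - t) + G (s + t) - 2 * G s) - (G (s' - t) + G (s' + t) - 2 * G s')|
      ≤ 2 * C * t ^ α * |s - s'| := by
  have hd : ∀ s, HasDerivAt (fun s => G (s - t) + G (s + t) - 2 * G s)
      ((g (s - t) - g s) + (g (s + t) - g s)) s := by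
    intro s
    have h2 := (hG (s - t)).comp s ((hasDerivAt_id s).sub_const t)
    have h3 := (hG (s + t)).comp s ((hasDerivAt_id s).add_const t)
    exact ((h2.add h3).sub ((hG s).const_mul 2)).congr_deriv (by ring)
  have hb : ∀ s, ‖(g (s - t) - g s) + (g (s + t) - g s)‖ ≤ 2 * C * t ^ α := by
    intro s
    have h1 := hg (s - t) s
    have h2 := hg (s + t) s
    rw [show s - t - s = -t by ring, abs_neg, abs_of_pos ht] at h1
    rw [add_sub_cancel_left, abs_of_pos ht] at h2
    calc _ ≤ ‖g (s - t) - g s‖ + ‖g (s + t) - g s‖ := norm_add_le _ _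
      _ ≤ C * t ^ α + C * t ^ α := add_le_add h1 h2
      _ = _ := by ring
  exact convex_univ.norm_image_sub_le_of_norm_hasDerivWithin_le
    (fun s _ => (hd s).hasDerivWithinAt) (fun s _ => hb s) (Set.mem_univ s') (Set.mem_univ s)

/-- Privalov's theorem: the conjugation operator is bounded on Hölder functions of exponent
`0 < α < 1`. In `hilb g s - hilb g s'` the part `t < |s - s'|` of the integral is estimated
directly, and the rest is first integrated by parts, so that only second differences of a primitive
of `g` remain. -/
theorem exists_isHolder_hilb {α : ℝ} (hα : 0 < α) (hα1 : α < 1) :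
    ∃ K : ℝ, 0 ≤ K ∧ ∀ (C : ℝ) (g : ℝ → ℝ), IsHolder C α g →
      IsHolder (K * C) α (hilb g) ∧ ∀ s, |hilb g s| ≤ K * C := by
  have hπ := Real.pi_pos
  have hπ1 : 1 ≤ Real.pi := by linarith [Real.pi_gt_three]
  have hα' : 0 < 1 - α := by linarith
  set K : ℝ := 4 * Real.pi / α + 2 * Real.pi + Real.pi ^ 2 / (1 - α)
    + 2 * Real.pi / α * Real.pi ^ α with hK
  have hK1 : 4 * Real.pi / α + 2 * Real.pi + Real.pi ^ 2 / (1 - α) ≤ K := by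
    rw [hK]; linarith [show 0 ≤ 2 * Real.pi / α * Real.pi ^ α by positivity]
  have hK2 : 2 * Real.pi / α * Real.pi ^ α ≤ K := by
    rw [hK]
    linarith [show 0 ≤ 4 * Real.pi / α + 2 * Real.pi + Real.pi ^ 2 / (1 - α) by positivity]
  have hpre : |1 / (2 * Real.pi)| ≤ 1 := by
    rw [abs_of_pos (by positivity), div_le_one (by positivity)]
    linarith
  refine ⟨K, by positivity, fun C g hg => ⟨fun s s' => ?_, fun s => ?_⟩⟩
  · have hC := hg.nonneg
    have hc := hg.continuous hα
    rcases eq_or_ne s s' with rfl | hne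
    · simp [Real.zero_rpow hα.ne']
    set δ := |s - s'| with hδ
    have hδ0 : 0 < δ := abs_pos.2 (sub_ne_zero.2 hne)
    set η := min δ Real.pi with hη
    have hη0 : 0 < η := lt_min hδ0 hπ
    have hηπ : η ≤ Real.pi := min_le_right _ _
    have hηδ : η ^ α ≤ δ ^ α := by
      gcongr
      exact min_le_left _ _
    -- the part near the singularity
    have near : ∀ s, |∫ t in (0 : ℝ)..η, (g (s - t) - g (s + t)) * cotHalf t|
        ≤ 2 * C * Real.pi / α * δ ^ α := fun s =>
      (abs_integral_mul_cotHalf_le hα (fun t ht _ => hg.abs_sub_le hα1 s ht) hη0.le hηπ).trans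
        (by gcongr)
    -- the part away from it
    have far : |(∫ t in η..Real.pi, (g (s - t) - g (s + t)) * cotHalf t)
        - ∫ t in η..Real.pi, (g (s' - t) - g (s' + t)) * cotHalf t|
        ≤ (2 * Real.pi + Real.pi ^ 2 / (1 - α)) * C * δ ^ α := by
      rcases le_or_gt Real.pi δ with hle | hlt
      · rw [hη, min_eq_right hle, intervalIntegral.integral_same, intervalIntegral.integral_same,
          sub_zero, abs_zero]
        positivity
      have hηeq : η = δ := min_eq_left hlt.le
      set G : ℝ → ℝ := fun x => ∫ y in (0 : ℝ)..x, g y with hGdef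
      have hG : ∀ s, HasDerivAt G (g s) s := fun s =>
        intervalIntegral.integral_hasDerivAt_right (hc.intervalIntegrable _ _)
          (hc.stronglyMeasurableAtFilter _ _) hc.continuousAt
      have hGc : Continuous G := continuous_iff_continuousAt.2 fun s => (hG s).continuousAt
      set S : ℝ → ℝ → ℝ := fun s t => G (s - t) + G (s + t) - 2 * G s with hS
      have hSd : ∀ t, 0 < t → |S s t - S s' t| ≤ 2 * C * t ^ α * δ := fun t ht =>
        abs_second_difference_sub_le hg hG s s' ht
      have hI : ∀ s, IntervalIntegrable (fun t => S s t * (1 / (2 * Real.sin (t / 2) ^ 2)))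
          volume η Real.pi := by
        intro s
        refine ContinuousOn.intervalIntegrable ?_
        rw [Set.uIcc_of_le hηπ]
        refine ContinuousOn.mul (by fun_prop) (continuousOn_const.div (by fun_prop) fun t ht => ?_)
        have := (sin_half_pos (hη0.trans_le ht.1) (by linarith [ht.2])).ne'
        positivity
      rw [integral_mul_cotHalf_eq_second_difference hc hG s hη0 hηπ,
        integral_mul_cotHalf_eq_second_difference hc hG s' hη0 hηπ]
      have hint : |∫ t in η..Real.pi, (S s t - S s' t) * (1 / (2 * Real.sin (t / 2) ^ 2))|
          ≤ Real.pi ^ 2 / (1 - α) * C * δ ^ α := by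
        have hb : ∀ t ∈ Set.Ioc η Real.pi,
            ‖(S s t - S s' t) * (1 / (2 * Real.sin (t / 2) ^ 2))‖
              ≤ C * δ * Real.pi ^ 2 * t ^ (α - 2) := by
          intro t ht
          have ht0 : 0 < t := hη0.trans ht.1
          have h1 := div_pi_le_sin_half ht0.le ht.2
          have h2 : 0 < t / Real.pi := by positivity
          have h3 : 1 / (2 * Real.sin (t / 2) ^ 2) ≤ 1 / (2 * (t / Real.pi) ^ 2) := by gcongr
          rw [norm_mul, Real.norm_eq_abs, Real.norm_eq_abs,
            abs_of_nonneg (by positivity : 0 ≤ 1 / (2 * Real.sin (t / 2) ^ 2))]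
          have h4 : t ^ (α - 2) = t ^ α / t ^ 2 := by
            rw [Real.rpow_sub ht0]; norm_num
          calc |S s t - S s' t| * (1 / (2 * Real.sin (t / 2) ^ 2))
              ≤ 2 * C * t ^ α * δ * (1 / (2 * (t / Real.pi) ^ 2)) := by
                gcongr
                exact hSd t ht0
            _ = _ := by rw [h4]; field_simp
        have hnot : (0 : ℝ) ∉ Set.uIcc η Real.pi := by
          rw [Set.uIcc_of_le hηπ]
          exact fun h => absurd h.1 (not_le.2 hη0)
        have hint2 : IntervalIntegrable (fun t => C * δ * Real.pi ^ 2 * t ^ (α - 2)) volume η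
            Real.pi :=
          (intervalIntegral.intervalIntegrable_rpow (Or.inr hnot)).const_mul _
        have h := intervalIntegral.norm_integral_le_of_norm_le hηπ (ae_of_all _ hb) hint2
        rw [intervalIntegral.integral_const_mul, integral_rpow
          (Or.inr ⟨by linarith, hnot⟩)] at h
        refine h.trans ?_
        have h5 : (Real.pi ^ (α - 2 + 1) - η ^ (α - 2 + 1)) / (α - 2 + 1)
            ≤ η ^ (α - 1) / (1 - α) := by
          rw [show α - 2 + 1 = α - 1 by ring, ← neg_div_neg_eq, neg_sub, neg_sub]
          gcongr
          linarith [Real.rpow_nonneg hπ.le (α - 1)]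
        calc C * δ * Real.pi ^ 2 * ((Real.pi ^ (α - 2 + 1) - η ^ (α - 2 + 1)) / (α - 2 + 1))
            ≤ C * δ * Real.pi ^ 2 * (η ^ (α - 1) / (1 - α)) := by gcongr
          _ = _ := by
            rw [hηeq, Real.rpow_sub_one hδ0.ne']
            field_simp
      have hbd : |(S s η - S s' η) * cotHalf η| ≤ 2 * Real.pi * C * δ ^ α := by
        rw [abs_mul]
        calc |S s η - S s' η| * |cotHalf η| ≤ 2 * C * η ^ α * δ * (Real.pi / η) := by
              gcongr
              · exact hSd η hη0
              · exact abs_cotHalf_le hη0 hηπ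
          _ = _ := by
            rw [hηeq]
            field_simp
      have e : (S s η * cotHalf η - ∫ t in η..Real.pi, S s t * (1 / (2 * Real.sin (t / 2) ^ 2)))
          - (S s' η * cotHalf η
            - ∫ t in η..Real.pi, S s' t * (1 / (2 * Real.sin (t / 2) ^ 2)))
          = (S s η - S s' η) * cotHalf η
            - ∫ t in η..Real.pi, (S s t - S s' t) * (1 / (2 * Real.sin (t / 2) ^ 2)) := by
        simp only [sub_mul]
        rw [intervalIntegral.integral_sub (hI s) (hI s')]
        ring
      rw [e]
      calc _ ≤ |(S s η - S s' η) * cotHalf η|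
            + |∫ t in η..Real.pi, (S s t - S s' t) * (1 / (2 * Real.sin (t / 2) ^ 2))| :=
          abs_sub _ _
        _ ≤ 2 * Real.pi * C * δ ^ α + Real.pi ^ 2 / (1 - α) * C * δ ^ α := add_le_add hbd hint
        _ = _ := by ring
    have split : ∀ s, ∫ t in (0 : ℝ)..Real.pi, (g (s - t) - g (s + t)) * cotHalf t
        = (∫ t in (0 : ℝ)..η, (g (s - t) - g (s + t)) * cotHalf t)
          + ∫ t in η..Real.pi, (g (s - t) - g (s + t)) * cotHalf t := fun s =>
      (intervalIntegral.integral_add_adjacent_intervals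
        (hg.intervalIntegrable_hilb hα hα1 s le_rfl hη0.le hηπ)
        (hg.intervalIntegrable_hilb hα hα1 s hη0.le hηπ le_rfl)).symm
    rw [hilb, hilb, ← mul_sub, abs_mul, split s, split s', add_sub_add_comm]
    refine (mul_le_of_le_one_left (abs_nonneg _) hpre).trans ?_
    calc _ ≤ (2 * C * Real.pi / α * δ ^ α + 2 * C * Real.pi / α * δ ^ α)
          + (2 * Real.pi + Real.pi ^ 2 / (1 - α)) * C * δ ^ α :=
        (abs_add_le _ _).trans
          (add_le_add ((abs_sub _ _).trans (add_le_add (near s) (near s'))) far)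
      _ = (4 * Real.pi / α + 2 * Real.pi + Real.pi ^ 2 / (1 - α)) * (C * δ ^ α) := by ring
      _ ≤ K * (C * δ ^ α) := by gcongr
      _ = _ := by ring
  · have hC := hg.nonneg
    rw [hilb, abs_mul]
    refine (mul_le_of_le_one_left (abs_nonneg _) hpre).trans ?_
    refine (abs_integral_mul_cotHalf_le hα (fun t ht _ => hg.abs_sub_le hα1 s ht) hπ.le
      le_rfl).trans ?_
    calc 2 * C * Real.pi / α * Real.pi ^ α = 2 * Real.pi / α * Real.pi ^ α * C := by ring
      _ ≤ _ := by gcongr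

/-! ### Duality and the inverse of the conjugation operator -/

theorem exists_abs_le_of_periodic {f : ℝ → ℝ} (hc : Continuous f)
    (hf : Function.Periodic f (2 * Real.pi)) : ∃ M : ℝ, 0 ≤ M ∧ ∀ s, |f s| ≤ M := by
  obtain ⟨M, hM⟩ := isCompact_Icc.exists_bound_of_continuousOn (s := Set.Icc 0 (2 * Real.pi))
    hc.continuousOn
  refine ⟨M, (norm_nonneg _).trans (hM 0 ⟨le_rfl, Real.two_pi_pos.le⟩), fun s => ?_⟩
  obtain ⟨t, ht, hst⟩ := hf.exists_mem_Ico₀ Real.two_pi_pos s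
  rw [hst]
  exact hM t ⟨ht.1, ht.2.le⟩

theorem integral_comp_add_of_periodic {f : ℝ → ℝ} (hf : Function.Periodic f (2 * Real.pi))
    (a : ℝ) : ∫ s in (0 : ℝ)..(2 * Real.pi), f (s + a) = ∫ s in (0 : ℝ)..(2 * Real.pi), f s := by
  rw [intervalIntegral.integral_comp_add_right]
  have := hf.intervalIntegral_add_eq (0 + a) 0
  rwa [show 0 + a + 2 * Real.pi = 2 * Real.pi + a by ring, zero_add (2 * Real.pi)] at this

theorem integral_comp_sub_left_of_periodic {f : ℝ → ℝ}
    (hf : Function.Periodic f (2 * Real.pi)) (a : ℝ) :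
    ∫ s in (0 : ℝ)..(2 * Real.pi), f (a - s) = ∫ s in (0 : ℝ)..(2 * Real.pi), f s := by
  rw [intervalIntegral.integral_comp_sub_left]
  have := hf.intervalIntegral_add_eq (a - 2 * Real.pi) 0
  rwa [show a - 2 * Real.pi + 2 * Real.pi = a - 0 by ring, zero_add (2 * Real.pi)] at this

theorem integral_integral_swap_cotHalf {C α : ℝ} (hα : 0 < α) {F : ℝ → ℝ → ℝ}
    (hF : Continuous (Function.uncurry F))
    (hb : ∀ s t, 0 < t → t ≤ Real.pi → |F s t| ≤ C * t ^ α) :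
    ∫ s in (0 : ℝ)..(2 * Real.pi), ∫ t in (0 : ℝ)..Real.pi, F s t * cotHalf t
      = ∫ t in (0 : ℝ)..Real.pi, (∫ s in (0 : ℝ)..(2 * Real.pi), F s t) * cotHalf t := by
  have hπ := Real.pi_pos
  have hint : IntegrableOn (Function.uncurry fun s t => F s t * cotHalf t)
      (Set.uIoc 0 (2 * Real.pi) ×ˢ Set.uIoc 0 Real.pi) := by
    have h1 : IntegrableOn (fun t : ℝ => C * Real.pi * t ^ (α - 1)) (Set.uIoc 0 Real.pi) :=
      ((intervalIntegral.intervalIntegrable_rpow' (by linarith)).const_mul _).def'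
    have h2 : IntegrableOn (fun _ : ℝ => (1 : ℝ)) (Set.uIoc 0 (2 * Real.pi)) :=
      (intervalIntegrable_const (μ := volume) (c := (1 : ℝ))).def'
    have h3 := Integrable.mul_prod h2 h1
    rw [Measure.prod_restrict] at h3
    refine Integrable.mono' h3 (hF.measurable.mul
      (measurable_cotHalf.comp measurable_snd)).aestronglyMeasurable ?_
    filter_upwards [ae_restrict_mem (measurableSet_uIoc.prod measurableSet_uIoc)] with p hp
    have h4 := hp.2
    rw [Set.uIoc_of_le hπ.le] at h4
    rw [one_mul]
    exact abs_mul_cotHalf_le (hb p.1 p.2 h4.1 h4.2) h4.1 h4.2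
  rw [intervalIntegral_intervalIntegral_swap hint]
  exact intervalIntegral.integral_congr fun t _ => intervalIntegral.integral_mul_const _ _

/-- The conjugation operator is skew-adjoint. -/
theorem IsHolder.integral_mul_hilb {C D α : ℝ} {f g : ℝ → ℝ} (hα : 0 < α) (hα1 : α < 1)
    (hf : IsHolder C α f) (hfp : Function.Periodic f (2 * Real.pi))
    (hg : IsHolder D α g) (hgp : Function.Periodic g (2 * Real.pi)) :
    ∫ s in (0 : ℝ)..(2 * Real.pi), f s * hilb g s
      = -∫ s in (0 : ℝ)..(2 * Real.pi), g s * hilb f s := by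
  have hfc := hf.continuous hα
  have hgc := hg.continuous hα
  have key : ∀ {C D : ℝ} {f g : ℝ → ℝ}, IsHolder C α f → Function.Periodic f (2 * Real.pi) →
      IsHolder D α g → Function.Periodic g (2 * Real.pi) →
      ∫ s in (0 : ℝ)..(2 * Real.pi), f s * hilb g s = 1 / (2 * Real.pi) *
        ∫ t in (0 : ℝ)..Real.pi,
          (∫ s in (0 : ℝ)..(2 * Real.pi), f s * (g (s - t) - g (s + t))) * cotHalf t := by
    intro C D f g hf hfp hg hgp
    have hfc := hf.continuous hα
    have hgc := hg.continuous hα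
    obtain ⟨M, hM0, hM⟩ := exists_abs_le_of_periodic hfc hfp
    rw [← integral_integral_swap_cotHalf (C := M * (2 * D)) hα
      (F := fun s t => f s * (g (s - t) - g (s + t))) (by fun_prop) fun s t ht _ => ?_]
    · rw [← intervalIntegral.integral_const_mul]
      refine intervalIntegral.integral_congr fun s _ => ?_
      rw [hilb, mul_left_comm, ← intervalIntegral.integral_const_mul (f s)]
      congr 1
      exact intervalIntegral.integral_congr fun t _ => by ring
    · rw [abs_mul, mul_assoc M]
      exact mul_le_mul (hM s) (hg.abs_sub_le hα1 s ht) (abs_nonneg _) hM0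
  rw [key hf hfp hg hgp, key hg hgp hf hfp, ← mul_neg, ← intervalIntegral.integral_neg]
  congr 1
  refine intervalIntegral.integral_congr fun t _ => ?_
  rw [← neg_mul]
  congr 1
  have shift : ∀ {f g : ℝ → ℝ}, Function.Periodic f (2 * Real.pi) →
      Function.Periodic g (2 * Real.pi) →
      ∫ s in (0 : ℝ)..(2 * Real.pi), f s * g (s - t)
        = ∫ s in (0 : ℝ)..(2 * Real.pi), g s * f (s + t) := by
    intro f g hfp hgp
    rw [← integral_comp_add_of_periodic (f := fun s => f s * g (s - t)) (fun s => by
      simp only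
      rw [hfp, show s + 2 * Real.pi - t = s - t + 2 * Real.pi by ring, hgp]) t]
    refine intervalIntegral.integral_congr fun s _ => ?_
    rw [add_sub_cancel_right, mul_comm]
  simp only [mul_sub]
  rw [intervalIntegral.integral_sub, intervalIntegral.integral_sub, shift hfp hgp,
    shift hgp hfp]
  · ring
  all_goals exact Continuous.intervalIntegrable (by fun_prop) _ _

/-- The mean value over a period. -/
def mean (g : ℝ → ℝ) : ℝ := 1 / (2 * Real.pi) * ∫ s in (0 : ℝ)..(2 * Real.pi), g s

theorem integral_cos_nat_mul (k : ℕ) (hk : k ≠ 0) :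
    ∫ t in (0 : ℝ)..Real.pi, Real.cos (k * t) = 0 := by
  rw [intervalIntegral.integral_comp_mul_left (fun t => Real.cos t) (by exact_mod_cast hk)]
  simp

theorem intervalIntegrable_sin_mul_cotHalf (k : ℕ) :
    IntervalIntegrable (fun t => Real.sin (k * t) * cotHalf t) volume 0 Real.pi := by
  refine intervalIntegrable_mul_cotHalf (C := k) (α := 1) one_pos (by fun_prop)
    (fun t ht _ => ?_) le_rfl Real.pi_pos.le le_rfl
  rw [Real.rpow_one]
  calc |Real.sin (k * t)| ≤ |(k : ℝ) * t| := Real.abs_sin_le_abs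
    _ = k * t := abs_of_nonneg (by positivity)

/-- `∫₀^π sin (k t) cot (t / 2) dt = π` for `k ≥ 1`, because consecutive integrands differ by
`cos ((k + 1) t) + cos (k t)`. -/
theorem integral_sin_mul_cotHalf (k : ℕ) :
    ∫ t in (0 : ℝ)..Real.pi, Real.sin ((k + 1 : ℕ) * t) * cotHalf t = Real.pi := by
  have step : ∀ k : ℕ, (∫ t in (0 : ℝ)..Real.pi, Real.sin ((k + 1 : ℕ) * t) * cotHalf t)
      = (∫ t in (0 : ℝ)..Real.pi, Real.sin (k * t) * cotHalf t)
        + (∫ t in (0 : ℝ)..Real.pi, Real.cos ((k + 1 : ℕ) * t))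
        + ∫ t in (0 : ℝ)..Real.pi, Real.cos (k * t) := by
    intro k
    rw [← intervalIntegral.integral_add (intervalIntegrable_sin_mul_cotHalf k)
      (Continuous.intervalIntegrable (by fun_prop) _ _), ← intervalIntegral.integral_add
      ((intervalIntegrable_sin_mul_cotHalf k).add (Continuous.intervalIntegrable (by fun_prop) _ _))
      (Continuous.intervalIntegrable (by fun_prop) _ _)]
    refine intervalIntegral.integral_congr_ae (ae_of_all _ fun t ht => ?_)
    rw [Set.uIoc_of_le Real.pi_pos.le] at ht
    have hs := (sin_half_pos ht.1 (by linarith [ht.2, Real.pi_pos])).ne'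
    have e1 : Real.sin ((k + 1 : ℕ) * t) - Real.sin (k * t)
        = 2 * Real.sin (t / 2) * Real.cos ((k + 1 / 2) * t) := by
      rw [Real.sin_sub_sin]
      push_cast
      ring_nf
    have e2 : Real.cos ((k + 1 : ℕ) * t) + Real.cos (k * t)
        = 2 * Real.cos ((k + 1 / 2) * t) * Real.cos (t / 2) := by
      rw [Real.cos_add_cos]
      push_cast
      ring_nf
    have e3 : Real.sin ((k + 1 : ℕ) * t) * cotHalf t - Real.sin (k * t) * cotHalf t
        = Real.cos ((k + 1 : ℕ) * t) + Real.cos (k * t) := by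
      rw [← sub_mul, e1, e2, cotHalf]
      field_simp
    linarith
  induction k with
  | zero =>
    rw [step 0, integral_cos_nat_mul _ (by norm_num)]
    simp
  | succ k ih =>
    rw [step (k + 1), ih, integral_cos_nat_mul _ (by omega), integral_cos_nat_mul _ (by omega)]
    ring

theorem hilb_cos (k : ℕ) (s : ℝ) :
    hilb (fun s => Real.cos ((k + 1 : ℕ) * s)) s = Real.sin ((k + 1 : ℕ) * s) := by
  have h : ∀ t, (Real.cos ((k + 1 : ℕ) * (s - t)) - Real.cos ((k + 1 : ℕ) * (s + t))) * cotHalf t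
      = 2 * Real.sin ((k + 1 : ℕ) * s) * (Real.sin ((k + 1 : ℕ) * t) * cotHalf t) := by
    intro t
    rw [mul_sub, mul_add, Real.cos_sub, Real.cos_add]
    ring
  rw [hilb]
  simp only [h]
  rw [intervalIntegral.integral_const_mul, integral_sin_mul_cotHalf]
  field_simp [Real.pi_pos.ne']

theorem hilb_sin (k : ℕ) (s : ℝ) :
    hilb (fun s => Real.sin ((k + 1 : ℕ) * s)) s = -Real.cos ((k + 1 : ℕ) * s) := by
  have h : ∀ t, (Real.sin ((k + 1 : ℕ) * (s - t)) - Real.sin ((k + 1 : ℕ) * (s + t))) * cotHalf t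
      = -2 * Real.cos ((k + 1 : ℕ) * s) * (Real.sin ((k + 1 : ℕ) * t) * cotHalf t) := by
    intro t
    rw [mul_sub, mul_add, Real.sin_sub, Real.sin_add]
    ring
  rw [hilb]
  simp only [h]
  rw [intervalIntegral.integral_const_mul, integral_sin_mul_cotHalf]
  field_simp [Real.pi_pos.ne']

instance fact_two_pi_pos : Fact (0 < 2 * Real.pi) := ⟨Real.two_pi_pos⟩

/-- A continuous `2π`-periodic function as a continuous function on the circle. -/
def toCircle (f : ℝ → ℝ) (hc : Continuous f) (hf : Function.Periodic f (2 * Real.pi)) :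
    C(AddCircle (2 * Real.pi), ℝ) where
  toFun := hf.lift
  continuous_toFun := continuous_coinduced_dom.2 hc

/-- Uniqueness of Fourier series, in real form. -/
theorem eq_zero_of_trigonometric_moments {f : ℝ → ℝ} (hc : Continuous f)
    (hf : Function.Periodic f (2 * Real.pi)) (h0 : ∫ s in (0 : ℝ)..(2 * Real.pi), f s = 0)
    (hcos : ∀ k : ℕ, ∫ s in (0 : ℝ)..(2 * Real.pi), Real.cos ((k + 1 : ℕ) * s) * f s = 0)
    (hsin : ∀ k : ℕ, ∫ s in (0 : ℝ)..(2 * Real.pi), Real.sin ((k + 1 : ℕ) * s) * f s = 0)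
    (s : ℝ) : f s = 0 := by
  have hcos' : ∀ n : ℤ, ∫ s in (0 : ℝ)..(2 * Real.pi), Real.cos (n * s) * f s = 0 := by
    intro n
    obtain ⟨m, rfl | rfl⟩ := n.eq_nat_or_neg
    · rcases m with _ | m
      · simpa using h0
      · simpa using hcos m
    · rcases m with _ | m
      · simpa using h0
      · simpa [← neg_add, -neg_add_rev, neg_mul] using hcos m
  have hsin' : ∀ n : ℤ, ∫ s in (0 : ℝ)..(2 * Real.pi), Real.sin (n * s) * f s = 0 := by
    intro n
    obtain ⟨m, rfl | rfl⟩ := n.eq_nat_or_neg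
    · rcases m with _ | m
      · simp
      · simpa using hsin m
    · rcases m with _ | m
      · simp
      · simpa [← neg_add, -neg_add_rev, neg_mul] using hsin m
  let F : C(AddCircle (2 * Real.pi), ℂ) :=
    ⟨fun x => (toCircle f hc hf x : ℂ), Complex.continuous_ofReal.comp (map_continuous _)⟩
  have hF : ∀ n : ℤ, fourierCoeff F n = 0 := by
    intro n
    rw [fourierCoeff_eq_intervalIntegral F n 0, zero_add]
    have e : ∀ x : ℝ, fourier (-n) (x : AddCircle (2 * Real.pi)) • F (x : AddCircle (2 * Real.pi))
        = ((Real.cos ((-n : ℤ) * x) * f x : ℝ) : ℂ)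
          + ((Real.sin ((-n : ℤ) * x) * f x : ℝ) : ℂ) * Complex.I := by
      intro x
      have hFx : F (x : AddCircle (2 * Real.pi)) = (f x : ℂ) := rfl
      rw [hFx, fourier_coe_apply, smul_eq_mul]
      have hπ : (Real.pi : ℂ) ≠ 0 := by exact_mod_cast Real.pi_pos.ne'
      rw [show 2 * (Real.pi : ℂ) * Complex.I * ((-n : ℤ) : ℂ) * (x : ℂ) / ((2 * Real.pi : ℝ) : ℂ)
        = (((-n : ℤ) * x : ℝ) : ℂ) * Complex.I by push_cast; field_simp]
      rw [Complex.exp_mul_I, ← Complex.ofReal_cos, ← Complex.ofReal_sin]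
      push_cast
      ring
    simp only [e]
    rw [intervalIntegral.integral_add, intervalIntegral.integral_mul_const,
      intervalIntegral.integral_ofReal, intervalIntegral.integral_ofReal, hcos', hsin']
    · simp
    all_goals exact Continuous.intervalIntegrable (by fun_prop) _ _
  have hsum := hasSum_fourier_series_of_summable (f := F) (by
    rw [show fourierCoeff F = fun _ => 0 from funext hF]; exact summable_zero)
  simp only [hF, zero_smul] at hsum
  have h1 : F = 0 := hsum.unique hasSum_zero
  have h2 : F (s : AddCircle (2 * Real.pi)) = 0 := by rw [h1]; rfl
  have h3 : (f s : ℂ) = 0 := h2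
  exact_mod_cast h3

/-- A bounded Lipschitz increment is a Hölder increment. -/
theorem le_mul_rpow_of_le {x δ M L α : ℝ} (hα : 0 < α) (hα1 : α < 1) (hδ : 0 ≤ δ) (hM : 0 ≤ M)
    (hL : 0 ≤ L) (h1 : x ≤ M) (h2 : x ≤ L * δ) : x ≤ (M + L) * δ ^ α := by
  rcases le_total δ 1 with h | h
  · have h3 : δ ≤ δ ^ α := by
      calc δ = δ ^ (1 : ℝ) := (Real.rpow_one δ).symm
        _ ≤ δ ^ α := Real.rpow_le_rpow_of_exponent_ge_of_imp hδ h hα1.le (by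
          intro _ h; linarith)
    have h4 : 0 ≤ δ ^ α := hδ.trans h3
    nlinarith [mul_nonneg hM h4]
  · have h3 : 1 ≤ δ ^ α := Real.one_le_rpow h hα.le
    nlinarith [mul_nonneg hL (zero_le_one.trans h3)]

theorem isHolder_cos (k : ℕ) {α : ℝ} (hα : 0 < α) (hα1 : α < 1) :
    ∃ C, IsHolder C α (fun s => Real.cos (k * s)) ∧ IsHolder C α (fun s => Real.sin (k * s)) := by
  have aux : ∀ {x δ : ℝ}, 0 ≤ δ → x ≤ 2 → x ≤ k * δ → x ≤ (2 + k) * δ ^ α := fun hδ h2 hk =>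
    le_mul_rpow_of_le hα hα1 hδ zero_le_two k.cast_nonneg h2 hk
  have hk : ∀ s t : ℝ, |(k : ℝ) * s - k * t| = k * |s - t| := fun s t => by
    rw [← mul_sub, abs_mul, Nat.abs_cast]
  refine ⟨2 + k, fun s t => aux (abs_nonneg _) ?_ ?_, fun s t => aux (abs_nonneg _) ?_ ?_⟩
  · refine (abs_sub _ _).trans ?_
    linarith [Real.abs_cos_le_one (k * s), Real.abs_cos_le_one (k * t)]
  · rw [← hk, Real.cos_sub_cos, abs_mul, abs_mul]
    have h1 := Real.abs_sin_le_one ((k * s + k * t) / 2)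
    have h2 := Real.abs_sin_le_abs (x := (k * s - k * t) / 2)
    rw [abs_div, abs_two] at h2
    rw [abs_neg, abs_two]
    nlinarith [abs_nonneg (Real.sin ((k * s - k * t) / 2)),
      abs_nonneg (Real.sin ((k * s + k * t) / 2))]
  · refine (abs_sub _ _).trans ?_
    linarith [Real.abs_sin_le_one (k * s), Real.abs_sin_le_one (k * t)]
  · rw [← hk, Real.sin_sub_sin, abs_mul, abs_mul]
    have h1 := Real.abs_cos_le_one ((k * s + k * t) / 2)
    have h2 := Real.abs_sin_le_abs (x := (k * s - k * t) / 2)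
    rw [abs_div, abs_two] at h2
    rw [abs_two]
    nlinarith [abs_nonneg (Real.sin ((k * s - k * t) / 2)),
      abs_nonneg (Real.cos ((k * s + k * t) / 2))]

theorem periodic_comp_nat_mul {f : ℝ → ℝ} (hf : Function.Periodic f (2 * Real.pi)) (k : ℕ) :
    Function.Periodic (fun s => f (k * s)) (2 * Real.pi) := by
  intro s
  simp only
  rw [mul_add]
  exact hf.nat_mul k _

/-- Conjugate functions have mean zero, by skew-adjointness and `hilb 1 = 0`. -/
theorem IsHolder.integral_hilb {C α : ℝ} {g : ℝ → ℝ} (hα : 0 < α) (hα1 : α < 1)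
    (hg : IsHolder C α g) (hgp : Function.Periodic g (2 * Real.pi)) :
    ∫ s in (0 : ℝ)..(2 * Real.pi), hilb g s = 0 := by
  have := (IsHolder.const 1 α).integral_mul_hilb hα hα1 (fun _ => rfl) hg hgp
  simpa [hilb_const] using this

/-- The conjugation operator squares to minus the identity on functions of mean zero: by
skew-adjointness and `hilb_cos`, `hilb_sin`, both sides have the same Fourier coefficients. -/
theorem IsHolder.hilb_hilb {C α : ℝ} {g : ℝ → ℝ} (hα : 0 < α) (hα1 : α < 1)
    (hg : IsHolder C α g) (hgp : Function.Periodic g (2 * Real.pi)) (s : ℝ) :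
    hilb (hilb g) s = mean g - g s := by
  obtain ⟨K, -, hK⟩ := exists_isHolder_hilb hα hα1
  have h1 := (hK C g hg).1
  have h1p := hilb_periodic hgp
  have h2 := (hK _ _ h1).1
  have h2p := hilb_periodic h1p
  have hgc := hg.continuous hα
  have h2c := h2.continuous hα
  have hzero := eq_zero_of_trigonometric_moments (f := fun s => hilb (hilb g) s + g s - mean g)
    (by fun_prop) (fun s => by simp only; rw [h2p, hgp]) ?_ ?_ ?_ s
  · linarith
  · rw [intervalIntegral.integral_sub, intervalIntegral.integral_add,
      h1.integral_hilb hα hα1 h1p, intervalIntegral.integral_const, mean]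
    · simp only [smul_eq_mul]
      field_simp [Real.pi_pos.ne']
      ring
    all_goals exact Continuous.intervalIntegrable (by fun_prop) _ _
  -- moving both operators onto the trigonometric monomial multiplies it by `-1`
  · intro k
    obtain ⟨D, hcos, hsin⟩ := isHolder_cos (k + 1) hα hα1
    have hcp := periodic_comp_nat_mul Real.cos_periodic (k + 1)
    have hsp := periodic_comp_nat_mul Real.sin_periodic (k + 1)
    have e1 := hcos.integral_mul_hilb hα hα1 hcp h1 h1p
    have e2 := hsin.integral_mul_hilb hα hα1 hsp hg hgp
    simp only [hilb_cos, hilb_sin] at e1 e2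
    have e3 : ∫ s in (0 : ℝ)..(2 * Real.pi), hilb g s * Real.sin ((k + 1 : ℕ) * s)
        = ∫ s in (0 : ℝ)..(2 * Real.pi), Real.sin ((k + 1 : ℕ) * s) * hilb g s :=
      intervalIntegral.integral_congr fun s _ => mul_comm _ _
    have e4 : ∫ s in (0 : ℝ)..(2 * Real.pi), g s * -Real.cos ((k + 1 : ℕ) * s)
        = -∫ s in (0 : ℝ)..(2 * Real.pi), Real.cos ((k + 1 : ℕ) * s) * g s := by
      rw [← intervalIntegral.integral_neg]
      exact intervalIntegral.integral_congr fun s _ => by ring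
    have e5 : ∫ s in (0 : ℝ)..(2 * Real.pi), Real.cos ((k + 1 : ℕ) * s) = 0 := by
      rw [intervalIntegral.integral_comp_mul_left (fun t => Real.cos t) (by positivity)]
      rw [integral_cos, mul_zero, Real.sin_zero, sub_zero]
      have := Real.sin_nat_mul_pi (2 * (k + 1))
      push_cast at this ⊢
      rw [show ((k : ℝ) + 1) * (2 * Real.pi) = 2 * (k + 1) * Real.pi by ring, this, smul_zero]
    simp only [mul_sub, mul_add]
    rw [intervalIntegral.integral_sub, intervalIntegral.integral_add, e1, e3, e2, e4,
      intervalIntegral.integral_mul_const, e5]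
    · ring
    all_goals exact Continuous.intervalIntegrable (by fun_prop) _ _
  · intro k
    obtain ⟨D, hcos, hsin⟩ := isHolder_cos (k + 1) hα hα1
    have hcp := periodic_comp_nat_mul Real.cos_periodic (k + 1)
    have hsp := periodic_comp_nat_mul Real.sin_periodic (k + 1)
    have e1 := hsin.integral_mul_hilb hα hα1 hsp h1 h1p
    have e2 := hcos.integral_mul_hilb hα hα1 hcp hg hgp
    simp only [hilb_cos, hilb_sin] at e1 e2
    have e3 : ∫ s in (0 : ℝ)..(2 * Real.pi), hilb g s * -Real.cos ((k + 1 : ℕ) * s)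
        = -∫ s in (0 : ℝ)..(2 * Real.pi), Real.cos ((k + 1 : ℕ) * s) * hilb g s := by
      rw [← intervalIntegral.integral_neg]
      exact intervalIntegral.integral_congr fun s _ => by ring
    have e4 : ∫ s in (0 : ℝ)..(2 * Real.pi), g s * Real.sin ((k + 1 : ℕ) * s)
        = ∫ s in (0 : ℝ)..(2 * Real.pi), Real.sin ((k + 1 : ℕ) * s) * g s :=
      intervalIntegral.integral_congr fun s _ => mul_comm _ _
    have e5 : ∫ s in (0 : ℝ)..(2 * Real.pi), Real.sin ((k + 1 : ℕ) * s) = 0 := by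
      rw [intervalIntegral.integral_comp_mul_left (fun t => Real.sin t) (by positivity)]
      rw [integral_sin, mul_zero, Real.cos_zero, Real.cos_nat_mul_two_pi, sub_self, smul_zero]
    simp only [mul_sub, mul_add]
    rw [intervalIntegral.integral_sub, intervalIntegral.integral_add, e1, e3, e2, e4,
      intervalIntegral.integral_mul_const, e5]
    · ring
    all_goals exact Continuous.intervalIntegrable (by fun_prop) _ _

/-! ### The logarithmic kernel -/

/-- `log (4 sin² (t / 2))`, the periodic logarithmic kernel; a primitive of `cotHalf` between
consecutive multiples of `2π`. -/
def logKer (t : ℝ) : ℝ := Real.log (4 * Real.sin (t / 2) ^ 2)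

theorem logKer_periodic : Function.Periodic logKer (2 * Real.pi) := by
  intro t
  rw [logKer, logKer, show (t + 2 * Real.pi) / 2 = t / 2 + Real.pi by ring, Real.sin_add_pi,
    neg_sq]

theorem logKer_neg (t : ℝ) : logKer (-t) = logKer t := by
  rw [logKer, logKer, neg_div, Real.sin_neg, neg_sq]

theorem measurable_logKer : Measurable logKer := by
  unfold logKer
  fun_prop

theorem intervalIntegrable_logKer (a b : ℝ) : IntervalIntegrable logKer volume a b := by
  have h : MeromorphicOn (fun t : ℝ => 4 * Real.sin (t / 2) ^ 2) (Set.uIcc a b) :=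
    fun t _ => AnalyticAt.meromorphicAt (by fun_prop)
  exact h.intervalIntegrable_log

theorem hasDerivAt_logKer {t : ℝ} (h : Real.sin (t / 2) ≠ 0) :
    HasDerivAt logKer (cotHalf t) t := by
  have h1 : HasDerivAt (fun t : ℝ => t / 2) (1 / 2) t := (hasDerivAt_id t).div_const 2
  refine (((h1.sin.pow 2).const_mul 4).log (by simpa using h)).congr_deriv ?_
  rw [cotHalf]
  simp only [Nat.add_one_sub_one, pow_one, Nat.cast_ofNat, Pi.pow_apply]
  field_simp

/-- The conjugate function as a convolution of the derivative with the logarithmic kernel. -/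
theorem hilb_eq_integral_logKer {φ φ' : ℝ → ℝ} (hφ : ∀ s, HasDerivAt φ (φ' s) s)
    (hφ' : Continuous φ') (hp : Function.Periodic φ (2 * Real.pi))
    (hp' : Function.Periodic φ' (2 * Real.pi)) (s : ℝ) :
    hilb φ s = 1 / (2 * Real.pi) * ∫ t in (0 : ℝ)..(2 * Real.pi), φ' (s - t) * logKer t := by
  have hπ := Real.pi_pos
  have hφc : Continuous φ := continuous_iff_continuousAt.2 fun s => (hφ s).continuousAt
  obtain ⟨M, hM0, hM⟩ := exists_abs_le_of_periodic hφ' hp'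
  have hlip : ∀ t, 0 < t → |φ (s - t) - φ (s + t)| ≤ 2 * M * t := by
    intro t ht
    have h := convex_univ.norm_image_sub_le_of_norm_hasDerivWithin_le
      (fun s _ => (hφ s).hasDerivWithinAt) (fun s _ => hM s) (Set.mem_univ (s + t))
      (Set.mem_univ (s - t))
    rw [show s - t - (s + t) = -(2 * t) by ring, norm_neg, Real.norm_eq_abs, Real.norm_eq_abs,
      abs_of_pos (by linarith : 0 < 2 * t)] at h
    linarith
  have i1 : IntervalIntegrable (fun t => (φ (s - t) - φ (s + t)) * cotHalf t) volume 0 Real.pi :=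
    intervalIntegrable_mul_cotHalf (C := 2 * M) (α := 1) one_pos (by fun_prop)
      (fun t ht _ => by rw [Real.rpow_one]; exact hlip t ht) le_rfl hπ.le le_rfl
  have im : ∀ a b, IntervalIntegrable (fun t => φ' (s - t) * logKer t) volume a b := fun a b =>
    (intervalIntegrable_logKer a b).continuousOn_mul (by fun_prop)
  have ip : ∀ a b, IntervalIntegrable (fun t => φ' (s + t) * logKer t) volume a b := fun a b =>
    (intervalIntegrable_logKer a b).continuousOn_mul (by fun_prop)
  have key := intervalIntegral.integral_eq_sub_of_hasDerivAt_of_tendsto (a := 0) (b := Real.pi)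
    hπ (f := fun t => (φ (s - t) - φ (s + t)) * logKer t)
    (f' := fun t => (φ (s - t) - φ (s + t)) * cotHalf t
      - (φ' (s - t) * logKer t + φ' (s + t) * logKer t)) (fa := 0) (fb := 0)
    (fun t ht => ?_) (i1.sub ((im 0 Real.pi).add (ip 0 Real.pi))) ?_ ?_
  · rw [intervalIntegral.integral_sub i1 ((im 0 Real.pi).add (ip 0 Real.pi)),
      intervalIntegral.integral_add (im 0 Real.pi) (ip 0 Real.pi)] at key
    have e : ∫ t in (0 : ℝ)..Real.pi, φ' (s + t) * logKer t
        = ∫ t in Real.pi..(2 * Real.pi), φ' (s - t) * logKer t := by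
      have h := intervalIntegral.integral_comp_sub_left (a := 0) (b := Real.pi)
        (fun t => φ' (s - t) * logKer t) (2 * Real.pi)
      rw [show 2 * Real.pi - Real.pi = Real.pi by ring, sub_zero] at h
      rw [← h]
      refine intervalIntegral.integral_congr fun t _ => ?_
      rw [show s - (2 * Real.pi - t) = s + t - 2 * Real.pi by ring, hp'.sub_eq,
        show 2 * Real.pi - t = -t + 2 * Real.pi by ring, logKer_periodic, logKer_neg]
    rw [e, intervalIntegral.integral_add_adjacent_intervals (im _ _) (im _ _)] at key
    rw [hilb]
    congr 1
    linarith
  · have h2 := (hφ (s - t)).comp t ((hasDerivAt_id t).const_sub s)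
    have h3 := (hφ (s + t)).comp t ((hasDerivAt_id t).const_add s)
    refine ((h2.sub h3).mul (hasDerivAt_logKer
      (sin_half_pos ht.1 (by linarith [ht.2])).ne')).congr_deriv ?_
    simp only [Function.comp_apply, Pi.sub_apply]
    ring
  · have h1 : Tendsto (fun t : ℝ => 2 * M * Real.pi *
        |2 * Real.sin (t / 2) * Real.log (2 * Real.sin (t / 2))|) (𝓝[>] 0) (𝓝 0) := by
      have : Continuous fun t : ℝ => 2 * M * Real.pi *
        |2 * Real.sin (t / 2) * Real.log (2 * Real.sin (t / 2))| :=
        continuous_const.mul (continuous_abs.comp (Real.continuous_mul_log.comp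
          (g := fun x : ℝ => x * Real.log x)
          (f := fun t : ℝ => 2 * Real.sin (t / 2)) (by fun_prop)))
      have h := (this.tendsto 0).mono_left (nhdsWithin_le_nhds (s := Set.Ioi 0))
      simpa using h
    refine squeeze_zero_norm' ?_ h1
    filter_upwards [Ioo_mem_nhdsGT hπ] with t ht
    have hs := div_pi_le_sin_half ht.1.le ht.2.le
    have hs0 := sin_half_pos ht.1 (by linarith [ht.2])
    have e : logKer t = 2 * Real.log (2 * Real.sin (t / 2)) := by
      rw [logKer, show 4 * Real.sin (t / 2) ^ 2 = (2 * Real.sin (t / 2)) ^ 2 by ring,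
        Real.log_pow]
      norm_num
    rw [div_le_iff₀ hπ] at hs
    rw [norm_mul, Real.norm_eq_abs, Real.norm_eq_abs, e, abs_mul (2 * _) (Real.log _),
      abs_of_pos (by positivity : 0 < 2 * Real.sin (t / 2)), abs_mul, abs_two]
    calc |φ (s - t) - φ (s + t)| * (2 * |Real.log (2 * Real.sin (t / 2))|)
        ≤ 2 * M * (Real.sin (t / 2) * Real.pi) * (2 * |Real.log (2 * Real.sin (t / 2))|) := by
          gcongr
          exact (hlip t ht.1).trans (by gcongr)
      _ = _ := by ring
  · have hc : ContinuousAt (fun t => (φ (s - t) - φ (s + t)) * logKer t) Real.pi := by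
      refine ContinuousAt.mul (by fun_prop) (hasDerivAt_logKer ?_).continuousAt
      simp
    have h := hc.tendsto.mono_left (nhdsWithin_le_nhds (s := Set.Iio Real.pi))
    have e : φ (s - Real.pi) - φ (s + Real.pi) = 0 := by
      rw [show s + Real.pi = s - Real.pi + 2 * Real.pi by ring, hp, sub_self]
    simpa [e] using h

/-! ### Hölder kernels -/

/-- A function of two real variables that is `2π`-periodic in each of them. -/
def BiPeriodic (F : ℝ → ℝ → ℝ) : Prop :=
  (∀ s σ, F (s + 2 * Real.pi) σ = F s σ) ∧ ∀ s σ, F s (σ + 2 * Real.pi) = F s σ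

/-- A continuous doubly periodic kernel that is Hölder continuous in its first variable, uniformly
in the second one. -/
structure HolderKernel (α : ℝ) (F : ℝ → ℝ → ℝ) : Prop where
  continuous : Continuous (Function.uncurry F)
  periodic : BiPeriodic F
  holder : ∃ C, ∀ s s' σ, |F s σ - F s' σ| ≤ C * |s - s'| ^ α

theorem BiPeriodic.exists_abs_le {F : ℝ → ℝ → ℝ} (hp : BiPeriodic F)
    (hc : Continuous (Function.uncurry F)) : ∃ M : ℝ, 0 ≤ M ∧ ∀ s σ, |F s σ| ≤ M := by
  obtain ⟨M, hM⟩ := (isCompact_Icc.prod isCompact_Icc).exists_bound_of_continuousOn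
    (s := Set.Icc 0 (2 * Real.pi) ×ˢ Set.Icc 0 (2 * Real.pi)) hc.continuousOn
  have h0 : (0 : ℝ) ∈ Set.Icc 0 (2 * Real.pi) := ⟨le_rfl, Real.two_pi_pos.le⟩
  refine ⟨M, (norm_nonneg _).trans (hM (0, 0) ⟨h0, h0⟩), fun s σ => ?_⟩
  have h1 : Function.Periodic (fun s => F s σ) (2 * Real.pi) := fun s => hp.1 s σ
  obtain ⟨s', hs', hs⟩ := h1.exists_mem_Ico₀ Real.two_pi_pos s
  have h2 : Function.Periodic (fun σ => F s' σ) (2 * Real.pi) := fun σ => hp.2 s' σ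
  obtain ⟨σ', hσ', hσ⟩ := h2.exists_mem_Ico₀ Real.two_pi_pos σ
  rw [hs, hσ]
  exact hM (s', σ') ⟨⟨hs'.1, hs'.2.le⟩, ⟨hσ'.1, hσ'.2.le⟩⟩

theorem HolderKernel.exists_bound {α : ℝ} {F : ℝ → ℝ → ℝ} (hF : HolderKernel α F) :
    ∃ M : ℝ, 0 ≤ M ∧ (∀ s σ, |F s σ| ≤ M) ∧ ∀ s s' σ, |F s σ - F s' σ| ≤ M * |s - s'| ^ α := by
  obtain ⟨M, hM0, hM⟩ := hF.periodic.exists_abs_le hF.continuous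
  obtain ⟨C, hC⟩ := hF.holder
  refine ⟨max M C, le_max_of_le_left hM0, fun s σ => (hM s σ).trans (le_max_left _ _),
    fun s s' σ => (hC s s' σ).trans ?_⟩
  gcongr
  exact le_max_right _ _

theorem HolderKernel.mul {α : ℝ} {F G : ℝ → ℝ → ℝ} (hF : HolderKernel α F)
    (hG : HolderKernel α G) : HolderKernel α fun s σ => F s σ * G s σ := by
  obtain ⟨M, hM0, hM, hM'⟩ := hF.exists_bound
  obtain ⟨N, hN0, hN, hN'⟩ := hG.exists_bound
  refine ⟨hF.continuous.mul hG.continuous,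
    ⟨fun s σ => by simp only [hF.periodic.1, hG.periodic.1],
      fun s σ => by simp only [hF.periodic.2, hG.periodic.2]⟩, 2 * (M * N), fun s s' σ => ?_⟩
  calc |F s σ * G s σ - F s' σ * G s' σ|
      = |F s σ * (G s σ - G s' σ) + (F s σ - F s' σ) * G s' σ| := by ring_nf
    _ ≤ |F s σ| * |G s σ - G s' σ| + |F s σ - F s' σ| * |G s' σ| := by
      rw [← abs_mul, ← abs_mul]; exact abs_add_le _ _
    _ ≤ M * (N * |s - s'| ^ α) + M * |s - s'| ^ α * N :=
      add_le_add (mul_le_mul (hM _ _) (hN' _ _ _) (abs_nonneg _) hM0)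
        (mul_le_mul (hM' _ _ _) (hN _ _) (abs_nonneg _) (by positivity))
    _ = _ := by ring

theorem HolderKernel.add {α : ℝ} {F G : ℝ → ℝ → ℝ} (hF : HolderKernel α F)
    (hG : HolderKernel α G) : HolderKernel α fun s σ => F s σ + G s σ := by
  obtain ⟨C, hC⟩ := hF.holder
  obtain ⟨D, hD⟩ := hG.holder
  refine ⟨hF.continuous.add hG.continuous,
    ⟨fun s σ => by simp only [hF.periodic.1, hG.periodic.1],
      fun s σ => by simp only [hF.periodic.2, hG.periodic.2]⟩, C + D, fun s s' σ => ?_⟩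
  calc |F s σ + G s σ - (F s' σ + G s' σ)| = |(F s σ - F s' σ) + (G s σ - G s' σ)| := by ring_nf
    _ ≤ |F s σ - F s' σ| + |G s σ - G s' σ| := abs_add_le _ _
    _ ≤ C * |s - s'| ^ α + D * |s - s'| ^ α := add_le_add (hC _ _ _) (hD _ _ _)
    _ = _ := by ring

theorem HolderKernel.const (α c : ℝ) : HolderKernel α fun _ _ => c :=
  ⟨continuous_const, ⟨fun _ _ => rfl, fun _ _ => rfl⟩, 0, fun s s' σ => by simp⟩

theorem HolderKernel.sum {α : ℝ} {ι : Type*} (t : Finset ι) {F : ι → ℝ → ℝ → ℝ}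
    (hF : ∀ i ∈ t, HolderKernel α (F i)) : HolderKernel α fun s σ => ∑ i ∈ t, F i s σ := by
  classical
  induction t using Finset.induction_on with
  | empty => simpa using HolderKernel.const α 0
  | insert i t hi ih =>
    simp only [Finset.sum_insert hi]
    exact (hF i (Finset.mem_insert_self i t)).add
      (ih fun j hj => hF j (Finset.mem_insert_of_mem hj))

theorem holderKernel_of_hasDerivAt {α : ℝ} (hα : 0 < α) (hα1 : α < 1) {F F' : ℝ → ℝ → ℝ}
    (hF : Continuous (Function.uncurry F)) (hp : BiPeriodic F)
    (hF' : Continuous (Function.uncurry F')) (hp' : BiPeriodic F')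
    (hd : ∀ s σ, HasDerivAt (fun s => F s σ) (F' s σ) s) : HolderKernel α F := by
  obtain ⟨M, hM0, hM⟩ := hp.exists_abs_le hF
  obtain ⟨L, hL0, hL⟩ := hp'.exists_abs_le hF'
  refine ⟨hF, hp, 2 * M + L, fun s s' σ => ?_⟩
  refine le_mul_rpow_of_le hα hα1 (abs_nonneg _) (by linarith) hL0 ?_ ?_
  · refine (abs_sub _ _).trans ?_
    linarith [hM s σ, hM s' σ]
  · exact convex_univ.norm_image_sub_le_of_norm_hasDerivWithin_le
      (fun s _ => (hd s σ).hasDerivWithinAt) (fun s _ => hL s σ) (Set.mem_univ s')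
      (Set.mem_univ s)

theorem holderKernel_comp_sub {α C : ℝ} (hα : 0 < α) {g : ℝ → ℝ} (hg : IsHolder C α g)
    (hp : Function.Periodic g (2 * Real.pi)) : HolderKernel α fun s σ => g (s - σ) := by
  have hc := hg.continuous hα
  refine ⟨hc.comp (continuous_fst.sub continuous_snd),
    ⟨fun s σ => by
        change g _ = g _
        rw [show s + 2 * Real.pi - σ = s - σ + 2 * Real.pi by ring, hp],
      fun s σ => by
        change g _ = g _
        rw [show s - (σ + 2 * Real.pi) = s - σ - 2 * Real.pi by ring, hp.sub_eq]⟩,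
    C, fun s s' σ => ?_⟩
  have := hg (s - σ) (s' - σ)
  rwa [sub_sub_sub_cancel_right] at this

/-- The partial derivative in the first variable. -/
def partialFst (F : ℝ → ℝ → ℝ) (s σ : ℝ) : ℝ := fderiv ℝ (Function.uncurry F) (s, σ) (1, 0)

theorem hasDerivAt_partialFst {F : ℝ → ℝ → ℝ} (hF : ContDiff ℝ 1 (Function.uncurry F))
    (s σ : ℝ) : HasDerivAt (fun s => F s σ) (partialFst F s σ) s := by
  have h := ((hF.differentiable one_ne_zero) (s, σ)).hasFDerivAt
  have h2 : HasDerivAt (fun s : ℝ => (s, σ)) ((1 : ℝ), (0 : ℝ)) s :=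
    (hasDerivAt_id s).prodMk (hasDerivAt_const s σ)
  exact h.comp_hasDerivAt s h2

theorem BiPeriodic.partialFst {F : ℝ → ℝ → ℝ} (hF : ContDiff ℝ 1 (Function.uncurry F))
    (hp : BiPeriodic F) : BiPeriodic (partialFst F) := by
  constructor
  · intro s σ
    have h1 := (hasDerivAt_partialFst hF (s + 2 * Real.pi) σ).comp s
      ((hasDerivAt_id s).add_const (2 * Real.pi))
    have h2 : ((fun s => F s σ) ∘ fun x => id x + 2 * Real.pi) = fun s => F s σ :=
      funext fun s => hp.1 s σ
    rw [h2, mul_one] at h1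
    exact h1.unique (hasDerivAt_partialFst hF s σ)
  · intro s σ
    have h1 := hasDerivAt_partialFst hF s (σ + 2 * Real.pi)
    simp only [hp.2] at h1
    exact h1.unique (hasDerivAt_partialFst hF s σ)

theorem contDiff_partialFst {F : ℝ → ℝ → ℝ} (hF : ContDiff ℝ 2 (Function.uncurry F)) :
    ContDiff ℝ 1 (Function.uncurry (partialFst F)) := by
  have h : ContDiff ℝ 1 (fderiv ℝ (Function.uncurry F)) := hF.fderiv_right (by norm_num)
  exact h.clm_apply contDiff_const

theorem holderKernel_of_contDiff {α : ℝ} (hα : 0 < α) (hα1 : α < 1) {F : ℝ → ℝ → ℝ}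
    (hF : ContDiff ℝ 1 (Function.uncurry F)) (hp : BiPeriodic F) : HolderKernel α F := by
  refine holderKernel_of_hasDerivAt hα hα1 hF.continuous hp ?_ (hp.partialFst hF)
    (hasDerivAt_partialFst hF)
  exact (hF.continuous_fderiv one_ne_zero).clm_apply continuous_const

/-! ### The correction `y² log y` of the logarithmic kernel -/

/-- `x ↦ x log x` is Hölder continuous of every exponent below `1`. -/
theorem exists_abs_mul_log_sub_le {α : ℝ} (hα : 0 < α) (hα1 : α < 1) :
    ∃ C : ℝ, 0 ≤ C ∧ ∀ a b : ℝ, |a| ≤ 2 → |b| ≤ 2 →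
      |a * Real.log a - b * Real.log b| ≤ C * |a - b| ^ α := by
  have hβ : 0 < 1 - α := by linarith
  set K : ℝ := 1 / (1 - α) + 2 with hK
  have hK0 : 0 ≤ K := by positivity
  have hlog : ∀ b : ℝ, b ≠ 0 → |b| ≤ 2 → |b| ^ (1 - α) * |Real.log b| ≤ K := by
    intro b hb0 hb
    have hb' : 0 < |b| := abs_pos.2 hb0
    rw [← Real.log_abs b]
    rcases le_total |b| 1 with h | h
    · have h1 := (Real.abs_log_mul_self_rpow_lt |b| (1 - α) hb' h hβ).le
      rw [abs_mul, abs_of_nonneg (Real.rpow_nonneg hb'.le _), mul_comm] at h1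
      linarith
    · have h1 : |b| ^ (1 - α) ≤ 2 := by
        calc |b| ^ (1 - α) ≤ |b| ^ (1 : ℝ) := Real.rpow_le_rpow_of_exponent_le h (by linarith)
          _ ≤ 2 := by rwa [Real.rpow_one]
      have h2 : |Real.log (|b|)| ≤ 1 := by
        rw [abs_of_nonneg (Real.log_nonneg h)]
        linarith [Real.log_le_sub_one_of_pos hb']
      have h3 : 0 ≤ 1 / (1 - α) := by positivity
      nlinarith [abs_nonneg (Real.log (|b|)), Real.rpow_nonneg hb'.le (1 - α)]
  -- it suffices to treat `|a| ≤ |b|`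
  suffices main : ∀ a b : ℝ, |a| ≤ |b| → |b| ≤ 2 →
      |a * Real.log a - b * Real.log b| ≤ (4 + 2 * K) * |a - b| ^ α by
    refine ⟨4 + 2 * K, by positivity, fun a b ha hb => ?_⟩
    rcases le_total |a| |b| with h | h
    · exact main a b h hb
    · rw [abs_sub_comm, abs_sub_comm a b]
      exact main b a h ha
  intro a b hab hb
  rcases eq_or_ne b 0 with rfl | hb0
  · have : a = 0 := by simpa using hab
    subst this
    simp [Real.zero_rpow hα.ne']
  have hb' : 0 < |b| := abs_pos.2 hb0
  have hd : |a - b| ≤ 2 * |b| := (abs_sub _ _).trans (by linarith)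
  have hsplit : ∀ D, 0 ≤ D → |a - b| ≤ 2 * D → |a - b| ≤ |a - b| ^ α * (2 * D ^ (1 - α)) := by
    intro D hD0 hD
    have h1 : |a - b| = |a - b| ^ α * |a - b| ^ (1 - α) := by
      rw [← Real.rpow_add_of_nonneg (abs_nonneg _) hα.le hβ.le]
      simp
    have h2 : |a - b| ^ (1 - α) ≤ 2 * D ^ (1 - α) := by
      calc |a - b| ^ (1 - α) ≤ (2 * D) ^ (1 - α) := by gcongr
        _ = 2 ^ (1 - α) * D ^ (1 - α) := Real.mul_rpow (by norm_num) hD0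
        _ ≤ 2 * D ^ (1 - α) := by
          gcongr
          calc (2 : ℝ) ^ (1 - α) ≤ 2 ^ (1 : ℝ) :=
                Real.rpow_le_rpow_of_exponent_le (by norm_num) (by linarith)
            _ = 2 := Real.rpow_one 2
    calc |a - b| = |a - b| ^ α * |a - b| ^ (1 - α) := h1
      _ ≤ _ := by gcongr
  have hA : |a * (Real.log a - Real.log b)| ≤ |a - b| := by
    rcases eq_or_ne a 0 with rfl | ha0
    · simp
    have ha' : 0 < |a| := abs_pos.2 ha0
    rw [abs_mul, ← Real.log_abs a, ← Real.log_abs b, abs_sub_comm, ← Real.log_div hb'.ne' ha'.ne',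
      abs_of_nonneg (Real.log_nonneg ((one_le_div ha').2 hab))]
    have h1 := Real.log_le_sub_one_of_pos (div_pos hb' ha')
    calc |a| * Real.log (|b| / |a|) ≤ |a| * (|b| / |a| - 1) := by gcongr
      _ = |b| - |a| := by field_simp
      _ ≤ |a - b| := by rw [abs_sub_comm]; exact abs_sub_abs_le_abs_sub b a
  have hB : |(a - b) * Real.log b| ≤ 2 * K * |a - b| ^ α := by
    rw [abs_mul]
    calc |a - b| * |Real.log b| ≤ |a - b| ^ α * (2 * |b| ^ (1 - α)) * |Real.log b| := by
          gcongr
          exact hsplit |b| hb'.le hd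
      _ = 2 * |a - b| ^ α * (|b| ^ (1 - α) * |Real.log b|) := by ring
      _ ≤ 2 * |a - b| ^ α * K := by
        gcongr
        exact hlog b hb0 hb
      _ = _ := by ring
  have hC : |a - b| ≤ 4 * |a - b| ^ α := by
    have h1 := hsplit 2 (by norm_num) (hd.trans (by linarith))
    have h2 : (2 : ℝ) ^ (1 - α) ≤ 2 := by
      calc (2 : ℝ) ^ (1 - α) ≤ 2 ^ (1 : ℝ) :=
            Real.rpow_le_rpow_of_exponent_le (by norm_num) (by linarith)
        _ = 2 := Real.rpow_one 2
    have h3 : 0 ≤ |a - b| ^ α := by positivity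
    nlinarith
  calc |a * Real.log a - b * Real.log b|
      = |a * (Real.log a - Real.log b) + (a - b) * Real.log b| := by ring_nf
    _ ≤ |a - b| + 2 * K * |a - b| ^ α := (abs_add_le _ _).trans (add_le_add hA hB)
    _ ≤ _ := by linarith

theorem hasDerivAt_sq_mul_log (y : ℝ) :
    HasDerivAt (fun y : ℝ => y * (y * Real.log y)) (2 * (y * Real.log y) + y) y := by
  rcases eq_or_ne y 0 with rfl | hy
  · rw [hasDerivAt_iff_tendsto_slope]
    have h := Real.continuous_mul_log.tendsto 0
    simp only [zero_mul] at h
    simp only [zero_mul, mul_zero, add_zero]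
    refine (h.mono_left nhdsWithin_le_nhds).congr' ?_
    filter_upwards [self_mem_nhdsWithin] with z hz
    have hz : z ≠ 0 := hz
    rw [slope_def_field]
    field_simp
    ring
  · refine ((hasDerivAt_id y).mul ((hasDerivAt_id y).mul (Real.hasDerivAt_log hy))).congr_deriv ?_
    simp only [id, Pi.mul_apply]
    field_simp
    ring

/-- `-½ · 4 sin² (t / 2) log (4 sin² (t / 2))`, the leading correction to the logarithmic kernel. -/
def logCorr (t : ℝ) : ℝ :=
  -(2 * Real.sin (t / 2) * (2 * Real.sin (t / 2) * Real.log (2 * Real.sin (t / 2))))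

/-- The derivative of `logCorr`. -/
def logCorr' (t : ℝ) : ℝ :=
  -(2 * (2 * Real.sin (t / 2) * Real.log (2 * Real.sin (t / 2))) + 2 * Real.sin (t / 2))
    * Real.cos (t / 2)

theorem logCorr_eq (t : ℝ) : logCorr t = -(1 / 2) * logKer t * (4 * Real.sin (t / 2) ^ 2) := by
  rw [logCorr, logKer, show 4 * Real.sin (t / 2) ^ 2 = (2 * Real.sin (t / 2)) ^ 2 by ring,
    Real.log_pow]
  push_cast
  ring

theorem hasDerivAt_two_mul_sin_half (t : ℝ) :
    HasDerivAt (fun t : ℝ => 2 * Real.sin (t / 2)) (Real.cos (t / 2)) t := by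
  have h1 : HasDerivAt (fun t : ℝ => t / 2) (1 / 2) t := (hasDerivAt_id t).div_const 2
  exact (h1.sin.const_mul 2).congr_deriv (by ring)

theorem hasDerivAt_logCorr (t : ℝ) : HasDerivAt logCorr (logCorr' t) t := by
  refine ((hasDerivAt_sq_mul_log (2 * Real.sin (t / 2))).comp t
    (hasDerivAt_two_mul_sin_half t)).neg.congr_deriv ?_
  rw [logCorr']
  ring

theorem logCorr_periodic : Function.Periodic logCorr (2 * Real.pi) := by
  intro t
  rw [logCorr, logCorr, show (t + 2 * Real.pi) / 2 = t / 2 + Real.pi by ring, Real.sin_add_pi,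
    mul_neg, Real.log_neg_eq_log]
  ring

theorem logCorr'_periodic : Function.Periodic logCorr' (2 * Real.pi) := by
  intro t
  rw [logCorr', logCorr', show (t + 2 * Real.pi) / 2 = t / 2 + Real.pi by ring, Real.sin_add_pi,
    Real.cos_add_pi]
  simp only [mul_neg, Real.log_neg_eq_log]
  ring

theorem IsHolder.mul {C D M N α : ℝ} {f g : ℝ → ℝ} (hf : IsHolder C α f)
    (hg : IsHolder D α g) (hM : ∀ s, |f s| ≤ M) (hN : ∀ s, |g s| ≤ N) :
    IsHolder (M * D + C * N) α fun s => f s * g s := by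
  intro s t
  have hM0 := (abs_nonneg _).trans (hM 0)
  have hC := hf.nonneg
  calc |f s * g s - f t * g t| = |f s * (g s - g t) + (f s - f t) * g t| := by ring_nf
    _ ≤ |f s| * |g s - g t| + |f s - f t| * |g t| := by
      rw [← abs_mul, ← abs_mul]; exact abs_add_le _ _
    _ ≤ M * (D * |s - t| ^ α) + C * |s - t| ^ α * N :=
      add_le_add (mul_le_mul (hM _) (hg _ _) (abs_nonneg _) hM0)
        (mul_le_mul (hf _ _) (hN _) (abs_nonneg _) (by positivity))
    _ = _ := by ring

theorem abs_two_mul_sin_half_le (t : ℝ) : |2 * Real.sin (t / 2)| ≤ 2 := by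
  rw [abs_mul, abs_two]
  linarith [Real.abs_sin_le_one (t / 2)]

theorem exists_isHolder_logCorr' {α : ℝ} (hα : 0 < α) (hα1 : α < 1) :
    ∃ C, IsHolder C α logCorr' := by
  obtain ⟨C, hC0, hC⟩ := exists_abs_mul_log_sub_le hα hα1
  have hlip : ∀ s t : ℝ, |2 * Real.sin (s / 2) - 2 * Real.sin (t / 2)| ≤ |s - t| := fun s t => by
    have := convex_univ.norm_image_sub_le_of_norm_hasDerivWithin_le (C := 1)
      (fun s _ => (hasDerivAt_two_mul_sin_half s).hasDerivWithinAt)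
      (fun s _ => Real.abs_cos_le_one (s / 2)) (Set.mem_univ t) (Set.mem_univ s)
    simpa using this
  have hlip' : ∀ s t : ℝ, |Real.cos (s / 2) - Real.cos (t / 2)| ≤ 1 * |s - t| := fun s t => by
    have hd : ∀ s, HasDerivAt (fun t : ℝ => Real.cos (t / 2)) (-Real.sin (s / 2) * (1 / 2)) s :=
      fun s => HasDerivAt.cos (f := fun t : ℝ => t / 2) ((hasDerivAt_id s).div_const 2)
    refine convex_univ.norm_image_sub_le_of_norm_hasDerivWithin_le (C := 1)
      (fun s _ => (hd s).hasDerivWithinAt) (fun s _ => ?_) (Set.mem_univ t) (Set.mem_univ s)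
    rw [Real.norm_eq_abs, abs_mul, abs_neg, abs_of_pos (by norm_num : (0 : ℝ) < 1 / 2)]
    linarith [Real.abs_sin_le_one (s / 2)]
  have h1 : IsHolder C α fun t => 2 * Real.sin (t / 2) * Real.log (2 * Real.sin (t / 2)) := by
    intro s t
    refine (hC _ _ (abs_two_mul_sin_half_le s) (abs_two_mul_sin_half_le t)).trans ?_
    exact mul_le_mul_of_nonneg_left (Real.rpow_le_rpow (abs_nonneg _) (hlip s t) hα.le) hC0
  have h2 : IsHolder (4 + 1) α fun t => 2 * Real.sin (t / 2) := fun s t =>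
    le_mul_rpow_of_le hα hα1 (abs_nonneg _) (by norm_num) (by norm_num)
      ((abs_sub _ _).trans (by linarith [abs_two_mul_sin_half_le s, abs_two_mul_sin_half_le t]))
      (by rw [one_mul]; exact hlip s t)
  have h3 : IsHolder (2 + 1) α fun t => Real.cos (t / 2) := fun s t =>
    le_mul_rpow_of_le hα hα1 (abs_nonneg _) (by norm_num) (by norm_num)
      ((abs_sub _ _).trans (by linarith [Real.abs_cos_le_one (s / 2), Real.abs_cos_le_one (t / 2)]))
      (hlip' s t)
  have h4 := ((h1.const_mul 2).add h2).const_mul (-1)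
  have hc4 := h4.continuous hα
  have hp4 : Function.Periodic (fun t => |-1 * (2 * (2 * Real.sin (t / 2) *
      Real.log (2 * Real.sin (t / 2))) + 2 * Real.sin (t / 2))|) (2 * Real.pi) := by
    intro t
    simp only
    rw [show (t + 2 * Real.pi) / 2 = t / 2 + Real.pi by ring, Real.sin_add_pi, mul_neg,
      Real.log_neg_eq_log, ← abs_neg]
    ring_nf
  obtain ⟨M, -, hM⟩ := exists_abs_le_of_periodic (continuous_abs.comp hc4) hp4
  have h5 := IsHolder.mul h4 h3 (fun s => by simpa using hM s)
    (fun s => Real.abs_cos_le_one (s / 2))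
  simp only [neg_one_mul] at h5
  exact ⟨_, h5⟩

/-! ### The kernels on the boundary curve -/

theorem hasFDerivAt_integral_unitInterval {E : Type*} [NormedAddCommGroup E] [NormedSpace ℝ E]
    {f : (ℝ × ℝ) × ℝ → E} (hf : ContDiff ℝ 1 f) (p : ℝ × ℝ) :
    HasFDerivAt (fun p => ∫ τ in (0 : ℝ)..1, f (p, τ))
      (∫ τ in (0 : ℝ)..1, (fderiv ℝ f (p, τ)).comp (ContinuousLinearMap.inl ℝ (ℝ × ℝ) ℝ)) p := by
  have hd : Continuous fun q : (ℝ × ℝ) × ℝ =>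
      (fderiv ℝ f q).comp (ContinuousLinearMap.inl ℝ (ℝ × ℝ) ℝ) :=
    (hf.continuous_fderiv one_ne_zero).clm_comp continuous_const
  have hfc := hf.continuous
  obtain ⟨M, hM⟩ := ((isCompact_closedBall p 1).prod
    (isCompact_Icc (a := (0 : ℝ)) (b := 1))).exists_bound_of_continuousOn hd.continuousOn
  refine intervalIntegral.hasFDerivAt_integral_of_dominated_of_fderiv_le
    (F := fun p τ => f (p, τ)) (F' := fun p τ =>
      (fderiv ℝ f (p, τ)).comp (ContinuousLinearMap.inl ℝ (ℝ × ℝ) ℝ)) (bound := fun _ => M)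
    (Metric.closedBall_mem_nhds p one_pos)
    (Eventually.of_forall fun q => Continuous.aestronglyMeasurable (by fun_prop))
    (Continuous.intervalIntegrable (by fun_prop) _ _)
    (Continuous.aestronglyMeasurable (hd.comp (by fun_prop : Continuous fun τ : ℝ => (p, τ))))
    ?_ intervalIntegrable_const ?_
  · refine ae_of_all _ fun τ hτ q hq => hM (q, τ) ⟨hq, ?_⟩
    rw [Set.uIoc_of_le zero_le_one] at hτ
    exact ⟨hτ.1.le, hτ.2⟩
  · refine ae_of_all _ fun τ _ q _ => ?_
    have h1 := (hf.differentiable one_ne_zero (q, τ)).hasFDerivAt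
    exact h1.comp q (hasFDerivAt_prodMk_left q τ)

theorem contDiff_integral_unitInterval (n : ℕ) {E : Type} [NormedAddCommGroup E]
    [NormedSpace ℝ E] {f : (ℝ × ℝ) × ℝ → E} (hf : ContDiff ℝ n f) :
    ContDiff ℝ n fun p : ℝ × ℝ => ∫ τ in (0 : ℝ)..1, f (p, τ) := by
  induction n generalizing E with
  | zero =>
    have hc := hf.continuous
    exact contDiff_zero.2 (intervalIntegral.continuous_parametric_intervalIntegral_of_continuous'
      (f := fun p τ => f (p, τ)) hc _ _)
  | succ n ih =>
    push_cast at hf ⊢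
    rw [contDiff_succ_iff_hasFDerivAt]
    have h1 : ContDiff ℝ n fun q : (ℝ × ℝ) × ℝ =>
        (fderiv ℝ f q).comp (ContinuousLinearMap.inl ℝ (ℝ × ℝ) ℝ) :=
      (hf.fderiv_right le_rfl).clm_comp contDiff_const
    exact ⟨_, ih h1, fun p => hasFDerivAt_integral_unitInterval
      (hf.of_le (by exact_mod_cast Nat.le_add_left 1 n)) p⟩

/-- The averaged difference quotient `(x(s) - x(σ)) / (s - σ) = ∫₀¹ x'(σ + τ (s - σ)) dτ`. -/
def chord (x : ℝ → EuclideanSpace ℝ (Fin 2)) (p : ℝ × ℝ) : EuclideanSpace ℝ (Fin 2) :=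
  ∫ τ in (0 : ℝ)..1, deriv x (p.2 + τ * (p.1 - p.2))

/-- `sin ((s - σ) / 2) / ((s - σ) / 2)`, in the same form. -/
def sineChord (p : ℝ × ℝ) : ℝ := ∫ τ in (0 : ℝ)..1, Real.cos (τ * ((p.1 - p.2) / 2))

theorem contDiff_chord {x : ℝ → EuclideanSpace ℝ (Fin 2)} (hx : ContDiff ℝ 3 x) :
    ContDiff ℝ 2 (chord x) := by
  have h : ContDiff ℝ 2 (deriv x) := by
    have h3 : ContDiff ℝ (2 + 1) x := by norm_num; exact hx
    exact (contDiff_succ_iff_deriv.1 h3).2.2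
  exact contDiff_integral_unitInterval 2
    (f := fun q : (ℝ × ℝ) × ℝ => deriv x (q.1.2 + q.2 * (q.1.1 - q.1.2)))
    (h.comp (by fun_prop))

theorem contDiff_sineChord : ContDiff ℝ 2 sineChord :=
  contDiff_integral_unitInterval 2
    (f := fun q : (ℝ × ℝ) × ℝ => Real.cos (q.2 * ((q.1.1 - q.1.2) / 2))) (by fun_prop)

theorem integral_deriv_segment {E : Type*} [NormedAddCommGroup E] [NormedSpace ℝ E]
    [CompleteSpace E] {f f' : ℝ → E} (hf : ∀ s, HasDerivAt f (f' s) s) (hf' : Continuous f')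
    (s σ : ℝ) : (s - σ) • ∫ τ in (0 : ℝ)..1, f' (σ + τ * (s - σ)) = f s - f σ := by
  have hd : ∀ τ : ℝ, HasDerivAt (fun τ => f (σ + τ * (s - σ)))
      ((s - σ) • f' (σ + τ * (s - σ))) τ := by
    intro τ
    have h1 : HasDerivAt (fun τ : ℝ => σ + τ * (s - σ)) (s - σ) τ := by
      simpa using ((hasDerivAt_id τ).mul_const (s - σ)).const_add σ
    exact (hf (σ + τ * (s - σ))).scomp τ h1
  have h := intervalIntegral.integral_eq_sub_of_hasDerivAt (a := 0) (b := 1)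
    (fun τ _ => hd τ) (Continuous.intervalIntegrable (by fun_prop) _ _)
  rw [intervalIntegral.integral_smul] at h
  rw [h]
  simp

theorem smul_chord {x : ℝ → EuclideanSpace ℝ (Fin 2)} (hx : ContDiff ℝ 3 x) (s σ : ℝ) :
    (s - σ) • chord x (s, σ) = x s - x σ :=
  integral_deriv_segment
    (fun s => ((hx.differentiable (by norm_num)) s).hasDerivAt)
    (hx.continuous_deriv (by norm_num)) s σ

theorem mul_sineChord (s σ : ℝ) :
    (s - σ) / 2 * sineChord (s, σ) = Real.sin ((s - σ) / 2) := by
  have h := integral_deriv_segment Real.hasDerivAt_sin Real.continuous_cos ((s - σ) / 2) 0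
  simp [sineChord] at h ⊢

theorem chord_self (x : ℝ → EuclideanSpace ℝ (Fin 2)) (s : ℝ) : chord x (s, s) = deriv x s := by
  simp [chord]

theorem sineChord_self (s : ℝ) : sineChord (s, s) = 1 := by
  simp [sineChord]

theorem sin_half_ne_zero {t : ℝ} (h : |t| < 2 * Real.pi) (h0 : t ≠ 0) :
    Real.sin (t / 2) ≠ 0 := by
  rcases lt_or_gt_of_ne h0 with h1 | h1
  · have := sin_half_pos (t := -t) (by linarith) (by linarith [neg_abs_le t])
    rw [neg_div, Real.sin_neg] at this
    linarith
  · exact (sin_half_pos h1 (by linarith [le_abs_self t])).ne'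

theorem sineChord_ne_zero {p : ℝ × ℝ} (hp : |p.1 - p.2| < 2 * Real.pi) : sineChord p ≠ 0 := by
  obtain ⟨s, σ⟩ := p
  rcases eq_or_ne s σ with rfl | hne
  · rw [sineChord_self]
    exact one_ne_zero
  · have h := mul_sineChord s σ
    intro h0
    rw [h0, mul_zero] at h
    exact sin_half_ne_zero hp (sub_ne_zero.2 hne) h.symm

open Classical in
/-- `|x(s) - x(σ)|² / (4 sin² ((s - σ) / 2))`, completed by `|x'(s)|²` on the diagonal. -/
def chordRatio (x : ℝ → EuclideanSpace ℝ (Fin 2)) (s σ : ℝ) : ℝ :=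
  if Real.sin ((s - σ) / 2) = 0 then ‖deriv x s‖ ^ 2
  else ‖x s - x σ‖ ^ 2 / (4 * Real.sin ((s - σ) / 2) ^ 2)

theorem IsBoundaryParam.deriv_periodic {x : ℝ → EuclideanSpace ℝ (Fin 2)}
    (hx : IsBoundaryParam x) : Function.Periodic (deriv x) (2 * Real.pi) := by
  intro s
  rw [← deriv_comp_add_const, show (fun y => x (y + 2 * Real.pi)) = x from funext hx.periodic]

theorem IsBoundaryParam.biPeriodic_chordRatio {x : ℝ → EuclideanSpace ℝ (Fin 2)}
    (hx : IsBoundaryParam x) : BiPeriodic (chordRatio x) := by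
  constructor
  · intro s σ
    simp only [chordRatio]
    rw [show (s + 2 * Real.pi - σ) / 2 = (s - σ) / 2 + Real.pi by ring, Real.sin_add_pi,
      neg_sq, hx.periodic, hx.deriv_periodic]
    simp only [neg_eq_zero]
  · intro s σ
    simp only [chordRatio]
    rw [show (s - (σ + 2 * Real.pi)) / 2 = (s - σ) / 2 - Real.pi by ring, Real.sin_sub_pi,
      neg_sq, hx.periodic]
    simp only [neg_eq_zero]

theorem IsBoundaryParam.chordRatio_eq {x : ℝ → EuclideanSpace ℝ (Fin 2)}
    (hx : IsBoundaryParam x) {s σ : ℝ} (h : |s - σ| < 2 * Real.pi) :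
    chordRatio x s σ = ‖chord x (s, σ)‖ ^ 2 / sineChord (s, σ) ^ 2 := by
  rcases eq_or_ne s σ with rfl | hne
  · rw [chordRatio, if_pos (by simp), chord_self, sineChord_self]
    simp
  · have h0 := sub_ne_zero.2 hne
    have h1 := sin_half_ne_zero h h0
    have h2 : sineChord (s, σ) ≠ 0 := sineChord_ne_zero h
    rw [chordRatio, if_neg h1, ← smul_chord hx.contDiff, ← mul_sineChord, norm_smul, mul_pow,
      Real.norm_eq_abs, sq_abs]
    field_simp
    ring

theorem IsBoundaryParam.contDiff_chordRatio {x : ℝ → EuclideanSpace ℝ (Fin 2)}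
    (hx : IsBoundaryParam x) : ContDiff ℝ 2 (Function.uncurry (chordRatio x)) := by
  rw [contDiff_iff_contDiffAt]
  rintro ⟨s, σ⟩
  -- move the first argument by a multiple of `2π` to within `π` of the second one
  set k : ℤ := round ((s - σ) / (2 * Real.pi)) with hk
  have hπ := Real.pi_pos
  set T : ℝ × ℝ → ℝ × ℝ := fun p => (p.1 - k * (2 * Real.pi), p.2) with hT
  have hTc : ContDiff ℝ 2 T := by rw [hT]; fun_prop
  have hclose : |s - k * (2 * Real.pi) - σ| < 2 * Real.pi := by
    have h := abs_sub_round ((s - σ) / (2 * Real.pi))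
    rw [← hk] at h
    have e : s - k * (2 * Real.pi) - σ = ((s - σ) / (2 * Real.pi) - k) * (2 * Real.pi) := by
      field_simp
      ring
    rw [e, abs_mul, abs_of_pos Real.two_pi_pos]
    nlinarith
  have hev : ∀ᶠ p : ℝ × ℝ in 𝓝 (s, σ), |(T p).1 - (T p).2| < 2 * Real.pi := by
    have hc : Continuous fun p : ℝ × ℝ => |(T p).1 - (T p).2| := by rw [hT]; fun_prop
    exact hc.continuousAt.eventually_lt continuousAt_const hclose
  have hmain : ContDiffAt ℝ 2 (fun p => ‖chord x (T p)‖ ^ 2 / sineChord (T p) ^ 2) (s, σ) := by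
    refine ContDiffAt.div ?_ ?_ ?_
    · exact (((contDiff_chord hx.contDiff).comp hTc).norm_sq ℝ).contDiffAt
    · exact ((contDiff_sineChord.comp hTc).pow 2).contDiffAt
    · exact pow_ne_zero 2 (sineChord_ne_zero hclose)
  refine hmain.congr_of_eventuallyEq ?_
  filter_upwards [hev] with p hp
  have hper : Function.Periodic (fun s => chordRatio x s p.2) (2 * Real.pi) := fun s =>
    hx.biPeriodic_chordRatio.1 s p.2
  have h1 := hper.sub_int_mul_eq k (x := p.1)
  rw [Function.uncurry, ← h1]
  exact hx.chordRatio_eq hp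

theorem IsBoundaryParam.sin_half_eq_zero {x : ℝ → EuclideanSpace ℝ (Fin 2)}
    (hx : IsBoundaryParam x) {s σ : ℝ} (h : x s = x σ) : Real.sin ((s - σ) / 2) = 0 := by
  set s' := toIcoMod Real.two_pi_pos 0 s with hs'
  set σ' := toIcoMod Real.two_pi_pos 0 σ with hσ'
  have e1 : s = s' + toIcoDiv Real.two_pi_pos 0 s * (2 * Real.pi) := by
    rw [← zsmul_eq_mul]; exact (toIcoMod_add_toIcoDiv_zsmul Real.two_pi_pos 0 s).symm
  have e2 : σ = σ' + toIcoDiv Real.two_pi_pos 0 σ * (2 * Real.pi) := by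
    rw [← zsmul_eq_mul]; exact (toIcoMod_add_toIcoDiv_zsmul Real.two_pi_pos 0 σ).symm
  have hs1 : s' ∈ Set.Ico 0 (2 * Real.pi) := by
    simpa using toIcoMod_mem_Ico Real.two_pi_pos 0 s
  have hσ1 : σ' ∈ Set.Ico 0 (2 * Real.pi) := by
    simpa using toIcoMod_mem_Ico Real.two_pi_pos 0 σ
  have h1 : x s = x s' := by
    rw [e1]; exact hx.periodic.int_mul _ _
  have h2 : x σ = x σ' := by
    rw [e2]; exact hx.periodic.int_mul _ _
  have h3 : s' = σ' := hx.simple hs1 hσ1 (by rw [← h1, ← h2, h])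
  rw [e1, e2, h3]
  rw [show (σ' + toIcoDiv Real.two_pi_pos 0 s * (2 * Real.pi)
    - (σ' + toIcoDiv Real.two_pi_pos 0 σ * (2 * Real.pi))) / 2
    = ((toIcoDiv Real.two_pi_pos 0 s - toIcoDiv Real.two_pi_pos 0 σ : ℤ) : ℝ) * Real.pi by
      push_cast; ring]
  exact Real.sin_int_mul_pi _

theorem IsBoundaryParam.chordRatio_pos {x : ℝ → EuclideanSpace ℝ (Fin 2)}
    (hx : IsBoundaryParam x) (s σ : ℝ) : 0 < chordRatio x s σ := by
  rw [chordRatio]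
  split_ifs with h
  · have := norm_pos_iff.2 (hx.regular s)
    positivity
  · have h1 : x s - x σ ≠ 0 := fun h0 => h (hx.sin_half_eq_zero (sub_eq_zero.1 h0))
    have := norm_pos_iff.2 h1
    positivity

/-- `N` and its derivative `N'` in the first variable are Hölder kernels. This is the regularity of
`Φ_n(|x(s) - x(σ)|)` after the logarithmic kernel is split off; a second derivative need not
exist. -/
structure IsRegularPart (α : ℝ) (N N' : ℝ → ℝ → ℝ) : Prop where
  holder : HolderKernel α N
  holder' : HolderKernel α N'
  hasDerivAt : ∀ s σ, HasDerivAt (fun s => N s σ) (N' s σ) s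

/-- On the curve every `Φ_n` splits into the same multiple of the logarithmic kernel and a regular
part. The factor of the logarithm in `Φ_n` is `1 + O(r²)`, so that beyond the leading term the
logarithm occurs only in `sin² ((s - σ) / 2) log (4 sin² ((s - σ) / 2))`, which has a Hölder
continuous derivative. -/
theorem IsBoundaryParam.exists_regularPart {c κ : ℝ} (hc : 0 < c) (hκ : 0 < κ)
    {x : ℝ → EuclideanSpace ℝ (Fin 2)} (hx : IsBoundaryParam x) {α : ℝ} (hα : 0 < α)
    (hα1 : α < 1) (n : ℕ) :
    ∃ N N' : ℝ → ℝ → ℝ, IsRegularPart α N N' ∧ ∀ s σ, Real.sin ((s - σ) / 2) ≠ 0 →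
      Phi c κ n ‖x s - x σ‖ = -(1 / 2) * logKer (s - σ) + N s σ := by
  obtain ⟨A, B, hA, hB, hAB⟩ := exists_Phi_eq hc hκ n
  set u : ℝ → ℝ → ℝ := fun s σ => ‖x s - x σ‖ ^ 2 with hu
  have hx2 : ContDiff ℝ 2 x := hx.contDiff.of_le (by norm_num)
  have huc : ContDiff ℝ 2 (Function.uncurry u) :=
    ((hx2.comp contDiff_fst).sub (hx2.comp contDiff_snd)).norm_sq ℝ
  have hup : BiPeriodic u := ⟨fun s σ => by simp only [hu, hx.periodic s],
    fun s σ => by simp only [hu, hx.periodic σ]⟩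
  have hqc := hx.contDiff_chordRatio
  have hqp := hx.biPeriodic_chordRatio
  set a : ℝ → ℝ → ℝ := fun s σ => chordRatio x s σ * A (u s σ) with ha
  set b : ℝ → ℝ → ℝ := fun s σ =>
    -(1 / 2) * Real.log (chordRatio x s σ) * (1 + u s σ * A (u s σ)) + B (u s σ) with hb
  have hac : ContDiff ℝ 2 (Function.uncurry a) := hqc.mul (hA.comp huc)
  have hbc : ContDiff ℝ 2 (Function.uncurry b) :=
    ((contDiff_const.mul (hqc.log fun p => (hx.chordRatio_pos p.1 p.2).ne')).mul
      (contDiff_const.add (huc.mul (hA.comp huc)))).add (hB.comp huc)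
  have hap : BiPeriodic a := ⟨fun s σ => by simp only [ha, hqp.1, hup.1],
    fun s σ => by simp only [ha, hqp.2, hup.2]⟩
  have hbp : BiPeriodic b := ⟨fun s σ => by simp only [hb, hqp.1, hup.1],
    fun s σ => by simp only [hb, hqp.2, hup.2]⟩
  have hac1 : ContDiff ℝ 1 (Function.uncurry a) := hac.of_le (by norm_num)
  have hbc1 : ContDiff ℝ 1 (Function.uncurry b) := hbc.of_le (by norm_num)
  obtain ⟨C, hm'⟩ := exists_isHolder_logCorr' hα hα1
  have hm'k := holderKernel_comp_sub hα hm' logCorr'_periodic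
  have hmc : Continuous logCorr :=
    continuous_iff_continuousAt.2 fun t => (hasDerivAt_logCorr t).continuousAt
  have hmd : ∀ s σ, HasDerivAt (fun s => logCorr (s - σ)) (logCorr' (s - σ)) s := fun s σ =>
    (hasDerivAt_logCorr (s - σ)).comp_sub_const s σ
  have hmp : BiPeriodic fun s σ => logCorr (s - σ) :=
    ⟨fun s σ => by
      simp only
      rw [show s + 2 * Real.pi - σ = s - σ + 2 * Real.pi by ring, logCorr_periodic],
    fun s σ => by
      simp only
      rw [show s - (σ + 2 * Real.pi) = s - σ - 2 * Real.pi by ring, logCorr_periodic.sub_eq]⟩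
  have hmk : HolderKernel α fun s σ => logCorr (s - σ) :=
    holderKernel_of_hasDerivAt hα hα1 (hmc.comp (continuous_fst.sub continuous_snd)) hmp
      hm'k.continuous hm'k.periodic hmd
  have hak := holderKernel_of_contDiff hα hα1 hac1 hap
  have hbk := holderKernel_of_contDiff hα hα1 hbc1 hbp
  have hak' := holderKernel_of_contDiff hα hα1 (contDiff_partialFst hac) (hap.partialFst hac1)
  have hbk' := holderKernel_of_contDiff hα hα1 (contDiff_partialFst hbc) (hbp.partialFst hbc1)
  refine ⟨fun s σ => logCorr (s - σ) * a s σ + b s σ,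
    fun s σ => (logCorr' (s - σ) * a s σ + logCorr (s - σ) * partialFst a s σ)
      + partialFst b s σ,
    ⟨(hmk.mul hak).add hbk, ((hm'k.mul hak).add (hmk.mul hak')).add hbk', fun s σ =>
      ((hmd s σ).mul (hasDerivAt_partialFst hac1 s σ)).add (hasDerivAt_partialFst hbc1 s σ)⟩,
    fun s σ hsin => ?_⟩
  have hne : x s - x σ ≠ 0 := by
    intro h0
    have hpos := hx.chordRatio_pos s σ
    rw [chordRatio, if_neg hsin, h0] at hpos
    simp at hpos
  have hr := norm_pos_iff.2 hne
  have hq0 := hx.chordRatio_pos s σ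
  have hs2 : 0 < 4 * Real.sin ((s - σ) / 2) ^ 2 := by positivity
  have hudef : u s σ = 4 * Real.sin ((s - σ) / 2) ^ 2 * chordRatio x s σ := by
    rw [chordRatio, if_neg hsin]
    field_simp
    rfl
  have hlog : Real.log ‖x s - x σ‖
      = 1 / 2 * (logKer (s - σ) + Real.log (chordRatio x s σ)) := by
    rw [logKer, ← Real.log_mul hs2.ne' hq0.ne', ← hudef, hu]
    simp only
    rw [Real.log_pow]
    push_cast
    ring
  rw [hAB _ hr, hlog]
  change -(1 / 2 * (logKer (s - σ) + Real.log (chordRatio x s σ))) * (1 + u s σ * A (u s σ))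
    + B (u s σ) = -(1 / 2) * logKer (s - σ) + (logCorr (s - σ) * a s σ + b s σ)
  rw [logCorr_eq]
  simp only [ha, hb]
  have e : u s σ * A (u s σ)
      = 4 * Real.sin ((s - σ) / 2) ^ 2 * (chordRatio x s σ * A (u s σ)) := by
    nth_rewrite 1 [hudef]
    ring
  rw [e]
  ring

/-! ### Positive definiteness of the Macdonald kernel -/

/-- Lebesgue measure on one period. -/
abbrev periodMeasure : Measure ℝ := volume.restrict (Set.Ioc 0 (2 * Real.pi))

theorem integrable_periodMeasure_prod {f : ℝ × ℝ → ℝ} (hf : Continuous f) :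
    Integrable f (periodMeasure.prod periodMeasure) := by
  rw [Measure.prod_restrict]
  exact (hf.continuousOn.integrableOn_compact (isCompact_Icc.prod isCompact_Icc)).mono_set
    (Set.prod_mono Set.Ioc_subset_Icc_self Set.Ioc_subset_Icc_self)

theorem integral_periodMeasure (f : ℝ → ℝ) :
    ∫ s, f s ∂periodMeasure = ∫ s in (0 : ℝ)..(2 * Real.pi), f s :=
  (intervalIntegral.integral_of_le Real.two_pi_pos.le).symm

/-- The quadratic form of the kernel `exp (b ⟨x, y⟩)`, as a sum of squares of moments. -/
theorem hasSum_exp_inner_form {h p q : ℝ → ℝ} (hc : Continuous h) (pc : Continuous p)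
    (qc : Continuous q) (hp : Function.Periodic h (2 * Real.pi))
    (pp : Function.Periodic p (2 * Real.pi)) (qp : Function.Periodic q (2 * Real.pi)) (b : ℝ) :
    HasSum (fun k : ℕ => ∑ j ∈ Finset.range (k + 1), b ^ k / k.factorial * (k.choose j : ℝ)
        * (∫ s in (0 : ℝ)..(2 * Real.pi), h s * p s ^ j * q s ^ (k - j)) ^ 2)
      (∫ z : ℝ × ℝ, h z.1 * h z.2 * Real.exp (b * (p z.1 * p z.2 + q z.1 * q z.2))
        ∂(periodMeasure.prod periodMeasure)) := by
  obtain ⟨M, hM0, hM⟩ := exists_abs_le_of_periodic hc hp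
  obtain ⟨P, hP0, hP⟩ := exists_abs_le_of_periodic pc pp
  obtain ⟨Q, hQ0, hQ⟩ := exists_abs_le_of_periodic qc qp
  set F : ℕ → ℝ × ℝ → ℝ := fun k z =>
    h z.1 * h z.2 * ((b * (p z.1 * p z.2 + q z.1 * q z.2)) ^ k / k.factorial) with hF
  have hFc : ∀ k, Continuous (F k) := fun k => by rw [hF]; fun_prop
  have hFi : ∀ k, Integrable (F k) (periodMeasure.prod periodMeasure) := fun k =>
    integrable_periodMeasure_prod (hFc k)
  set R : ℝ := |b| * (P * P + Q * Q) with hR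
  have hbound : ∀ k z, ‖F k z‖ ≤ M * M * (R ^ k / k.factorial) := by
    intro k z
    simp only [hF, Real.norm_eq_abs, abs_mul, abs_div, abs_pow, Nat.abs_cast]
    gcongr
    · exact hM _
    · exact hM _
    · rw [hR]
      refine mul_le_mul_of_nonneg_left ((abs_add_le _ _).trans ?_) (abs_nonneg _)
      rw [abs_mul, abs_mul]
      exact add_le_add (mul_le_mul (hP _) (hP _) (abs_nonneg _) hP0)
        (mul_le_mul (hQ _) (hQ _) (abs_nonneg _) hQ0)
  have hsum : Summable fun k => ∫ z, ‖F k z‖ ∂(periodMeasure.prod periodMeasure) := by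
    refine Summable.of_nonneg_of_le (fun k => integral_nonneg fun z => norm_nonneg _)
      (fun k => ?_) ((Real.summable_pow_div_factorial R).mul_left
        (((periodMeasure.prod periodMeasure).real Set.univ) * (M * M)))
    calc ∫ z, ‖F k z‖ ∂(periodMeasure.prod periodMeasure)
        ≤ ∫ z, M * M * (R ^ k / k.factorial) ∂(periodMeasure.prod periodMeasure) :=
          integral_mono (hFi k).norm (integrable_const _) (hbound k)
      _ = _ := by rw [integral_const, smul_eq_mul]; ring
  have key := hasSum_integral_of_summable_integral_norm hFi hsum
  have h1 : ∀ k, ∫ z, F k z ∂(periodMeasure.prod periodMeasure)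
      = ∑ j ∈ Finset.range (k + 1), b ^ k / k.factorial * (k.choose j : ℝ)
        * (∫ s in (0 : ℝ)..(2 * Real.pi), h s * p s ^ j * q s ^ (k - j)) ^ 2 := by
    intro k
    have e : ∀ z, F k z = ∑ j ∈ Finset.range (k + 1), b ^ k / k.factorial * (k.choose j : ℝ)
        * ((h z.1 * p z.1 ^ j * q z.1 ^ (k - j)) * (h z.2 * p z.2 ^ j * q z.2 ^ (k - j))) := by
      intro z
      simp only [hF]
      rw [mul_pow, add_pow, Finset.mul_sum, Finset.sum_div, Finset.mul_sum]
      refine Finset.sum_congr rfl fun j _ => ?_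
      rw [mul_pow, mul_pow]
      ring
    simp only [e]
    rw [integral_finsetSum]
    · refine Finset.sum_congr rfl fun j _ => ?_
      rw [integral_const_mul, integral_prod_mul (μ := periodMeasure) (ν := periodMeasure)
        (fun s => h s * p s ^ j * q s ^ (k - j)) (fun s => h s * p s ^ j * q s ^ (k - j)),
        integral_periodMeasure, sq]
    · exact fun j _ => integrable_periodMeasure_prod (by fun_prop)
  have h2 : ∀ z, ∑' k, F k z
      = h z.1 * h z.2 * Real.exp (b * (p z.1 * p z.2 + q z.1 * q z.2)) := by
    intro z
    simp only [hF]
    rw [tsum_mul_left, Real.exp_eq_exp_ℝ, NormedSpace.exp_eq_tsum_div]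
  simpa only [h1, h2] using key

theorem eq_zero_of_integral_mul_self {h : ℝ → ℝ} (hc : Continuous h)
    (hp : Function.Periodic h (2 * Real.pi))
    (h0 : ∫ s in (0 : ℝ)..(2 * Real.pi), h s * h s = 0) (s : ℝ) : h s = 0 := by
  obtain ⟨t, ht, hst⟩ := hp.exists_mem_Ico₀ Real.two_pi_pos s
  rw [hst]
  by_contra hne
  have := intervalIntegral.integral_pos Real.two_pi_pos
    (f := fun s => h s * h s) (by fun_prop) (fun t _ => mul_self_nonneg _)
    ⟨t, ⟨ht.1, ht.2.le⟩, mul_self_pos.2 hne⟩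
  exact this.ne' h0

/-- A continuous function on the curve all of whose polynomial moments vanish is zero: by the
Stone–Weierstrass theorem polynomials in the coordinates are dense. -/
theorem eq_zero_of_polynomial_moments {h p q : ℝ → ℝ} (hc : Continuous h) (pc : Continuous p)
    (qc : Continuous q) (hp : Function.Periodic h (2 * Real.pi))
    (pp : Function.Periodic p (2 * Real.pi)) (qp : Function.Periodic q (2 * Real.pi))
    (hsep : ∀ s σ, p s = p σ → q s = q σ → (s : AddCircle (2 * Real.pi)) = σ)
    (hmom : ∀ i j : ℕ, ∫ s in (0 : ℝ)..(2 * Real.pi), h s * p s ^ i * q s ^ j = 0) (s : ℝ) :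
    h s = 0 := by
  set X := toCircle p pc pp
  set Y := toCircle q qc qp
  set S : Set C(AddCircle (2 * Real.pi), ℝ) :=
    {F | ∫ s in (0 : ℝ)..(2 * Real.pi), h s * F (s : AddCircle (2 * Real.pi)) = 0} with hS
  have hint : ∀ F : C(AddCircle (2 * Real.pi), ℝ), IntervalIntegrable
      (fun s : ℝ => h s * F (s : AddCircle (2 * Real.pi))) volume 0 (2 * Real.pi) := fun F =>
    (hc.mul (F.continuous.comp (AddCircle.continuous_mk' _))).intervalIntegrable _ _
  have hclosed : IsClosed S := by
    refine isClosed_eq ?_ continuous_const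
    refine intervalIntegral.continuous_parametric_intervalIntegral_of_continuous'
      (f := fun (F : C(AddCircle (2 * Real.pi), ℝ)) (s : ℝ) =>
        h s * F (s : AddCircle (2 * Real.pi))) ?_ _ _
    exact (hc.comp continuous_snd).mul
      (continuous_fst.eval ((AddCircle.continuous_mk' _).comp continuous_snd))
  have hadj : ∀ F ∈ Algebra.adjoin ℝ {X, Y}, F ∈ S := by
    intro F hF
    rw [← Subalgebra.mem_toSubmodule, Algebra.adjoin_eq_span] at hF
    induction hF using Submodule.span_induction with
    | mem F hF =>
      obtain ⟨i, j, rfl⟩ := (Submonoid.mem_closure_pair _ _ _).1 hF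
      have := hmom i j
      simp only [mul_assoc] at this
      exact this
    | zero => simp [hS]
    | add F G _ _ hF hG =>
      simp only [hS, Set.mem_ofPred_eq, ContinuousMap.add_apply, mul_add] at hF hG ⊢
      rw [intervalIntegral.integral_add (hint F) (hint G), hF, hG, add_zero]
    | smul a F _ hF =>
      simp only [hS, Set.mem_ofPred_eq, ContinuousMap.smul_apply, smul_eq_mul,
        mul_left_comm _ a] at hF ⊢
      rw [intervalIntegral.integral_const_mul, hF, mul_zero]
  have htop := ContinuousMap.subalgebra_topologicalClosure_eq_top_of_separatesPoints
    (Algebra.adjoin ℝ {X, Y}) (by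
      intro a b hab
      induction a using QuotientAddGroup.induction_on with | _ a
      induction b using QuotientAddGroup.induction_on with | _ b
      by_cases h1 : p a = p b
      · refine ⟨Y, ⟨Y, Algebra.subset_adjoin (by simp), rfl⟩, fun h2 => hab (hsep a b h1 h2)⟩
      · exact ⟨X, ⟨X, Algebra.subset_adjoin (by simp), rfl⟩, h1⟩)
  have hmem : toCircle h hc hp ∈ S := by
    have h1 : toCircle h hc hp ∈ (Algebra.adjoin ℝ {X, Y}).topologicalClosure := by
      rw [htop]; trivial
    exact hclosed.closure_subset_iff.2 hadj h1
  have h0 : ∫ s in (0 : ℝ)..(2 * Real.pi), h s * h s = 0 := hmem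
  exact eq_zero_of_integral_mul_self hc hp h0 s

theorem IsBoundaryParam.coe_eq_coe {x : ℝ → EuclideanSpace ℝ (Fin 2)} (hx : IsBoundaryParam x)
    {s σ : ℝ} (h : x s = x σ) : (s : AddCircle (2 * Real.pi)) = σ := by
  obtain ⟨k, hk⟩ := Real.sin_eq_zero_iff.1 (hx.sin_half_eq_zero h)
  rw [← sub_eq_zero, ← AddCircle.coe_sub, AddCircle.coe_eq_zero_iff]
  exact ⟨k, by rw [zsmul_eq_mul]; linarith⟩

/-- The quadratic form of the Gaussian kernel `exp (-a |x - y|²)`. -/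
def gaussForm (x : ℝ → EuclideanSpace ℝ (Fin 2)) (g : ℝ → ℝ) (a : ℝ) : ℝ :=
  ∫ z : ℝ × ℝ, g z.1 * g z.2 * Real.exp (-(a * ‖x z.1 - x z.2‖ ^ 2))
    ∂(periodMeasure.prod periodMeasure)

/-- Gaussian kernels are strictly positive definite: after the substitution
`h = g exp (-a |x|²)` the kernel becomes `exp (2a ⟨x, y⟩)`. -/
theorem IsBoundaryParam.gaussForm_pos {x : ℝ → EuclideanSpace ℝ (Fin 2)}
    (hx : IsBoundaryParam x) {g : ℝ → ℝ} (hc : Continuous g)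
    (hp : Function.Periodic g (2 * Real.pi)) {a : ℝ} (ha : 0 < a) :
    0 ≤ gaussForm x g a ∧ (gaussForm x g a = 0 → ∀ s, g s = 0) := by
  have hxc := hx.contDiff.continuous
  set h : ℝ → ℝ := fun s => g s * Real.exp (-(a * ‖x s‖ ^ 2)) with hh
  have hhc : Continuous h := by rw [hh]; fun_prop
  have hhp : Function.Periodic h (2 * Real.pi) := fun s => by
    simp only [hh, hp s, hx.periodic s]
  have hxp : ∀ i : Fin 2, Function.Periodic (fun s => x s i) (2 * Real.pi) := fun i s => by
    simp only [hx.periodic s]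
  have hxic : ∀ i : Fin 2, Continuous fun s => x s i := fun i => by fun_prop
  have hsum := hasSum_exp_inner_form hhc (hxic 0) (hxic 1) hhp (hxp 0) (hxp 1) (2 * a)
  have e : (∫ z : ℝ × ℝ, h z.1 * h z.2
      * Real.exp (2 * a * (x z.1 0 * x z.2 0 + x z.1 1 * x z.2 1))
        ∂(periodMeasure.prod periodMeasure)) = gaussForm x g a := by
    refine integral_congr_ae (ae_of_all _ fun z => ?_)
    simp only [hh]
    rw [norm_sub_sq_real, PiLp.inner_apply, Fin.sum_univ_two]
    simp only [RCLike.inner_apply, conj_trivial]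
    rw [show -(a * (‖x z.1‖ ^ 2 - 2 * (x z.2 0 * x z.1 0 + x z.2 1 * x z.1 1) + ‖x z.2‖ ^ 2))
      = -(a * ‖x z.1‖ ^ 2) + -(a * ‖x z.2‖ ^ 2)
        + 2 * a * (x z.1 0 * x z.2 0 + x z.1 1 * x z.2 1) by ring, Real.exp_add, Real.exp_add]
    ring
  rw [e] at hsum
  have hterm : ∀ k j : ℕ, 0 ≤ (2 * a) ^ k / k.factorial * (k.choose j : ℝ)
        * (∫ s in (0 : ℝ)..(2 * Real.pi), h s * x s 0 ^ j * x s 1 ^ (k - j)) ^ 2 := fun k j => by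
    positivity
  have hterms : ∀ k : ℕ, 0 ≤ ∑ j ∈ Finset.range (k + 1), (2 * a) ^ k / k.factorial
      * (k.choose j : ℝ)
        * (∫ s in (0 : ℝ)..(2 * Real.pi), h s * x s 0 ^ j * x s 1 ^ (k - j)) ^ 2 := fun k =>
    Finset.sum_nonneg fun j _ => hterm k j
  refine ⟨hsum.nonneg hterms, fun h0 s => ?_⟩
  rw [h0] at hsum
  have hz := (hasSum_zero_iff_of_nonneg hterms).1 hsum
  have hmom : ∀ i j : ℕ,
      ∫ s in (0 : ℝ)..(2 * Real.pi), h s * x s 0 ^ i * x s 1 ^ j = 0 := by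
    intro i j
    have h1 := (Finset.sum_eq_zero_iff_of_nonneg fun l (_ : l ∈ Finset.range (i + j + 1)) =>
      hterm (i + j) l).1 (congrFun hz (i + j)) i (Finset.mem_range.2 (by omega))
    rw [Nat.add_sub_cancel_left] at h1
    have h2 : (0 : ℝ) < (2 * a) ^ (i + j) / (i + j).factorial * ((i + j).choose i : ℝ) := by
      have := Nat.choose_pos (Nat.le_add_right i j)
      positivity
    exact pow_eq_zero_iff two_ne_zero |>.1 ((mul_eq_zero.1 h1).resolve_left h2.ne')
  have h3 := eq_zero_of_polynomial_moments hhc (hxic 0) (hxic 1) hhp (hxp 0) (hxp 1)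
    (fun s σ h1 h2 => hx.coe_eq_coe (by ext i; fin_cases i; exacts [h1, h2])) hmom s
  exact (mul_eq_zero.1 h3).resolve_right (Real.exp_pos _).ne'

theorem ae_sin_half_sub_ne_zero_right (s : ℝ) : ∀ᵐ σ : ℝ, Real.sin ((s - σ) / 2) ≠ 0 := by
  have hcount : (Set.range fun k : ℤ => s - 2 * (k * Real.pi)).Countable :=
    Set.countable_range _
  filter_upwards [hcount.ae_notMem volume] with σ hσ h0
  obtain ⟨k, hk⟩ := Real.sin_eq_zero_iff.1 h0
  exact hσ ⟨k, by simp only [hk]; ring⟩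

theorem intervalIntegrable_logKer_sub (s a b : ℝ) :
    IntervalIntegrable (fun σ => logKer (s - σ)) volume a b := by
  have := (intervalIntegrable_logKer (s - a) (s - b)).comp_sub_left s
  simpa only [sub_sub_cancel] using this

theorem ae_sin_half_sub_ne_zero : ∀ᵐ z : ℝ × ℝ ∂(periodMeasure.prod periodMeasure),
    Real.sin ((z.1 - z.2) / 2) ≠ 0 := by
  have hm : MeasurableSet {z : ℝ × ℝ | Real.sin ((z.1 - z.2) / 2) ≠ 0} :=
    (isOpen_ne_fun (by fun_prop) continuous_const).measurableSet
  exact (Measure.ae_prod_iff_ae_ae hm).2 (ae_of_all _ fun s =>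
    ae_restrict_of_ae (ae_sin_half_sub_ne_zero_right s))

theorem integrable_logKer_sub_prod :
    Integrable (fun z : ℝ × ℝ => logKer (z.1 - z.2)) (periodMeasure.prod periodMeasure) := by
  have hper : Function.Periodic (fun t => |logKer t|) (2 * Real.pi) := fun t => by
    simp only [logKer_periodic t]
  have hm : Measurable fun z : ℝ × ℝ => logKer (z.1 - z.2) :=
    measurable_logKer.comp (by fun_prop)
  refine (integrable_prod_iff hm.aestronglyMeasurable).2 ⟨ae_of_all _ fun s => ?_, ?_⟩
  · exact (intervalIntegrable_iff_integrableOn_Ioc_of_le Real.two_pi_pos.le).1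
      (intervalIntegrable_logKer_sub s _ _)
  · have e : ∀ s, ∫ σ, ‖logKer (s - σ)‖ ∂periodMeasure
        = ∫ t in (0 : ℝ)..(2 * Real.pi), |logKer t| := fun s => by
      rw [integral_periodMeasure]
      exact integral_comp_sub_left_of_periodic hper s
    simp only [e]
    exact integrable_const _

theorem Phi_zero_apply (c κ r : ℝ) : Phi c κ 0 r = K0 (gamma c κ * r) := by
  simp [Phi, v, w, coeff_zero]

theorem IsBoundaryParam.norm_sub_pos {x : ℝ → EuclideanSpace ℝ (Fin 2)}
    (hx : IsBoundaryParam x) {s σ : ℝ} (h : Real.sin ((s - σ) / 2) ≠ 0) : 0 < ‖x s - x σ‖ :=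
  norm_pos_iff.2 fun h0 => h (hx.sin_half_eq_zero (sub_eq_zero.1 h0))

theorem integrable_mul_logKer_add {G N : ℝ → ℝ → ℝ} (hG : Continuous (Function.uncurry G))
    (hN : Continuous (Function.uncurry N)) :
    Integrable (fun z : ℝ × ℝ => G z.1 z.2 * (-(1 / 2) * logKer (z.1 - z.2) + N z.1 z.2))
      (periodMeasure.prod periodMeasure) := by
  have h1 : Integrable (fun z : ℝ × ℝ => -(1 / 2) * logKer (z.1 - z.2) + N z.1 z.2)
      (periodMeasure.prod periodMeasure) :=
    (integrable_logKer_sub_prod.const_mul _).add (integrable_periodMeasure_prod hN)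
  rw [Measure.prod_restrict] at h1 ⊢
  exact IntegrableOn.continuousOn_mul_of_subset hG.continuousOn h1
    (isCompact_Icc.prod isCompact_Icc) (measurableSet_Ioc.prod measurableSet_Ioc)
    (Set.prod_mono Set.Ioc_subset_Icc_self Set.Ioc_subset_Icc_self)

/-- The quadratic form of the kernel `Φ_0(|x(s) - x(σ)|)`. -/
def PhiForm (c κ : ℝ) (x : ℝ → EuclideanSpace ℝ (Fin 2)) (g : ℝ → ℝ) : ℝ :=
  ∫ z : ℝ × ℝ, g z.1 * g z.2 * Phi c κ 0 ‖x z.1 - x z.2‖ ∂(periodMeasure.prod periodMeasure)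

/-- The Macdonald kernel is strictly positive definite, as a mixture of Gaussian kernels. -/
theorem IsBoundaryParam.PhiForm_pos {c κ : ℝ} (hc : 0 < c) (hκ : 0 < κ)
    {x : ℝ → EuclideanSpace ℝ (Fin 2)}
    (hx : IsBoundaryParam x) {g : ℝ → ℝ} (hgc : Continuous g)
    (hgp : Function.Periodic g (2 * Real.pi)) :
    0 ≤ PhiForm c κ x g ∧ (PhiForm c κ x g = 0 → ∀ s, g s = 0) := by
  have hγ : 0 < gamma c κ := div_pos hκ hc
  have hxc := hx.contDiff.continuous
  obtain ⟨N, N', hN, hPhi⟩ := hx.exists_regularPart hc hκ (α := 1 / 2) (by norm_num)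
    (by norm_num) 0
  set P := periodMeasure.prod periodMeasure with hP
  set V : Measure ℝ := volume.restrict (Set.Ioi 0) with hV
  set u : ℝ × ℝ → ℝ := fun z => (gamma c κ * ‖x z.1 - x z.2‖) ^ 2 / 4 with hu
  have hK : ∀ᵐ z ∂P, 0 < u z ∧ Phi c κ 0 ‖x z.1 - x z.2‖
      = 1 / 2 * ∫ τ in Set.Ioi (0 : ℝ), heatWeight (u z) τ / τ := by
    filter_upwards [ae_sin_half_sub_ne_zero] with z hz
    have := hx.norm_sub_pos hz
    have h1 := mul_pos hγ this
    exact ⟨by simp only [hu]; positivity, by rw [Phi_zero_apply, K0_eq_integral h1]⟩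
  have hint : ∀ G : ℝ → ℝ → ℝ, Continuous (Function.uncurry G) → Integrable
      (fun z : ℝ × ℝ => G z.1 z.2 * Phi c κ 0 ‖x z.1 - x z.2‖) P := by
    intro G hG
    refine (integrable_mul_logKer_add hG hN.holder.continuous).congr ?_
    filter_upwards [ae_sin_half_sub_ne_zero] with z hz
    rw [hPhi _ _ hz]
  have hprod : Integrable (Function.uncurry fun (z : ℝ × ℝ) (τ : ℝ) =>
      g z.1 * g z.2 * (heatWeight (u z) τ / τ)) (P.prod V) := by
    have hm : Measurable (Function.uncurry fun (z : ℝ × ℝ) (τ : ℝ) =>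
        g z.1 * g z.2 * (heatWeight (u z) τ / τ)) := by
      simp only [hu, heatWeight]
      fun_prop
    refine (integrable_prod_iff hm.aestronglyMeasurable).2 ⟨?_, ?_⟩
    · filter_upwards [hK] with z hz
      simpa using (integrableOn_heatWeight_div_pow hz.1 1).const_mul (g z.1 * g z.2)
    · refine ((hint (fun s σ => 2 * |g s * g σ|) (by
        simp only [Function.uncurry_def]; fun_prop))).congr ?_
      filter_upwards [hK] with z hz
      rw [hz.2]
      simp only [Function.uncurry_apply_pair, norm_mul]
      rw [integral_const_mul]
      have : ∫ τ in Set.Ioi (0 : ℝ), ‖heatWeight (u z) τ / τ‖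
          = ∫ τ in Set.Ioi (0 : ℝ), heatWeight (u z) τ / τ := by
        refine setIntegral_congr_fun measurableSet_Ioi fun τ hτ => ?_
        exact Real.norm_of_nonneg (div_nonneg (heatWeight_pos _ _).le (le_of_lt hτ))
      rw [this, abs_mul, Real.norm_eq_abs, Real.norm_eq_abs]
      ring
  set W : ℝ → ℝ := fun τ => Real.exp (-τ) / τ * gaussForm x g (gamma c κ ^ 2 / (4 * τ)) with hW
  have hslice : ∀ τ, ∫ z, g z.1 * g z.2 * (heatWeight (u z) τ / τ) ∂P = W τ := by
    intro τ
    simp only [hW, gaussForm]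
    rw [← integral_const_mul]
    refine integral_congr_ae (ae_of_all _ fun z => ?_)
    simp only [heatWeight, hu]
    rw [sub_eq_add_neg, Real.exp_add, show (gamma c κ * ‖x z.1 - x z.2‖) ^ 2 / 4 / τ
      = gamma c κ ^ 2 / (4 * τ) * ‖x z.1 - x z.2‖ ^ 2 by rw [mul_pow, div_div]; ring]
    ring
  have hWi : Integrable W V := by
    simpa only [Function.uncurry_apply_pair, hslice] using hprod.integral_prod_right
  have hform : PhiForm c κ x g = 1 / 2 * ∫ τ, W τ ∂V := by
    have h1 := integral_integral_swap hprod
    simp only [hslice] at h1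
    rw [← h1, ← integral_const_mul, PhiForm]
    refine integral_congr_ae ?_
    filter_upwards [hK] with z hz
    rw [hz.2, integral_const_mul]
    ring
  have hWpos : ∀ τ : ℝ, 0 < τ → 0 ≤ W τ := fun τ hτ =>
    mul_nonneg (by positivity) (hx.gaussForm_pos hgc hgp (by positivity)).1
  have hW0 : 0 ≤ᵐ[V] W := (ae_restrict_iff' measurableSet_Ioi).2 (ae_of_all _ hWpos)
  refine ⟨by rw [hform]; exact mul_nonneg (by norm_num) (integral_nonneg_of_ae hW0), fun h0 => ?_⟩
  rw [hform] at h0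
  have h1 : ∫ τ, W τ ∂V = 0 := by linarith
  have h2 := (integral_eq_zero_iff_of_nonneg_ae hW0 hWi).1 h1
  rw [Filter.EventuallyEq, hV, ae_restrict_iff' measurableSet_Ioi] at h2
  have h3 : ∃ τ ∈ Set.Ioi (0 : ℝ), W τ = 0 := by
    by_contra! hcon
    have h4 : volume (Set.Ioi (0 : ℝ)) = 0 :=
      measure_eq_zero_iff_ae_notMem.2 (h2.mono fun τ h5 hτ => hcon τ hτ (h5 hτ))
    simp at h4
  obtain ⟨τ, hτ, h5⟩ := h3
  have hτ' : (0 : ℝ) < τ := hτ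
  exact (hx.gaussForm_pos hgc hgp (by positivity)).2
    ((mul_eq_zero.1 h5).resolve_left (by positivity))

/-! ### The boundary operators on Hölder spaces -/

theorem memC0_iff {α : ℝ≥0} {g : ℝ → ℝ} :
    MemC0 α g ↔ Function.Periodic g (2 * Real.pi) ∧ ∃ C : ℝ, IsHolder C α g := by
  refine and_congr_right fun _ => ⟨fun ⟨C, hC⟩ => ⟨C, fun s t => ?_⟩, fun ⟨C, hC⟩ => ?_⟩
  · simpa [Real.dist_eq] using hC.dist_le s t
  · refine ⟨⟨C, hC.nonneg⟩, fun s t => ?_⟩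
    have h1 : edist (g s) (g t) ≤ ENNReal.ofReal (C * |s - t| ^ (α : ℝ)) := by
      rw [edist_dist, Real.dist_eq]
      exact ENNReal.ofReal_le_ofReal (hC s t)
    rw [ENNReal.ofReal_mul hC.nonneg,
      ← ENNReal.ofReal_rpow_of_nonneg (abs_nonneg _) α.coe_nonneg, ← Real.dist_eq,
      ← edist_dist] at h1
    rwa [ENNReal.ofReal, Real.toNNReal_of_nonneg hC.nonneg] at h1

theorem hasPVIntegral_of_continuous {g : ℝ → ℝ} (hc : Continuous g)
    (hp : Function.Periodic g (2 * Real.pi)) (s : ℝ) :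
    HasPVIntegral g s (∫ σ in (0 : ℝ)..(2 * Real.pi), g σ) := by
  have h1 : Continuous fun ε : ℝ => ∫ σ in (s + ε)..(s + 2 * Real.pi - ε), g σ := by
    have e : ∀ ε : ℝ, ∫ σ in (s + ε)..(s + 2 * Real.pi - ε), g σ
        = (∫ σ in (0 : ℝ)..(s + 2 * Real.pi - ε), g σ) - ∫ σ in (0 : ℝ)..(s + ε), g σ :=
      fun ε => (intervalIntegral.integral_interval_sub_left (hc.intervalIntegrable _ _)
        (hc.intervalIntegrable _ _)).symm
    simp only [e]
    have hprim : Continuous fun b : ℝ => ∫ σ in (0 : ℝ)..b, g σ :=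
      intervalIntegral.continuous_primitive (fun a b => hc.intervalIntegrable a b) 0
    exact (hprim.comp (by fun_prop)).sub (hprim.comp (by fun_prop))
  have h2 := (h1.tendsto 0).mono_left (nhdsWithin_le_nhds (s := Set.Ioi 0))
  have h3 := hp.intervalIntegral_add_eq s 0
  rw [zero_add] at h3
  simp only [add_zero, sub_zero, h3] at h2
  exact h2

theorem sin_half_sub_ne_zero {s σ ε : ℝ} (hε : 0 < ε)
    (hσ : σ ∈ Set.Icc (s + ε) (s + 2 * Real.pi - ε)) : Real.sin ((s - σ) / 2) ≠ 0 := by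
  have := sin_half_pos (t := σ - s) (by linarith [hσ.1]) (by linarith [hσ.2])
  rw [show (s - σ) / 2 = -((σ - s) / 2) by ring, Real.sin_neg]
  linarith

/-- `Q_n` is a multiple of the periodic Cauchy kernel plus a continuous kernel. -/
theorem IsBoundaryParam.Q_eq {c κ : ℝ} {x : ℝ → EuclideanSpace ℝ (Fin 2)}
    {α : ℝ} {n : ℕ} {N N' : ℝ → ℝ → ℝ} (hN : IsRegularPart α N N')
    (hPhi : ∀ s σ, Real.sin ((s - σ) / 2) ≠ 0 →
      Phi c κ n ‖x s - x σ‖ = -(1 / 2) * logKer (s - σ) + N s σ)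
    {s σ : ℝ} (h : Real.sin ((s - σ) / 2) ≠ 0) :
    Q c κ x n s σ = 2 / ‖deriv x s‖ * (-(1 / 2) * cotHalf (s - σ) + N' s σ) := by
  rw [Q]
  congr 1
  have h1 : HasDerivAt (fun t => -(1 / 2) * logKer (t - σ) + N t σ)
      (-(1 / 2) * cotHalf (s - σ) + N' s σ) s :=
    (((hasDerivAt_logKer h).comp_sub_const s σ).const_mul _).add (hN.hasDerivAt s σ)
  refine (h1.congr_of_eventuallyEq ?_).deriv
  have h2 : ∀ᶠ t in 𝓝 s, Real.sin ((t - σ) / 2) ≠ 0 :=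
    (by fun_prop : Continuous fun t => Real.sin ((t - σ) / 2)).continuousAt.eventually_ne h
  filter_upwards [h2] with t ht
  exact hPhi t σ ht

theorem IsBoundaryParam.hasPVIntegral_Q {c κ : ℝ} {x : ℝ → EuclideanSpace ℝ (Fin 2)}
    {α C : ℝ} (hα : 0 < α) (hα1 : α < 1) {n : ℕ} {N N' : ℝ → ℝ → ℝ} (hN : IsRegularPart α N N')
    (hPhi : ∀ s σ, Real.sin ((s - σ) / 2) ≠ 0 →
      Phi c κ n ‖x s - x σ‖ = -(1 / 2) * logKer (s - σ) + N s σ)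
    {g : ℝ → ℝ} (hg : IsHolder C α g) (hp : Function.Periodic g (2 * Real.pi)) (s : ℝ) :
    HasPVIntegral (fun σ => g σ * Q c κ x n s σ) s
      (2 / ‖deriv x s‖ * (-(1 / 2) * (2 * Real.pi * hilb g s)
        + ∫ σ in (0 : ℝ)..(2 * Real.pi), g σ * N' s σ)) := by
  have hc := hg.continuous hα
  have hN'c := hN.holder'.continuous
  have hN's : Continuous fun σ => N' s σ := hN'c.comp (by fun_prop : Continuous fun σ => (s, σ))
  have h1 := hg.hasPVIntegral_cotHalf hα hα1 hp s
  have h2 := hasPVIntegral_of_continuous (g := fun σ => g σ * N' s σ) (by fun_prop)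
    (fun σ => by simp only [hp σ, hN.holder'.periodic.2]) s
  refine (((h1.const_mul (-(1 / 2))).add h2).const_mul (2 / ‖deriv x s‖)).congr' ?_
  filter_upwards [Ioo_mem_nhdsGT Real.pi_pos] with ε hε
  have hle : s + ε ≤ s + 2 * Real.pi - ε := by linarith [hε.2]
  have hi1 : IntervalIntegrable (fun σ => g σ * cotHalf (s - σ)) volume
      (s + ε) (s + 2 * Real.pi - ε) := by
    refine ContinuousOn.intervalIntegrable fun σ hσ => ?_
    rw [Set.uIcc_of_le hle] at hσ
    have h3 := ((hasDerivAt_cotHalf (sin_half_sub_ne_zero hε.1 hσ)).continuousAt).comp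
      (f := fun σ => s - σ) (x := σ) (by fun_prop)
    exact (hc.continuousAt.mul h3).continuousWithinAt
  have hi2 : IntervalIntegrable (fun σ => g σ * N' s σ) volume
      (s + ε) (s + 2 * Real.pi - ε) := Continuous.intervalIntegrable (by fun_prop) _ _
  rw [← intervalIntegral.integral_const_mul, ← intervalIntegral.integral_add (hi1.const_mul _) hi2,
    ← intervalIntegral.integral_const_mul]
  refine intervalIntegral.integral_congr fun σ hσ => ?_
  rw [Set.uIcc_of_le hle] at hσ
  rw [IsBoundaryParam.Q_eq hN hPhi (sin_half_sub_ne_zero hε.1 hσ)]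
  ring

/-- The kernel `∑_k β_{n-k} Φ_k(|x(s) - x(σ)|)`. -/
def PhiSum (c κ : ℝ) (x : ℝ → EuclideanSpace ℝ (Fin 2)) (n : ℕ) (s σ : ℝ) : ℝ :=
  ∑ k ∈ Finset.range (n + 1), beta c κ (n - k) * Phi c κ k ‖x s - x σ‖

/-- Every `PhiSum` is at most logarithmically singular; the factor of the logarithm does not depend
on `s` and `σ`. -/
theorem IsBoundaryParam.exists_PhiSum_eq {c κ : ℝ} (hc : 0 < c) (hκ : 0 < κ)
    {x : ℝ → EuclideanSpace ℝ (Fin 2)} (hx : IsBoundaryParam x) {α : ℝ} (hα : 0 < α)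
    (hα1 : α < 1) (n : ℕ) :
    ∃ (b : ℝ) (M : ℝ → ℝ → ℝ), HolderKernel α M ∧ ∀ s σ, Real.sin ((s - σ) / 2) ≠ 0 →
      PhiSum c κ x n s σ = b * logKer (s - σ) + M s σ := by
  choose N N' hN hPhi using hx.exists_regularPart hc hκ hα hα1
  refine ⟨∑ k ∈ Finset.range (n + 1), beta c κ (n - k) * -(1 / 2),
    fun s σ => ∑ k ∈ Finset.range (n + 1), beta c κ (n - k) * N k s σ,
    HolderKernel.sum _ fun k _ => (HolderKernel.const α _).mul (hN k).holder, fun s σ h => ?_⟩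
  rw [PhiSum, Finset.sum_mul, ← Finset.sum_add_distrib]
  refine Finset.sum_congr rfl fun k _ => ?_
  rw [hPhi k s σ h]
  ring

theorem inner_normal (x : ℝ → EuclideanSpace ℝ (Fin 2)) (s σ : ℝ) :
    inner ℝ (normal x s) (normal x σ) = 1 / ‖deriv x s‖ * (1 / ‖deriv x σ‖)
      * ∑ i, deriv x s i * deriv x σ i := by
  rw [normal, normal, inner_smul_left, inner_smul_right, PiLp.inner_apply, Fin.sum_univ_two,
    Fin.sum_univ_two]
  simp
  ring

theorem intervalIntegrable_mul_PhiSum {c κ b : ℝ} {x : ℝ → EuclideanSpace ℝ (Fin 2)} {α : ℝ}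
    {n : ℕ} {M : ℝ → ℝ → ℝ} (hM : HolderKernel α M)
    (hPhi : ∀ s σ, Real.sin ((s - σ) / 2) ≠ 0 →
      PhiSum c κ x n s σ = b * logKer (s - σ) + M s σ)
    {g : ℝ → ℝ} (hg : Continuous g) (s : ℝ) :
    IntervalIntegrable (fun σ => g σ * PhiSum c κ x n s σ) volume 0 (2 * Real.pi) := by
  have hMc := hM.continuous
  have hMs : Continuous fun σ => M s σ := hMc.comp (by fun_prop : Continuous fun σ => (s, σ))
  have h1 : IntervalIntegrable (fun σ => g σ * (b * logKer (s - σ) + M s σ)) volume 0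
      (2 * Real.pi) :=
    (((intervalIntegrable_logKer_sub s _ _).const_mul b).add
      (hMs.intervalIntegrable _ _)).continuousOn_mul hg.continuousOn
  refine h1.congr_ae ?_
  filter_upwards [ae_restrict_of_ae (ae_sin_half_sub_ne_zero_right s)] with σ hσ
  rw [hPhi s σ hσ]

/-- The part of `|x'| (H_n - L_n) φ` that remains after the conjugation operator is split off, as an
operator in `φ` and `ψ = φ'`. It is smoothing: no derivative of `ψ` is used to bound it. Here `N'`
stands for the derivative of the regular part of `Φ_n`. -/
def regularOp (c κ : ℝ) (x : ℝ → EuclideanSpace ℝ (Fin 2)) (n : ℕ) (N' : ℝ → ℝ → ℝ)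
    (φ ψ : ℝ → ℝ) (s : ℝ) : ℝ :=
  1 / Real.pi * ((∫ σ in (0 : ℝ)..(2 * Real.pi), ψ σ * N' s σ)
    - ∑ i, deriv x s i * ∫ σ in (0 : ℝ)..(2 * Real.pi), φ σ * deriv x σ i * PhiSum c κ x n s σ)

/-- The products of normals are products of tangents, so that the kernel of `L_n` separates into two
terms `x_i'(s) x_i'(σ) PhiSum`. -/
theorem mul_Wtilde_eq (c κ : ℝ) {x : ℝ → EuclideanSpace ℝ (Fin 2)} (hx : IsBoundaryParam x)
    (n : ℕ) (φ : ℝ → ℝ) (s σ : ℝ) :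
    φ σ * Wtilde c κ x n s σ = 2 / ‖deriv x s‖ *
      ∑ i, deriv x s i * (φ σ * deriv x σ i * PhiSum c κ x n s σ) := by
  have h1 : ∑ k ∈ Finset.range (n + 1), beta c κ (n - k) * W c κ x k s σ
      = 2 * ‖deriv x σ‖ * PhiSum c κ x n s σ := by
    rw [PhiSum, Finset.mul_sum]
    exact Finset.sum_congr rfl fun k _ => by rw [W]; ring
  have h2 := norm_pos_iff.2 (hx.regular σ)
  rw [Wtilde, h1, inner_normal, Fin.sum_univ_two, Fin.sum_univ_two]
  field_simp

theorem isHolder_integral_mul {α m M C : ℝ} {F : ℝ → ℝ → ℝ} {g : ℝ → ℝ} (hg : Continuous g)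
    (hF : Continuous (Function.uncurry F)) (hm : ∀ s, |g s| ≤ m) (hM : ∀ s σ, |F s σ| ≤ M)
    (hC : ∀ s s' σ, |F s σ - F s' σ| ≤ C * |s - s'| ^ α) :
    IsHolder (2 * Real.pi * (m * C)) α (fun s => ∫ σ in (0 : ℝ)..(2 * Real.pi), g σ * F s σ) ∧
      ∀ s, |∫ σ in (0 : ℝ)..(2 * Real.pi), g σ * F s σ| ≤ 2 * Real.pi * (m * M) := by
  have hm0 : 0 ≤ m := (abs_nonneg _).trans (hm 0)
  have hFs : ∀ s, Continuous fun σ => F s σ := fun s =>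
    hF.comp (by fun_prop : Continuous fun σ => (s, σ))
  have hi : ∀ s, IntervalIntegrable (fun σ => g σ * F s σ) volume 0 (2 * Real.pi) := fun s =>
    (hg.mul (hFs s)).intervalIntegrable _ _
  constructor
  · intro s t
    beta_reduce
    rw [← intervalIntegral.integral_sub (hi s) (hi t)]
    have := intervalIntegral.norm_integral_le_of_norm_le_const (a := 0) (b := 2 * Real.pi)
      (f := fun σ => g σ * F s σ - g σ * F t σ) (C := m * (C * |s - t| ^ α)) fun σ _ => by
        rw [← mul_sub, norm_mul]
        exact mul_le_mul (hm σ) (hC s t σ) (abs_nonneg _) hm0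
    rw [sub_zero, abs_of_pos Real.two_pi_pos] at this
    refine this.trans_eq ?_
    ring
  · intro s
    have := intervalIntegral.norm_integral_le_of_norm_le_const (a := 0) (b := 2 * Real.pi)
      (f := fun σ => g σ * F s σ) (C := m * M) fun σ _ => by
        rw [norm_mul]
        exact mul_le_mul (hm σ) (hM s σ) (abs_nonneg _) hm0
    rw [sub_zero, abs_of_pos Real.two_pi_pos] at this
    refine this.trans_eq ?_
    ring

theorem integral_mul_logKer_sub {g : ℝ → ℝ} (hp : Function.Periodic g (2 * Real.pi)) (s : ℝ) :
    ∫ σ in (0 : ℝ)..(2 * Real.pi), g σ * logKer (s - σ)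
      = ∫ t in (0 : ℝ)..(2 * Real.pi), g (s - t) * logKer t := by
  have := integral_comp_sub_left_of_periodic (f := fun t => g (s - t) * logKer t)
    (fun t => by
      simp only [logKer_periodic t]
      rw [show s - (t + 2 * Real.pi) = s - t - 2 * Real.pi by ring, hp.sub_eq]) s
  simpa only [sub_sub_cancel] using this

/-- Convolution with the logarithmic kernel preserves Hölder continuity. -/
theorem isHolder_integral_mul_logKer {α m C : ℝ} (hα : 0 < α) {g : ℝ → ℝ} (hg : IsHolder C α g)
    (hp : Function.Periodic g (2 * Real.pi)) (hm : ∀ s, |g s| ≤ m) :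
    IsHolder (C * ∫ t in (0 : ℝ)..(2 * Real.pi), |logKer t|) α
        (fun s => ∫ σ in (0 : ℝ)..(2 * Real.pi), g σ * logKer (s - σ)) ∧
      ∀ s, |∫ σ in (0 : ℝ)..(2 * Real.pi), g σ * logKer (s - σ)|
        ≤ m * ∫ t in (0 : ℝ)..(2 * Real.pi), |logKer t| := by
  have hc := hg.continuous hα
  have hl := intervalIntegrable_logKer 0 (2 * Real.pi)
  have hi : ∀ s, IntervalIntegrable (fun t => g (s - t) * logKer t) volume 0 (2 * Real.pi) :=
    fun s => hl.continuousOn_mul (Continuous.continuousOn (by fun_prop))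
  simp only [integral_mul_logKer_sub hp]
  constructor
  · intro s s'
    rw [← intervalIntegral.integral_sub (hi s) (hi s')]
    have := intervalIntegral.norm_integral_le_of_norm_le (a := 0) (b := 2 * Real.pi)
      (μ := volume) (f := fun t => g (s - t) * logKer t - g (s' - t) * logKer t)
      (g := fun t => C * |s - s'| ^ α * |logKer t|) Real.two_pi_pos.le
      (ae_of_all _ fun t _ => by
        rw [← sub_mul, norm_mul]
        refine mul_le_mul_of_nonneg_right ((hg _ _).trans_eq ?_) (abs_nonneg _)
        rw [sub_sub_sub_cancel_right]) (hl.abs.const_mul _)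
    rw [intervalIntegral.integral_const_mul] at this
    refine this.trans_eq ?_
    ring
  · intro s
    have := intervalIntegral.norm_integral_le_of_norm_le (a := 0) (b := 2 * Real.pi)
      (μ := volume) (f := fun t => g (s - t) * logKer t)
      (g := fun t => m * |logKer t|) Real.two_pi_pos.le
      (ae_of_all _ fun t _ => by
        rw [norm_mul]
        exact mul_le_mul_of_nonneg_right (hm _) (abs_nonneg _)) (hl.abs.const_mul _)
    rwa [intervalIntegral.integral_const_mul] at this

/-- Integration against `PhiSum` is bounded on Hölder functions. -/
theorem exists_isHolder_integral_PhiSum {c κ b : ℝ} {x : ℝ → EuclideanSpace ℝ (Fin 2)} {α : ℝ}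
    (hα : 0 < α) {n : ℕ} {M : ℝ → ℝ → ℝ} (hM : HolderKernel α M)
    (hPhi : ∀ s σ, Real.sin ((s - σ) / 2) ≠ 0 →
      PhiSum c κ x n s σ = b * logKer (s - σ) + M s σ) :
    ∃ K : ℝ, 0 ≤ K ∧ ∀ (m : ℝ) (g : ℝ → ℝ), IsHolder m α g → (∀ s, |g s| ≤ m) →
      Function.Periodic g (2 * Real.pi) →
      IsHolder (K * m) α (fun s => ∫ σ in (0 : ℝ)..(2 * Real.pi), g σ * PhiSum c κ x n s σ) ∧
      ∀ s, |∫ σ in (0 : ℝ)..(2 * Real.pi), g σ * PhiSum c κ x n s σ| ≤ K * m := by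
  obtain ⟨B, hB0, hB, hB'⟩ := hM.exists_bound
  set I := ∫ t in (0 : ℝ)..(2 * Real.pi), |logKer t| with hI
  have hI0 : 0 ≤ I := intervalIntegral.integral_nonneg Real.two_pi_pos.le fun _ _ => abs_nonneg _
  refine ⟨|b| * I + 2 * Real.pi * B, by positivity, fun m g hg hm hp => ?_⟩
  have hc := hg.continuous hα
  obtain ⟨h1, h2⟩ := isHolder_integral_mul_logKer hα hg hp hm
  obtain ⟨h3, h4⟩ := isHolder_integral_mul hc hM.continuous hm hB hB'
  have hMc := hM.continuous
  have e : (fun s => ∫ σ in (0 : ℝ)..(2 * Real.pi), g σ * PhiSum c κ x n s σ)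
      = fun s => b * (∫ σ in (0 : ℝ)..(2 * Real.pi), g σ * logKer (s - σ))
        + ∫ σ in (0 : ℝ)..(2 * Real.pi), g σ * M s σ := by
    funext s
    have hMs : Continuous fun σ => M s σ := hMc.comp (by fun_prop : Continuous fun σ => (s, σ))
    rw [← intervalIntegral.integral_const_mul, ← intervalIntegral.integral_add
      (((intervalIntegrable_logKer_sub s _ _).continuousOn_mul hc.continuousOn).const_mul b)
      (Continuous.intervalIntegrable (by fun_prop) _ _)]
    refine intervalIntegral.integral_congr_ae ?_
    filter_upwards [ae_sin_half_sub_ne_zero_right s] with σ hσ _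
    rw [hPhi s σ hσ]
    ring
  rw [e]
  constructor
  · have h5 := (h1.const_mul b).add h3
    rwa [show |b| * (m * I) + 2 * Real.pi * (m * B) = (|b| * I + 2 * Real.pi * B) * m by ring] at h5
  · intro s
    rw [congrFun e s]
    calc _ ≤ |b| * |∫ σ in (0 : ℝ)..(2 * Real.pi), g σ * logKer (s - σ)|
          + |∫ σ in (0 : ℝ)..(2 * Real.pi), g σ * M s σ| := by
          rw [← abs_mul]; exact abs_add_le _ _
      _ ≤ |b| * (m * I) + 2 * Real.pi * (m * B) :=
          add_le_add (mul_le_mul_of_nonneg_left (h2 s) (abs_nonneg _)) (h4 s)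
      _ = _ := by ring

theorem exists_isHolder_of_contDiff {α : ℝ} (hα : 0 < α) (hα1 : α < 1) {f : ℝ → ℝ}
    (hf : ContDiff ℝ 1 f) (hp : Function.Periodic f (2 * Real.pi)) :
    ∃ D : ℝ, 0 ≤ D ∧ IsHolder D α f ∧ ∀ s, |f s| ≤ D := by
  obtain ⟨D, hD0, hD, hD'⟩ := (holderKernel_of_contDiff hα hα1 (F := fun s _ => f s)
    (hf.comp contDiff_fst) ⟨fun s _ => hp s, fun _ _ => rfl⟩).exists_bound
  exact ⟨D, hD0, fun s t => hD' s t 0, fun s => hD s 0⟩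

theorem IsBoundaryParam.contDiff_deriv {x : ℝ → EuclideanSpace ℝ (Fin 2)}
    (hx : IsBoundaryParam x) : ContDiff ℝ 1 (deriv x) := by
  have h3 : ContDiff ℝ (1 + 1) x := hx.contDiff.of_le (by norm_num)
  exact (contDiff_succ_iff_deriv.1 h3).2.2

theorem IsBoundaryParam.exists_isHolder_deriv {x : ℝ → EuclideanSpace ℝ (Fin 2)}
    (hx : IsBoundaryParam x) {α : ℝ} (hα : 0 < α) (hα1 : α < 1) (i : Fin 2) :
    ∃ D : ℝ, 0 ≤ D ∧ IsHolder D α (fun s => deriv x s i) ∧ ∀ s, |deriv x s i| ≤ D := by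
  have h1 := hx.contDiff_deriv
  exact exists_isHolder_of_contDiff hα hα1 (by fun_prop) fun s => by
    simp only [hx.deriv_periodic s]

/-- `regularOp` maps into Hölder functions, with bounds that do not involve the Hölder constant
of `ψ`. -/
theorem IsBoundaryParam.exists_isHolder_regularOp {c κ : ℝ} (hc : 0 < c) (hκ : 0 < κ)
    {x : ℝ → EuclideanSpace ℝ (Fin 2)} (hx : IsBoundaryParam x) {α : ℝ} (hα : 0 < α)
    (hα1 : α < 1) (n : ℕ) {N' : ℝ → ℝ → ℝ} (hN' : HolderKernel α N') :
    ∃ K : ℝ, 0 ≤ K ∧ ∀ (m : ℝ) (φ ψ : ℝ → ℝ), IsHolder m α φ → (∀ s, |φ s| ≤ m) →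
      Function.Periodic φ (2 * Real.pi) → Continuous ψ → (∀ s, |ψ s| ≤ m) →
      IsHolder (K * m) α (regularOp c κ x n N' φ ψ) ∧
      ∀ s, |regularOp c κ x n N' φ ψ s| ≤ K * m := by
  obtain ⟨b, M, hM, hPhi⟩ := hx.exists_PhiSum_eq hc hκ hα hα1 n
  obtain ⟨K, hK0, hK⟩ := exists_isHolder_integral_PhiSum hα hM hPhi
  obtain ⟨B, hB0, hB, hB'⟩ := hN'.exists_bound
  choose D hD0 hD hD' using hx.exists_isHolder_deriv hα hα1
  have hπ := Real.pi_pos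
  -- a term `x_i' ∫ φ x_i' PhiSum` is bounded by `E i * m`
  set E : Fin 2 → ℝ := fun i => 4 * (D i * (K * D i)) with hE
  have hE0 : ∀ i, 0 ≤ E i := fun i => by
    have := hD0 i
    simp only [hE]
    positivity
  refine ⟨1 / Real.pi * (2 * Real.pi * B + (E 0 + E 1)), by
    have := hE0 0
    have := hE0 1
    positivity, fun m φ ψ hφ hφm hφp hψ hψm => ?_⟩
  have hm0 : 0 ≤ m := hφ.nonneg
  obtain ⟨h1, h2⟩ := isHolder_integral_mul hψ hN'.continuous hψm hB hB'
  have hterm : ∀ i : Fin 2, IsHolder (E i * m) α (fun s => deriv x s i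
        * ∫ σ in (0 : ℝ)..(2 * Real.pi), φ σ * deriv x σ i * PhiSum c κ x n s σ) ∧
      ∀ s, |deriv x s i * ∫ σ in (0 : ℝ)..(2 * Real.pi), φ σ * deriv x σ i * PhiSum c κ x n s σ|
        ≤ E i * m := by
    intro i
    have h3 := IsHolder.mul hφ (hD i) hφm (hD' i)
    have h3' : ∀ s, |φ s * deriv x s i| ≤ m * D i + m * D i := fun s => by
      rw [abs_mul]
      have := mul_le_mul (hφm s) (hD' i s) (abs_nonneg _) hm0
      have := mul_nonneg hm0 (hD0 i)
      linarith
    obtain ⟨h4, h5⟩ := hK _ _ h3 h3' (fun s => by simp only [hφp s, hx.deriv_periodic s])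
    have h6 := IsHolder.mul (hD i) h4 (hD' i) h5
    constructor
    · rwa [show D i * (K * (m * D i + m * D i)) + D i * (K * (m * D i + m * D i)) = E i * m by
        simp only [hE]; ring] at h6
    · intro s
      rw [abs_mul]
      refine (mul_le_mul (hD' i s) (h5 s) (abs_nonneg _) (hD0 i)).trans ?_
      have : 0 ≤ D i * (K * (m * D i + m * D i)) := by
        have := hD0 i
        positivity
      simp only [hE]
      linarith
  constructor
  · have h7 := (h1.add (((hterm 0).1.add (hterm 1).1).const_mul (-1))).const_mul (1 / Real.pi)
    rw [abs_neg, abs_one, one_mul, abs_of_pos (by positivity)] at h7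
    have e : regularOp c κ x n N' φ ψ = fun s => 1 / Real.pi *
        ((∫ σ in (0 : ℝ)..(2 * Real.pi), ψ σ * N' s σ) + -1 * (
          deriv x s 0 * (∫ σ in (0 : ℝ)..(2 * Real.pi), φ σ * deriv x σ 0 * PhiSum c κ x n s σ)
          + deriv x s 1 *
            ∫ σ in (0 : ℝ)..(2 * Real.pi), φ σ * deriv x σ 1 * PhiSum c κ x n s σ)) := by
      funext s
      rw [regularOp, Fin.sum_univ_two]
      ring
    rw [e]
    rwa [show 1 / Real.pi * (2 * Real.pi * (m * B) + (E 0 * m + E 1 * m))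
      = 1 / Real.pi * (2 * Real.pi * B + (E 0 + E 1)) * m by ring] at h7
  · intro s
    rw [regularOp, Fin.sum_univ_two, abs_mul, abs_of_pos (by positivity : 0 < 1 / Real.pi),
      mul_assoc]
    refine mul_le_mul_of_nonneg_left ?_ (by positivity)
    refine (abs_sub _ _).trans ?_
    have := abs_add_le
      (deriv x s 0 * ∫ σ in (0 : ℝ)..(2 * Real.pi), φ σ * deriv x σ 0 * PhiSum c κ x n s σ)
      (deriv x s 1 * ∫ σ in (0 : ℝ)..(2 * Real.pi), φ σ * deriv x σ 1 * PhiSum c κ x n s σ)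
    linarith [h2 s, (hterm 0).2 s, (hterm 1).2 s]

theorem MemC1.deriv_periodic {α : ℝ≥0} {φ : ℝ → ℝ} (hφ : MemC1 α φ) :
    Function.Periodic (deriv φ) (2 * Real.pi) := by
  intro s
  rw [← deriv_comp_add_const, show (fun y => φ (y + 2 * Real.pi)) = φ from funext hφ.1]

theorem MemC1.exists_isHolder_deriv {α : ℝ≥0} {φ : ℝ → ℝ} (hφ : MemC1 α φ) :
    ∃ C : ℝ, IsHolder C α (deriv φ) :=
  (memC0_iff.1 ⟨hφ.deriv_periodic, hφ.2.2⟩).2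

theorem MemC1.hasDerivAt {α : ℝ≥0} {φ : ℝ → ℝ} (hφ : MemC1 α φ) (s : ℝ) :
    HasDerivAt φ (deriv φ s) s :=
  (hφ.2.1.differentiable one_ne_zero s).hasDerivAt

theorem isHolder_of_abs_deriv_le {α m : ℝ} (hα : 0 < α) (hα1 : α < 1) {φ φ' : ℝ → ℝ}
    (hd : ∀ s, HasDerivAt φ (φ' s) s) (hm : ∀ s, |φ s| ≤ m) (hm' : ∀ s, |φ' s| ≤ m) :
    IsHolder (3 * m) α φ := by
  have hm0 : 0 ≤ m := (abs_nonneg _).trans (hm 0)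
  intro s t
  have h1 : |φ s - φ t| ≤ 2 * m := (abs_sub _ _).trans (by linarith [hm s, hm t])
  have h2 : |φ s - φ t| ≤ m * |s - t| := by
    have := Convex.norm_image_sub_le_of_norm_hasDerivWithin_le (s := Set.univ) (x := t) (y := s)
      (fun u _ => (hd u).hasDerivWithinAt) (fun u _ => hm' u) convex_univ trivial trivial
    exact this
  exact (le_mul_rpow_of_le hα hα1 (abs_nonneg _) (by linarith) hm0 h1 h2).trans_eq (by ring)

/-- The operator `|x'| (H_n - L_n)` is the conjugation operator applied to `-φ'` plus a regular
operator. -/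
theorem IsBoundaryParam.mul_H_sub_L {c κ : ℝ} (hc : 0 < c) (hκ : 0 < κ)
    {x : ℝ → EuclideanSpace ℝ (Fin 2)} (hx : IsBoundaryParam x)
    {α : ℝ≥0} (hα : 0 < α) (hα1 : α < 1) {n : ℕ} {N N' : ℝ → ℝ → ℝ} (hN : IsRegularPart α N N')
    (hPhi : ∀ s σ, Real.sin ((s - σ) / 2) ≠ 0 →
      Phi c κ n ‖x s - x σ‖ = -(1 / 2) * logKer (s - σ) + N s σ)
    {φ : ℝ → ℝ} (hφ : MemC1 α φ) (s : ℝ) :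
    ‖deriv x s‖ * (H c κ x n φ s - L c κ x n φ s)
      = -hilb (deriv φ) s + regularOp c κ x n N' φ (deriv φ) s := by
  have hα' : (0 : ℝ) < α := by exact_mod_cast hα
  have hα1' : (α : ℝ) < 1 := by exact_mod_cast hα1
  obtain ⟨C, hC⟩ := hφ.exists_isHolder_deriv
  have hπ := Real.pi_pos
  have hx0 := norm_pos_iff.2 (hx.regular s)
  have h1 := (IsBoundaryParam.hasPVIntegral_Q hα' hα1' hN hPhi hC hφ.deriv_periodic s).pvIntegral_eq
  obtain ⟨b, M, hM, hPhiS⟩ := hx.exists_PhiSum_eq hc hκ hα' hα1' n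
  have hxc : Continuous (deriv x) := hx.contDiff.continuous_deriv (by norm_num)
  have hφc := hφ.2.1.continuous
  have h2 : ∫ σ in (0 : ℝ)..(2 * Real.pi), φ σ * Wtilde c κ x n s σ
      = 2 / ‖deriv x s‖ * ∑ i, deriv x s i
        * ∫ σ in (0 : ℝ)..(2 * Real.pi), φ σ * deriv x σ i * PhiSum c κ x n s σ := by
    simp only [mul_Wtilde_eq c κ hx]
    rw [intervalIntegral.integral_const_mul, intervalIntegral.integral_finsetSum]
    · simp only [intervalIntegral.integral_const_mul]
    · intro i _
      exact (intervalIntegrable_mul_PhiSum hM hPhiS (by fun_prop) s).const_mul _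
  rw [H, L, h1, h2, regularOp]
  field_simp
  ring

theorem IsBoundaryParam.exists_integrals {c κ : ℝ} (hc : 0 < c) (hκ : 0 < κ)
    {x : ℝ → EuclideanSpace ℝ (Fin 2)} (hx : IsBoundaryParam x)
    {α : ℝ≥0} (hα : 0 < α) (hα1 : α < 1) (n : ℕ) {φ : ℝ → ℝ} (hφ : MemC1 α φ) (s : ℝ) :
    (∃ l : ℝ, HasPVIntegral (fun σ => deriv φ σ * Q c κ x n s σ) s l) ∧
      IntervalIntegrable (fun σ => φ σ * Wtilde c κ x n s σ) volume 0 (2 * Real.pi) := by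
  have hα' : (0 : ℝ) < α := by exact_mod_cast hα
  have hα1' : (α : ℝ) < 1 := by exact_mod_cast hα1
  obtain ⟨C, hC⟩ := hφ.exists_isHolder_deriv
  obtain ⟨N, N', hN, hPhi⟩ := hx.exists_regularPart hc hκ hα' hα1' n
  refine ⟨⟨_, IsBoundaryParam.hasPVIntegral_Q hα' hα1' hN hPhi hC hφ.deriv_periodic s⟩, ?_⟩
  obtain ⟨b, M, hM, hPhiS⟩ := hx.exists_PhiSum_eq hc hκ hα' hα1' n
  have hxc : Continuous (deriv x) := hx.contDiff.continuous_deriv (by norm_num)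
  have hφc := hφ.2.1.continuous
  simp only [mul_Wtilde_eq c κ hx, Fin.sum_univ_two]
  exact (((intervalIntegrable_mul_PhiSum hM hPhiS (by fun_prop) s).const_mul _).add
    ((intervalIntegrable_mul_PhiSum hM hPhiS (by fun_prop) s).const_mul _)).const_mul _

/-! ### Injectivity, by an energy identity -/

theorem PhiForm_eq_integral {c κ α : ℝ} {x : ℝ → EuclideanSpace ℝ (Fin 2)}
    {N N' : ℝ → ℝ → ℝ} (hN : IsRegularPart α N N')
    (hPhi : ∀ s σ, Real.sin ((s - σ) / 2) ≠ 0 →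
      Phi c κ 0 ‖x s - x σ‖ = -(1 / 2) * logKer (s - σ) + N s σ)
    {g : ℝ → ℝ} (hg : Continuous g) :
    PhiForm c κ x g = ∫ s in (0 : ℝ)..(2 * Real.pi), g s *
      ∫ σ in (0 : ℝ)..(2 * Real.pi), g σ * Phi c κ 0 ‖x s - x σ‖ := by
  have hint : Integrable (fun z : ℝ × ℝ => g z.1 * g z.2 * Phi c κ 0 ‖x z.1 - x z.2‖)
      (periodMeasure.prod periodMeasure) := by
    refine (integrable_mul_logKer_add (G := fun s σ => g s * g σ)
      (by simp only [Function.uncurry_def]; fun_prop) hN.holder.continuous).congr ?_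
    filter_upwards [ae_sin_half_sub_ne_zero] with z hz
    rw [hPhi _ _ hz]
  rw [PhiForm, integral_prod _ hint, integral_periodMeasure]
  refine intervalIntegral.integral_congr fun s _ => ?_
  simp only
  rw [integral_periodMeasure, ← intervalIntegral.integral_const_mul]
  exact intervalIntegral.integral_congr fun σ _ => mul_assoc _ _ _

/-- Integration by parts in `s`, after the order of integration is exchanged, moves the derivative
from the kernel to `φ`. -/
theorem IsRegularPart.integral_mul_integral {α : ℝ} {N N' : ℝ → ℝ → ℝ}
    (hN : IsRegularPart α N N') {φ ψ : ℝ → ℝ} (hd : ∀ s, HasDerivAt φ (ψ s) s)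
    (hψ : Continuous ψ) (hp : Function.Periodic φ (2 * Real.pi)) :
    ∫ s in (0 : ℝ)..(2 * Real.pi), φ s * ∫ σ in (0 : ℝ)..(2 * Real.pi), ψ σ * N' s σ
      = -∫ s in (0 : ℝ)..(2 * Real.pi), ψ s *
        ∫ σ in (0 : ℝ)..(2 * Real.pi), ψ σ * N s σ := by
  have hφ : Continuous φ := continuous_iff_continuousAt.2 fun s => (hd s).continuousAt
  have hNc := hN.holder.continuous
  have hN'c := hN.holder'.continuous
  have swap : ∀ (f : ℝ → ℝ) (F : ℝ → ℝ → ℝ), Continuous f → Continuous (Function.uncurry F) →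
      ∫ s in (0 : ℝ)..(2 * Real.pi), f s * ∫ σ in (0 : ℝ)..(2 * Real.pi), ψ σ * F s σ
        = ∫ σ in (0 : ℝ)..(2 * Real.pi), ψ σ * ∫ s in (0 : ℝ)..(2 * Real.pi), f s * F s σ := by
    intro f F hf hF
    have h := integral_integral_swap (μ := periodMeasure) (ν := periodMeasure)
      (f := fun s σ => f s * (ψ σ * F s σ)) (integrable_periodMeasure_prod (by
        simp only [Function.uncurry_def] at hF ⊢
        fun_prop))
    simp only [integral_periodMeasure, intervalIntegral.integral_const_mul] at h
    rw [h]
    refine intervalIntegral.integral_congr fun σ _ => ?_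
    rw [← intervalIntegral.integral_const_mul]
    exact intervalIntegral.integral_congr fun s _ => mul_left_comm _ _ _
  rw [swap φ N' hφ hN'c, swap ψ N hψ hNc, ← intervalIntegral.integral_neg]
  refine intervalIntegral.integral_congr fun σ _ => ?_
  have hN's : Continuous fun s => N' s σ := hN'c.comp (by fun_prop : Continuous fun s => (s, σ))
  have h := intervalIntegral.integral_mul_deriv_eq_deriv_mul (a := 0) (b := 2 * Real.pi)
    (fun s _ => hd s) (fun s _ => hN.hasDerivAt s σ) (hψ.intervalIntegrable _ _)
    (hN's.intervalIntegrable _ _)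
  have h1 := hp 0
  have h2 := hN.holder.periodic.1 0 σ
  rw [zero_add] at h1 h2
  rw [h1, h2, sub_self, zero_sub] at h
  rw [h, mul_neg]

/-- The energy identity: `-π ∫ φ |x'| (H_0 - L_0) φ` is a sum of values of `PhiForm`, with positive
coefficients. The derivative in the kernel of `H_0` is moved to `φ` by parts, which gives
`PhiForm φ'`; the kernel of `L_0` contains `x'(s) · x'(σ)`, which gives one value for each
coordinate. -/
theorem IsBoundaryParam.energy_identity {c κ : ℝ} (hc : 0 < c) (hκ : 0 < κ)
    {x : ℝ → EuclideanSpace ℝ (Fin 2)} (hx : IsBoundaryParam x) {α C : ℝ} (hα : 0 < α)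
    (hα1 : α < 1) {N N' : ℝ → ℝ → ℝ} (hN : IsRegularPart α N N')
    (hPhi : ∀ s σ, Real.sin ((s - σ) / 2) ≠ 0 →
      Phi c κ 0 ‖x s - x σ‖ = -(1 / 2) * logKer (s - σ) + N s σ)
    {φ ψ : ℝ → ℝ} (hd : ∀ s, HasDerivAt φ (ψ s) s)
    (hψ : IsHolder C α ψ) (hp : Function.Periodic φ (2 * Real.pi))
    (hp' : Function.Periodic ψ (2 * Real.pi)) :
    ∫ s in (0 : ℝ)..(2 * Real.pi), φ s * (-hilb ψ s + regularOp c κ x 0 N' φ ψ s)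
      = -(1 / Real.pi * (PhiForm c κ x ψ + beta c κ 0 *
        ∑ i, PhiForm c κ x (fun s => φ s * deriv x s i))) := by
  have hφ : Continuous φ := continuous_iff_continuousAt.2 fun s => (hd s).continuousAt
  have hψc := hψ.continuous hα
  have hπ := Real.pi_pos
  obtain ⟨K, -, hK⟩ := exists_isHolder_hilb hα hα1
  obtain ⟨m, hm0, hm⟩ := exists_abs_le_of_periodic hφ hp
  obtain ⟨m', hm0', hm'⟩ := exists_abs_le_of_periodic hψc hp'
  have hφH : IsHolder (3 * max m m') α φ := isHolder_of_abs_deriv_le hα hα1 hd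
    (fun s => (hm s).trans (le_max_left _ _)) fun s => (hm' s).trans (le_max_right _ _)
  have hψh := (hK _ _ hψ).1.continuous hα
  have hφh := (hK _ _ hφH).1.continuous hα
  have hNc := hN.holder.continuous
  have hN'c := hN.holder'.continuous
  have hxc : Continuous (deriv x) := hx.contDiff.continuous_deriv (by norm_num)
  -- the singular part
  have h1 : ∫ s in (0 : ℝ)..(2 * Real.pi), φ s * -hilb ψ s
      = 1 / (2 * Real.pi) * ∫ s in (0 : ℝ)..(2 * Real.pi), ψ s *
        ∫ σ in (0 : ℝ)..(2 * Real.pi), ψ σ * logKer (s - σ) := by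
    have e := hφH.integral_mul_hilb hα hα1 hp hψ hp'
    simp only [mul_neg, intervalIntegral.integral_neg]
    rw [e, neg_neg, ← intervalIntegral.integral_const_mul]
    refine intervalIntegral.integral_congr fun s _ => ?_
    rw [hilb_eq_integral_logKer hd hψc hp hp' s, integral_mul_logKer_sub hp']
    ring
  have h2 := hN.integral_mul_integral hd hψc hp
  -- `PhiForm ψ` in terms of the two parts of the kernel
  have h3 : PhiForm c κ x ψ = -(1 / 2) * (∫ s in (0 : ℝ)..(2 * Real.pi), ψ s *
        ∫ σ in (0 : ℝ)..(2 * Real.pi), ψ σ * logKer (s - σ))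
      + ∫ s in (0 : ℝ)..(2 * Real.pi), ψ s * ∫ σ in (0 : ℝ)..(2 * Real.pi), ψ σ * N s σ := by
    have hl := (isHolder_integral_mul_logKer hα hψ hp' hm').1.continuous hα
    have hn : Continuous fun s => ∫ σ in (0 : ℝ)..(2 * Real.pi), ψ σ * N s σ := by
      refine intervalIntegral.continuous_parametric_intervalIntegral_of_continuous'
        (f := fun s σ => ψ σ * N s σ) ?_ _ _
      exact (hψc.comp continuous_snd).mul hNc
    rw [PhiForm_eq_integral hN hPhi hψc, ← intervalIntegral.integral_const_mul,
      ← intervalIntegral.integral_add (Continuous.intervalIntegrable (by fun_prop) _ _)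
        (Continuous.intervalIntegrable (by fun_prop) _ _)]
    refine intervalIntegral.integral_congr fun s _ => ?_
    have hNs : Continuous fun σ => N s σ := hNc.comp (by fun_prop : Continuous fun σ => (s, σ))
    have e : ∫ σ in (0 : ℝ)..(2 * Real.pi), ψ σ * Phi c κ 0 ‖x s - x σ‖
        = -(1 / 2) * (∫ σ in (0 : ℝ)..(2 * Real.pi), ψ σ * logKer (s - σ))
          + ∫ σ in (0 : ℝ)..(2 * Real.pi), ψ σ * N s σ := by
      rw [← intervalIntegral.integral_const_mul, ← intervalIntegral.integral_add
        (((intervalIntegrable_logKer_sub s _ _).continuousOn_mul hψc.continuousOn).const_mul _)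
        (Continuous.intervalIntegrable (by fun_prop) _ _)]
      refine intervalIntegral.integral_congr_ae ?_
      filter_upwards [ae_sin_half_sub_ne_zero_right s] with σ hσ _
      rw [hPhi s σ hσ]
      ring
    rw [e]
    ring
  -- the part of order zero
  have hPS : ∀ s σ, PhiSum c κ x 0 s σ = beta c κ 0 * Phi c κ 0 ‖x s - x σ‖ := fun s σ => by
    simp [PhiSum]
  have h4 : ∀ i, ∫ s in (0 : ℝ)..(2 * Real.pi), φ s * (deriv x s i *
      ∫ σ in (0 : ℝ)..(2 * Real.pi), φ σ * deriv x σ i * PhiSum c κ x 0 s σ)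
      = beta c κ 0 * PhiForm c κ x (fun s => φ s * deriv x s i) := by
    intro i
    rw [PhiForm_eq_integral hN hPhi (by fun_prop), ← intervalIntegral.integral_const_mul]
    refine intervalIntegral.integral_congr fun s _ => ?_
    simp only [hPS]
    rw [show beta c κ 0 * (φ s * deriv x s i * ∫ σ in (0 : ℝ)..(2 * Real.pi),
        φ σ * deriv x σ i * Phi c κ 0 ‖x s - x σ‖) = φ s * (deriv x s i * (beta c κ 0 *
        ∫ σ in (0 : ℝ)..(2 * Real.pi), φ σ * deriv x σ i * Phi c κ 0 ‖x s - x σ‖)) by ring,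
      ← intervalIntegral.integral_const_mul (beta c κ 0)]
    congr 2
    exact intervalIntegral.integral_congr fun σ _ => mul_left_comm _ _ _
  obtain ⟨b, M, hM, hPhiS⟩ := hx.exists_PhiSum_eq hc hκ hα hα1 0
  obtain ⟨K', hK0', hK'⟩ := exists_isHolder_integral_PhiSum hα hM hPhiS
  have hcont : ∀ i, Continuous fun s =>
      ∫ σ in (0 : ℝ)..(2 * Real.pi), φ σ * deriv x σ i * PhiSum c κ x 0 s σ := by
    intro i
    obtain ⟨D, hD0, hD, hD'⟩ := hx.exists_isHolder_deriv hα hα1 i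
    have h5 := IsHolder.mul hφH hD hm hD'
    obtain ⟨m2, hm2, hm2'⟩ := exists_abs_le_of_periodic (h5.continuous hα)
      (fun s => by simp only [hp s, hx.deriv_periodic s])
    have h6 : IsHolder (max (m * D + 3 * max m m' * D) m2) α fun s => φ s * deriv x s i :=
      fun s t => (h5 s t).trans (by gcongr; exact le_max_left _ _)
    exact (hK' _ _ h6 (fun s => (hm2' s).trans (le_max_right _ _))
      (fun s => by simp only [hp s, hx.deriv_periodic s])).1.continuous hα
  have hcont' : Continuous fun s => ∫ σ in (0 : ℝ)..(2 * Real.pi), ψ σ * N' s σ :=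
    intervalIntegral.continuous_parametric_intervalIntegral_of_continuous'
      (f := fun s σ => ψ σ * N' s σ) ((hψc.comp continuous_snd).mul hN'c) _ _
  have hsplit : ∀ s, φ s * (-hilb ψ s + regularOp c κ x 0 N' φ ψ s)
      = φ s * -hilb ψ s + 1 / Real.pi * (φ s * (∫ σ in (0 : ℝ)..(2 * Real.pi), ψ σ * N' s σ)
        - (φ s * (deriv x s 0 *
            ∫ σ in (0 : ℝ)..(2 * Real.pi), φ σ * deriv x σ 0 * PhiSum c κ x 0 s σ)
          + φ s * (deriv x s 1 *
            ∫ σ in (0 : ℝ)..(2 * Real.pi), φ σ * deriv x σ 1 * PhiSum c κ x 0 s σ))) := by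
    intro s
    rw [regularOp, Fin.sum_univ_two]
    ring
  have hcont0 := hcont 0
  have hcont1 := hcont 1
  simp only [hsplit]
  rw [intervalIntegral.integral_add (Continuous.intervalIntegrable (by fun_prop) _ _)
      (Continuous.intervalIntegrable (by fun_prop) _ _), intervalIntegral.integral_const_mul,
    intervalIntegral.integral_sub (Continuous.intervalIntegrable (by fun_prop) _ _)
      (Continuous.intervalIntegrable (by fun_prop) _ _),
    intervalIntegral.integral_add (Continuous.intervalIntegrable (by fun_prop) _ _)
      (Continuous.intervalIntegrable (by fun_prop) _ _), h1, h2, h3, h4, h4, Fin.sum_univ_two]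
  field_simp
  ring

/-- The operator `H_0 - L_0` is one-to-one: all values of `PhiForm` in the energy identity vanish,
so `φ x'` is zero, and `x'` has no zeros. -/
theorem IsBoundaryParam.eq_zero_of_energy {c κ : ℝ} (hc : 0 < c) (hκ : 0 < κ)
    {x : ℝ → EuclideanSpace ℝ (Fin 2)} (hx : IsBoundaryParam x) {α C : ℝ} (hα : 0 < α)
    (hα1 : α < 1) {N N' : ℝ → ℝ → ℝ} (hN : IsRegularPart α N N')
    (hPhi : ∀ s σ, Real.sin ((s - σ) / 2) ≠ 0 →
      Phi c κ 0 ‖x s - x σ‖ = -(1 / 2) * logKer (s - σ) + N s σ)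
    {φ ψ : ℝ → ℝ} (hd : ∀ s, HasDerivAt φ (ψ s) s)
    (hψ : IsHolder C α ψ) (hp : Function.Periodic φ (2 * Real.pi))
    (hp' : Function.Periodic ψ (2 * Real.pi))
    (h0 : ∀ s ∈ Set.Icc 0 (2 * Real.pi), -hilb ψ s + regularOp c κ x 0 N' φ ψ s = 0) (s : ℝ) :
    φ s = 0 := by
  have hφ : Continuous φ := continuous_iff_continuousAt.2 fun s => (hd s).continuousAt
  have hxc : Continuous (deriv x) := hx.contDiff.continuous_deriv (by norm_num)
  have hE := hx.energy_identity hc hκ hα hα1 hN hPhi hd hψ hp hp'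
  have hz : ∫ s in (0 : ℝ)..(2 * Real.pi), φ s * (-hilb ψ s + regularOp c κ x 0 N' φ ψ s)
      = ∫ s in (0 : ℝ)..(2 * Real.pi), (0 : ℝ) := by
    refine intervalIntegral.integral_congr fun s hs => ?_
    rw [Set.uIcc_of_le Real.two_pi_pos.le] at hs
    simp only [h0 s hs, mul_zero]
  rw [hz, intervalIntegral.integral_zero, Fin.sum_univ_two] at hE
  have hβ : 0 < beta c κ 0 := by simp only [beta]; positivity
  have h1 := (hx.PhiForm_pos hc hκ (hψ.continuous hα) hp').1
  have h2 : ∀ i, 0 ≤ PhiForm c κ x (fun s => φ s * deriv x s i) ∧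
      (PhiForm c κ x (fun s => φ s * deriv x s i) = 0 → ∀ s, φ s * deriv x s i = 0) := fun i =>
    hx.PhiForm_pos hc hκ (by fun_prop) (fun s => by simp only [hp s, hx.deriv_periodic s])
  have h3 : PhiForm c κ x ψ + beta c κ 0 * (PhiForm c κ x (fun s => φ s * deriv x s 0)
      + PhiForm c κ x (fun s => φ s * deriv x s 1)) = 0 := by
    have := neg_eq_zero.1 hE.symm
    exact (mul_eq_zero.1 this).resolve_left (by have := Real.pi_pos; positivity)
  have h4 := mul_nonneg hβ.le (h2 0).1
  have h5 := mul_nonneg hβ.le (h2 1).1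
  have h6 : PhiForm c κ x (fun s => φ s * deriv x s 0) = 0 :=
    (mul_eq_zero.1 (by linarith : beta c κ 0 * _ = 0)).resolve_left hβ.ne'
  have h7 : PhiForm c κ x (fun s => φ s * deriv x s 1) = 0 :=
    (mul_eq_zero.1 (by linarith : beta c κ 0 * _ = 0)).resolve_left hβ.ne'
  by_contra hne
  refine hx.regular s ?_
  ext i
  fin_cases i
  · exact (mul_eq_zero.1 ((h2 0).2 h6 s)).resolve_left hne
  · exact (mul_eq_zero.1 ((h2 1).2 h7 s)).resolve_left hne

/-! ### Equations of the second kind -/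

/-- The Fredholm alternative for an operator that maps continuous functions boundedly to Hölder
continuous ones: `1 + Y` is onto if it is one-to-one. -/
theorem exists_add_eq_of_injective {α K : ℝ} (hα : 0 < α) (hK : 0 ≤ K) (Y : (ℝ → ℝ) → ℝ → ℝ)
    (hadd : ∀ f g, Continuous f → Function.Periodic f (2 * Real.pi) → Continuous g →
      Function.Periodic g (2 * Real.pi) → ∀ s, Y (fun s => f s + g s) s = Y f s + Y g s)
    (hsmul : ∀ a f, Continuous f → Function.Periodic f (2 * Real.pi) →
      ∀ s, Y (fun s => a * f s) s = a * Y f s)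
    (hper : ∀ f, Continuous f → Function.Periodic f (2 * Real.pi) →
      Function.Periodic (Y f) (2 * Real.pi))
    (hbd : ∀ m f, Continuous f → Function.Periodic f (2 * Real.pi) → (∀ s, |f s| ≤ m) →
      IsHolder (K * m) α (Y f) ∧ ∀ s, |Y f s| ≤ K * m)
    (hinj : ∀ f, Continuous f → Function.Periodic f (2 * Real.pi) →
      (∀ s, f s + Y f s = 0) → ∀ s, f s = 0)
    {g : ℝ → ℝ} (hg : Continuous g) (hgp : Function.Periodic g (2 * Real.pi)) :
    ∃ f, Continuous f ∧ Function.Periodic f (2 * Real.pi) ∧ ∀ s, f s + Y f s = g s := by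
  let X := BoundedContinuousFunction (AddCircle (2 * Real.pi)) ℝ
  let ι : X → ℝ → ℝ := fun F s => F (s : AddCircle (2 * Real.pi))
  have ιc : ∀ F, Continuous (ι F) := fun F => F.continuous.comp (AddCircle.continuous_mk' _)
  have ιp : ∀ F, Function.Periodic (ι F) (2 * Real.pi) := fun F s => by
    simp only [ι]
    rw [AddCircle.coe_add_period]
  have ιb : ∀ F s, |ι F s| ≤ ‖F‖ := fun F s => F.norm_coe_le_norm _
  have Yc : ∀ F, Continuous (Y (ι F)) := fun F =>
    (hbd _ _ (ιc F) (ιp F) (ιb F)).1.continuous hα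
  let T₀ : X →ₗ[ℝ] X :=
    { toFun := fun F => BoundedContinuousFunction.mkOfCompact
        (toCircle (Y (ι F)) (Yc F) (hper _ (ιc F) (ιp F)))
      map_add' := fun F G => by
        ext z
        induction z using QuotientAddGroup.induction_on with | _ s
        exact hadd _ _ (ιc F) (ιp F) (ιc G) (ιp G) s
      map_smul' := fun a F => by
        ext z
        induction z using QuotientAddGroup.induction_on with | _ s
        exact hsmul a _ (ιc F) (ιp F) s }
  have hT₀ : ∀ F (s : ℝ), T₀ F (s : AddCircle (2 * Real.pi)) = Y (ι F) s := fun _ _ => rfl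
  let T : X →L[ℝ] X := T₀.mkContinuous K fun F => by
    refine (BoundedContinuousFunction.norm_le (by positivity)).2 fun z => ?_
    induction z using QuotientAddGroup.induction_on with | _ s
    exact (hbd _ _ (ιc F) (ιp F) (ιb F)).2 s
  have hT : ∀ F (s : ℝ), T F (s : AddCircle (2 * Real.pi)) = Y (ι F) s := fun _ _ => rfl
  have hcomp : IsCompactOperator T := by
    refine ⟨closure (T '' Metric.closedBall 0 1), ?_, Filter.mem_of_superset
      (Metric.closedBall_mem_nhds 0 one_pos) fun F hF => subset_closure ⟨F, hF, rfl⟩⟩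
    have hF1 : ∀ F ∈ Metric.closedBall (0 : X) 1, ∀ s, |ι F s| ≤ 1 := fun F hF s =>
      (ιb F s).trans (mem_closedBall_zero_iff.1 hF)
    refine BoundedContinuousFunction.arzela_ascoli (Metric.closedBall 0 (K * 1))
      (isCompact_closedBall _ _) _ ?_ ?_
    · rintro _ z ⟨F, hF, rfl⟩
      induction z using QuotientAddGroup.induction_on with | _ s
      rw [mem_closedBall_zero_iff]
      exact (hbd 1 _ (ιc F) (ιp F) (hF1 F hF)).2 s
    · intro z
      induction z using QuotientAddGroup.induction_on with | _ s
      rw [Metric.equicontinuousAt_iff_right]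
      intro ε hε
      have h1 : Tendsto (fun t : ℝ => K * 1 * |s - t| ^ α) (𝓝 s) (𝓝 0) := by
        have : Continuous fun t : ℝ => K * 1 * |s - t| ^ α :=
          continuous_const.mul ((continuous_abs.comp
            (continuous_const.sub continuous_id)).rpow_const fun _ => Or.inr hα.le)
        have h2 := this.tendsto s
        simpa [Real.zero_rpow hα.ne'] using h2
      have h3 : ∀ᶠ t : ℝ in 𝓝 s, ∀ i : T '' Metric.closedBall (0 : X) 1,
          dist ((i : X) (s : AddCircle (2 * Real.pi))) ((i : X) (t : AddCircle (2 * Real.pi)))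
            < ε := by
        filter_upwards [h1.eventually_lt_const hε] with t ht
        rintro ⟨_, F, hF, rfl⟩
        exact ((hbd 1 _ (ιc F) (ιp F) (hF1 F hF)).1 s t).trans_lt ht
      have h4 := (QuotientAddGroup.isOpenMap_coe
        (N := AddSubgroup.zmultiples (2 * Real.pi))).image_mem_nhds h3
      refine Filter.mem_of_superset h4 ?_
      rintro _ ⟨t, ht, rfl⟩
      exact ht
  rcases hcomp.hasEigenvalue_or_mem_resolventSet (μ := (-1 : ℝ)) (by norm_num) with h | h
  · exfalso
    obtain ⟨F, hF⟩ := h.exists_hasEigenvector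
    refine hF.2 ?_
    have h1 : T F = (-1 : ℝ) • F := hF.apply_eq_smul
    have h2 := hinj (ι F) (ιc F) (ιp F) fun s => by
      rw [← hT, h1]
      change F s + -1 * F s = 0
      ring
    ext z
    induction z using QuotientAddGroup.induction_on with | _ s
    exact h2 s
  · obtain ⟨u, hu⟩ := (spectrum.mem_resolventSet_iff).1 h
    let G : X := BoundedContinuousFunction.mkOfCompact (toCircle g hg hgp)
    have h1 : ((u : X →L[ℝ] X) * (↑u⁻¹ : X →L[ℝ] X)) G = G := by simp
    rw [hu] at h1
    set F : X := -((↑u⁻¹ : X →L[ℝ] X) G) with hF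
    refine ⟨ι F, ιc F, ιp F, fun s => ?_⟩
    have h2 : F + T F = G := by
      rw [mul_apply_eq_comp, sub_apply,
        Algebra.algebraMap_eq_smul_one, smul_apply,
        one_apply_eq_self, neg_one_smul] at h1
      rw [hF, map_neg, ← sub_eq_add_neg, h1]
    rw [← hT]
    exact DFunLike.congr_fun h2 (s : AddCircle (2 * Real.pi))

/-! ### Solvability of the first equation -/

/-- The mean-corrected primitive of `ρ`: every `2π`-periodic `C¹` function is of this form, for
exactly one `ρ`. -/
def primitive (ρ : ℝ → ℝ) (s : ℝ) : ℝ := (∫ t in (0 : ℝ)..s, (ρ t - mean ρ)) + mean ρ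

theorem hasDerivAt_primitive {ρ : ℝ → ℝ} (hρ : Continuous ρ) (s : ℝ) :
    HasDerivAt (primitive ρ) (ρ s - mean ρ) s := by
  have hc : Continuous fun t => ρ t - mean ρ := by fun_prop
  exact (intervalIntegral.integral_hasDerivAt_right (hc.intervalIntegrable _ _)
    (hc.stronglyMeasurableAtFilter _ _) hc.continuousAt).add_const _

theorem primitive_zero (ρ : ℝ → ℝ) : primitive ρ 0 = mean ρ := by simp [primitive]

theorem primitive_periodic {ρ : ℝ → ℝ} (hρ : Continuous ρ)
    (hp : Function.Periodic ρ (2 * Real.pi)) :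
    Function.Periodic (primitive ρ) (2 * Real.pi) := by
  intro s
  have hc : Continuous fun t => ρ t - mean ρ := by fun_prop
  have h1 := intervalIntegral.integral_add_adjacent_intervals
    (hc.intervalIntegrable (μ := volume) 0 s) (hc.intervalIntegrable s (s + 2 * Real.pi))
  have h0 : Function.Periodic (fun t => ρ t - mean ρ) (2 * Real.pi) := fun t => by
    simp only [hp t]
  have h2 := h0.intervalIntegral_add_eq s 0
  have h3 : ∫ t in (0 : ℝ)..(2 * Real.pi), (ρ t - mean ρ) = 0 := by
    rw [intervalIntegral.integral_sub (hρ.intervalIntegrable _ _) intervalIntegrable_const,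
      intervalIntegral.integral_const, mean, smul_eq_mul]
    have := Real.pi_pos
    field_simp
    ring
  rw [zero_add, h3] at h2
  rw [primitive, primitive, ← h1, h2, add_zero]

theorem abs_mean_le {ρ : ℝ → ℝ} {m : ℝ} (hm : ∀ s, |ρ s| ≤ m) : |mean ρ| ≤ m := by
  have hπ := Real.two_pi_pos
  have := intervalIntegral.norm_integral_le_of_norm_le_const (a := 0) (b := 2 * Real.pi)
    (f := ρ) (C := m) fun s _ => hm s
  rw [sub_zero, abs_of_pos hπ, Real.norm_eq_abs] at this
  rw [mean, abs_mul, abs_of_pos (by positivity), one_div, inv_mul_le_iff₀ hπ]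
  linarith

theorem abs_primitive_le {ρ : ℝ → ℝ} {m : ℝ} (hρ : Continuous ρ)
    (hp : Function.Periodic ρ (2 * Real.pi)) (hm : ∀ s, |ρ s| ≤ m) (s : ℝ) :
    |primitive ρ s| ≤ (4 * Real.pi + 1) * m := by
  have hm0 : 0 ≤ m := (abs_nonneg _).trans (hm 0)
  obtain ⟨t, ht, hst⟩ := (primitive_periodic hρ hp).exists_mem_Ico₀ Real.two_pi_pos s
  rw [hst, primitive]
  have hM := abs_mean_le hm
  have := intervalIntegral.norm_integral_le_of_norm_le_const (a := 0) (b := t)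
    (f := fun t => ρ t - mean ρ) (C := 2 * m) fun s _ =>
      (abs_sub _ _).trans (by linarith [hm s])
  rw [sub_zero, abs_of_nonneg ht.1, Real.norm_eq_abs] at this
  have h2 : 2 * m * t ≤ 2 * m * (2 * Real.pi) :=
    mul_le_mul_of_nonneg_left ht.2.le (by linarith)
  refine (abs_add_le _ _).trans ?_
  linarith

theorem mean_add {f g : ℝ → ℝ} (hf : Continuous f) (hg : Continuous g) :
    mean (fun s => f s + g s) = mean f + mean g := by
  rw [mean, mean, mean, intervalIntegral.integral_add (hf.intervalIntegrable _ _)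
    (hg.intervalIntegrable _ _), mul_add]

theorem mean_const_mul (a : ℝ) (f : ℝ → ℝ) : mean (fun s => a * f s) = a * mean f := by
  rw [mean, mean, intervalIntegral.integral_const_mul, mul_left_comm]

theorem mean_const (a : ℝ) : mean (fun _ => a) = a := by
  have := Real.pi_pos
  rw [mean, intervalIntegral.integral_const, smul_eq_mul]
  field_simp
  ring

theorem primitive_add {f g : ℝ → ℝ} (hf : Continuous f) (hg : Continuous g) (s : ℝ) :
    primitive (fun s => f s + g s) s = primitive f s + primitive g s := by
  rw [primitive, primitive, primitive, mean_add hf hg, add_add_add_comm,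
    ← intervalIntegral.integral_add (Continuous.intervalIntegrable (by fun_prop) _ _)
      (Continuous.intervalIntegrable (by fun_prop) _ _)]
  congr 1
  exact intervalIntegral.integral_congr fun t _ => by ring

theorem primitive_const_mul (a : ℝ) (f : ℝ → ℝ) (s : ℝ) :
    primitive (fun s => a * f s) s = a * primitive f s := by
  rw [primitive, primitive, mean_const_mul, mul_add, ← intervalIntegral.integral_const_mul]
  congr 1
  exact intervalIntegral.integral_congr fun t _ => by ring

theorem IsBoundaryParam.regularOp_add {c κ : ℝ} (hc : 0 < c) (hκ : 0 < κ)
    {x : ℝ → EuclideanSpace ℝ (Fin 2)} (hx : IsBoundaryParam x) (n : ℕ) {N' : ℝ → ℝ → ℝ}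
    (hN' : Continuous (Function.uncurry N')) {φ φ' ψ ψ' : ℝ → ℝ} (hφ : Continuous φ)
    (hφ' : Continuous φ') (hψ : Continuous ψ) (hψ' : Continuous ψ') (s : ℝ) :
    regularOp c κ x n N' (fun s => φ s + φ' s) (fun s => ψ s + ψ' s) s
      = regularOp c κ x n N' φ ψ s + regularOp c κ x n N' φ' ψ' s := by
  obtain ⟨b, M, hM, hPhi⟩ := hx.exists_PhiSum_eq hc hκ (α := 1 / 2) (by norm_num) (by norm_num) n
  have hxc : Continuous (deriv x) := hx.contDiff.continuous_deriv (by norm_num)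
  have hN's : Continuous fun σ => N' s σ := hN'.comp (by fun_prop : Continuous fun σ => (s, σ))
  have hi : ∀ (f : ℝ → ℝ), Continuous f → ∀ i, IntervalIntegrable
      (fun σ => f σ * deriv x σ i * PhiSum c κ x n s σ) volume 0 (2 * Real.pi) := fun f hf i =>
    intervalIntegrable_mul_PhiSum hM hPhi (by fun_prop) s
  simp only [regularOp, add_mul, Fin.sum_univ_two]
  rw [intervalIntegral.integral_add (Continuous.intervalIntegrable (by fun_prop) _ _)
      (Continuous.intervalIntegrable (by fun_prop) _ _),
    intervalIntegral.integral_add (hi φ hφ 0) (hi φ' hφ' 0),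
    intervalIntegral.integral_add (hi φ hφ 1) (hi φ' hφ' 1)]
  ring

theorem regularOp_const_mul (c κ : ℝ) (x : ℝ → EuclideanSpace ℝ (Fin 2)) (n : ℕ)
    (N' : ℝ → ℝ → ℝ) (a : ℝ) (φ ψ : ℝ → ℝ) (s : ℝ) :
    regularOp c κ x n N' (fun s => a * φ s) (fun s => a * ψ s) s
      = a * regularOp c κ x n N' φ ψ s := by
  simp only [regularOp, mul_assoc, intervalIntegral.integral_const_mul, Fin.sum_univ_two]
  ring

theorem IsBoundaryParam.regularOp_periodic (c κ : ℝ)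
    {x : ℝ → EuclideanSpace ℝ (Fin 2)} (hx : IsBoundaryParam x) (n : ℕ) {N' : ℝ → ℝ → ℝ}
    (hN' : BiPeriodic N') (φ ψ : ℝ → ℝ) :
    Function.Periodic (regularOp c κ x n N' φ ψ) (2 * Real.pi) := by
  intro s
  simp only [regularOp, PhiSum, hN'.1, hx.periodic s, hx.deriv_periodic s]

theorem IsHolder.mono {C D α : ℝ} {f : ℝ → ℝ} (hf : IsHolder C α f) (h : C ≤ D) :
    IsHolder D α f := fun s t => (hf s t).trans (by gcongr)

/-- If `hilb e + mean e = 0` then `e = 0`. -/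
theorem IsHolder.eq_zero_of_hilb_add_mean {C α : ℝ} {e : ℝ → ℝ} (hα : 0 < α) (hα1 : α < 1)
    (he : IsHolder C α e) (hp : Function.Periodic e (2 * Real.pi))
    (h : ∀ s, hilb e s + mean e = 0) (s : ℝ) : e s = 0 := by
  have h1 := he.hilb_hilb hα hα1 hp
  have h2 : hilb e = fun _ => -mean e := funext fun s => by linarith [h s]
  have h3 : e = fun _ => mean e := funext fun s => by
    have := h1 s
    rw [h2, hilb_const] at this
    linarith
  have h4 : mean e = 0 := by
    have := h 0
    rw [h3, hilb_const, mean_const] at this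
    linarith
  rw [h3]
  exact h4

/-- For every Hölder continuous right-hand side the equation `-hilb φ' + R φ = F` has a periodic
solution `φ`. The substitution `φ = primitive ρ` and the operator `hilb + mean`, the inverse of
`-hilb + mean`, turn it into an equation of the second kind with a compact operator. -/
theorem IsBoundaryParam.exists_solution {c κ : ℝ} (hc : 0 < c) (hκ : 0 < κ)
    {x : ℝ → EuclideanSpace ℝ (Fin 2)} (hx : IsBoundaryParam x) {α D : ℝ} (hα : 0 < α)
    (hα1 : α < 1) {N N' : ℝ → ℝ → ℝ} (hN : IsRegularPart α N N')
    (hPhi : ∀ s σ, Real.sin ((s - σ) / 2) ≠ 0 →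
      Phi c κ 0 ‖x s - x σ‖ = -(1 / 2) * logKer (s - σ) + N s σ)
    {F : ℝ → ℝ} (hF : IsHolder D α F) (hFp : Function.Periodic F (2 * Real.pi)) :
    ∃ (φ ψ : ℝ → ℝ) (C : ℝ), Function.Periodic φ (2 * Real.pi) ∧
      (∀ s, HasDerivAt φ (ψ s) s) ∧ IsHolder C α ψ ∧
      ∀ s, -hilb ψ s + regularOp c κ x 0 N' φ ψ s = F s := by
  have hπ := Real.pi_pos
  obtain ⟨K₁, hK₁, hR⟩ := hx.exists_isHolder_regularOp hc hκ hα hα1 0 hN.holder'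
  obtain ⟨K₂, hK₂, hH⟩ := exists_isHolder_hilb hα hα1
  set R : (ℝ → ℝ) → ℝ → ℝ := fun ρ =>
    regularOp c κ x 0 N' (primitive ρ) (fun s => ρ s - mean ρ) with hRdef
  set Y : (ℝ → ℝ) → ℝ → ℝ := fun ρ s => hilb (R ρ) s + mean (R ρ) - mean ρ with hYdef
  have hRp : ∀ ρ, Function.Periodic (R ρ) (2 * Real.pi) := fun ρ =>
    hx.regularOp_periodic c κ 0 hN.holder'.periodic _ _
  have primc : ∀ {ρ}, Continuous ρ → Continuous (primitive ρ) := fun {ρ} h =>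
    continuous_iff_continuousAt.2 fun s => (hasDerivAt_primitive h s).continuousAt
  set K₃ : ℝ := K₁ * (3 * (4 * Real.pi + 1)) with hK₃
  have hK₃0 : 0 ≤ K₃ := by positivity
  have hRb : ∀ m ρ, Continuous ρ → Function.Periodic ρ (2 * Real.pi) → (∀ s, |ρ s| ≤ m) →
      IsHolder (K₃ * m) α (R ρ) ∧ ∀ s, |R ρ s| ≤ K₃ * m := by
    intro m ρ hρ hp hm
    have hm0 : 0 ≤ m := (abs_nonneg _).trans (hm 0)
    have h1 : 0 ≤ Real.pi * m := by positivity
    have hψ : ∀ s, |ρ s - mean ρ| ≤ (4 * Real.pi + 1) * m := fun s => by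
      have h2 := abs_sub (ρ s) (mean ρ)
      have h3 : m ≤ Real.pi * m := by nlinarith [Real.pi_gt_three]
      linarith [hm s, abs_mean_le hm]
    have hφ := abs_primitive_le hρ hp hm
    have h2 := isHolder_of_abs_deriv_le hα hα1 (hasDerivAt_primitive hρ) hφ hψ
    have h3 : (4 * Real.pi + 1) * m ≤ 3 * ((4 * Real.pi + 1) * m) := by
      have : 0 ≤ (4 * Real.pi + 1) * m := by positivity
      linarith
    have h4 := hR (3 * ((4 * Real.pi + 1) * m)) (primitive ρ) (fun s => ρ s - mean ρ) h2
      (fun s => (hφ s).trans h3) (primitive_periodic hρ hp) (by fun_prop)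
      fun s => (hψ s).trans h3
    rwa [show K₁ * (3 * ((4 * Real.pi + 1) * m)) = K₃ * m by rw [hK₃]; ring] at h4
  have hRh : ∀ ρ, Continuous ρ → Function.Periodic ρ (2 * Real.pi) →
      ∃ C, IsHolder C α (R ρ) := fun ρ hρ hp => by
    obtain ⟨m, -, hm⟩ := exists_abs_le_of_periodic hρ hp
    exact ⟨_, (hRb m ρ hρ hp hm).1⟩
  -- `ρ + Y ρ` is `hilb + mean` applied to the left-hand side of the equation
  have key : ∀ {ρ C}, IsHolder C α ρ → Function.Periodic ρ (2 * Real.pi) → ∀ (g : ℝ → ℝ) (D : ℝ),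
      IsHolder D α g →
      ∀ s, hilb (fun s => (-1 * hilb ρ s + R ρ s) + -1 * g s) s
          + mean (fun s => (-1 * hilb ρ s + R ρ s) + -1 * g s)
        = ρ s + Y ρ s - (hilb g s + mean g) := by
    intro ρ C hρ hp g D hg s
    have hρc := hρ.continuous hα
    obtain ⟨C', hC'⟩ := hRh ρ hρc hp
    have h1 := (hH _ _ hρ).1
    have hgc := hg.continuous hα
    have hRc := hC'.continuous hα
    have h1c := h1.continuous hα
    rw [((h1.const_mul (-1)).add hC').hilb_add hα hα1 (hg.const_mul (-1)),
      (h1.const_mul (-1)).hilb_add hα hα1 hC', hilb_const_mul, hilb_const_mul,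
      hρ.hilb_hilb hα hα1 hp, mean_add (by fun_prop) (by fun_prop),
      mean_add (by fun_prop) (by fun_prop), mean_const_mul, mean_const_mul]
    have h2 : mean (hilb ρ) = 0 := by rw [mean, hρ.integral_hilb hα hα1 hp, mul_zero]
    rw [h2]
    simp only [hYdef]
    ring
  -- the equation for `primitive ρ`
  have heq : ∀ {ρ C}, IsHolder C α ρ → ∀ s, hilb (fun s => ρ s - mean ρ) s = hilb ρ s := by
    intro ρ C hρ s
    have := hρ.hilb_add hα hα1 (IsHolder.const (-mean ρ) α) s
    rw [hilb_const, add_zero] at this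
    simpa only [sub_eq_add_neg] using this
  have hYb : ∀ m ρ, Continuous ρ → Function.Periodic ρ (2 * Real.pi) → (∀ s, |ρ s| ≤ m) →
      IsHolder ((K₂ * K₃ + K₃ + 1) * m) α (Y ρ) ∧ ∀ s, |Y ρ s| ≤ (K₂ * K₃ + K₃ + 1) * m := by
    intro m ρ hρ hp hm
    have hm0 : 0 ≤ m := (abs_nonneg _).trans (hm 0)
    obtain ⟨h1, h2⟩ := hRb m ρ hρ hp hm
    obtain ⟨h3, h4⟩ := hH _ _ h1
    have h5 : 0 ≤ K₃ * m := by positivity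
    constructor
    · have h6 := (h3.add (IsHolder.const (mean (R ρ) - mean ρ) α)).mono
        (D := (K₂ * K₃ + K₃ + 1) * m) (by linarith)
      simpa only [hYdef, add_sub_assoc] using h6
    · intro s
      have h6 := abs_mean_le h2
      have h7 := abs_mean_le hm
      calc |Y ρ s| ≤ |hilb (R ρ) s + mean (R ρ)| + |mean ρ| := abs_sub _ _
        _ ≤ |hilb (R ρ) s| + |mean (R ρ)| + |mean ρ| := by gcongr; exact abs_add_le _ _
        _ ≤ _ := by linarith [h4 s]
  have hYp : ∀ ρ, Function.Periodic (Y ρ) (2 * Real.pi) := fun ρ s => by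
    simp only [hYdef, hilb_periodic (hRp ρ) s]
  have hadd : ∀ f g, Continuous f → Function.Periodic f (2 * Real.pi) → Continuous g →
      Function.Periodic g (2 * Real.pi) → ∀ s, Y (fun s => f s + g s) s = Y f s + Y g s := by
    intro f g hf hfp hg hgp s
    obtain ⟨C, hC⟩ := hRh f hf hfp
    obtain ⟨C', hC'⟩ := hRh g hg hgp
    have h1 : R (fun s => f s + g s) = fun s => R f s + R g s := by
      funext s
      simp only [hRdef]
      rw [← hx.regularOp_add hc hκ 0 hN.holder'.continuous (primc hf) (primc hg) (by fun_prop)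
        (by fun_prop)]
      congr 1
      · exact funext fun s => primitive_add hf hg s
      · funext s
        rw [mean_add hf hg]
        ring
    simp only [hYdef]
    rw [h1, hC.hilb_add hα hα1 hC', mean_add (hC.continuous hα) (hC'.continuous hα),
      mean_add hf hg]
    ring
  have hsmul : ∀ a f, Continuous f → Function.Periodic f (2 * Real.pi) →
      ∀ s, Y (fun s => a * f s) s = a * Y f s := by
    intro a f hf hfp s
    have h1 : R (fun s => a * f s) = fun s => a * R f s := by
      funext s
      simp only [hRdef]
      rw [← regularOp_const_mul]
      congr 1
      · exact funext fun s => primitive_const_mul a f s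
      · funext s
        rw [mean_const_mul]
        ring
    simp only [hYdef]
    rw [h1, hilb_const_mul, mean_const_mul, mean_const_mul]
    ring
  have hinj : ∀ ρ, Continuous ρ → Function.Periodic ρ (2 * Real.pi) →
      (∀ s, ρ s + Y ρ s = 0) → ∀ s, ρ s = 0 := by
    intro ρ hρ hp h0
    obtain ⟨m', -, hm'⟩ := exists_abs_le_of_periodic hρ hp
    have hρH := (hYb m' ρ hρ hp hm').1.const_mul (-1)
    have e : (fun t => -1 * Y ρ t) = ρ := funext fun s => by linarith [h0 s]
    rw [e] at hρH
    obtain ⟨C', hC'⟩ := hRh ρ hρ hp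
    have h1 := (hH _ _ hρH).1
    have h2 := (((h1.const_mul (-1)).add hC').add ((IsHolder.const 0 α).const_mul (-1)))
    have h3 := h2.eq_zero_of_hilb_add_mean hα hα1 (fun s => by
        simp only [hilb_periodic hp s, hRp ρ s]) (fun s => by
          rw [key hρH hp _ _ (IsHolder.const 0 α) s, h0 s, hilb_const, mean_const]; ring)
    have h4 : ∃ C, IsHolder C α fun s => ρ s - mean ρ := by
      have := hρH.add (IsHolder.const (-mean ρ) α)
      exact ⟨_, by simpa only [sub_eq_add_neg] using this⟩
    obtain ⟨C'', h4⟩ := h4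
    have h5 := hx.eq_zero_of_energy hc hκ hα hα1 hN hPhi (hasDerivAt_primitive hρ) h4
      (primitive_periodic hρ hp) (fun s => by simp only [hp s]) (fun s _ => by
        rw [heq hρH s]
        linarith [h3 s])
    have h6 : mean ρ = 0 := by rw [← primitive_zero]; exact h5 0
    intro s
    have h7 : HasDerivAt (primitive ρ) 0 s := by
      rw [show primitive ρ = fun _ => 0 from funext h5]
      exact hasDerivAt_const s 0
    have h8 := (hasDerivAt_primitive hρ s).unique h7
    linarith
  have hGH := ((hH _ _ hF).1.add (IsHolder.const (mean F) α))
  obtain ⟨ρ, hρ, hp, hsol⟩ := exists_add_eq_of_injective (K := K₂ * K₃ + K₃ + 1) hα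
    (by positivity) Y hadd hsmul (fun ρ _ _ => hYp ρ) hYb hinj
    (g := fun s => hilb F s + mean F) (hGH.continuous hα)
    (fun s => by simp only [hilb_periodic hFp s])
  obtain ⟨m', -, hm'⟩ := exists_abs_le_of_periodic hρ hp
  have hρH := hGH.add ((hYb m' ρ hρ hp hm').1.const_mul (-1))
  have e : (fun t => hilb F t + mean F + -1 * Y ρ t) = ρ := funext fun s => by
    linarith [hsol s]
  rw [e] at hρH
  obtain ⟨C', hC'⟩ := hRh ρ hρ hp
  have h1 := (hH _ _ hρH).1
  have h2 := (((h1.const_mul (-1)).add hC').add (hF.const_mul (-1)))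
  have h4 : ∃ C, IsHolder C α fun s => ρ s - mean ρ := by
    have := hρH.add (IsHolder.const (-mean ρ) α)
    exact ⟨_, by simpa only [sub_eq_add_neg] using this⟩
  obtain ⟨C'', h4⟩ := h4
  refine ⟨primitive ρ, fun s => ρ s - mean ρ, C'', primitive_periodic hρ hp,
    hasDerivAt_primitive hρ, h4, fun s => ?_⟩
  · have h3 := h2.eq_zero_of_hilb_add_mean hα hα1 (fun s => by
      simp only [hilb_periodic hp s, hRp ρ s, hFp s]) (fun s => by
        rw [key hρH hp F D hF s, hsol s, sub_self]) s
    rw [heq hρH s]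
    linarith

/-! ### The sequence of equations -/

theorem MemC0.add {α : ℝ≥0} {f g : ℝ → ℝ} (hf : MemC0 α f) (hg : MemC0 α g) :
    MemC0 α fun s => f s + g s := by
  obtain ⟨hfp, C, hC⟩ := memC0_iff.1 hf
  obtain ⟨hgp, D, hD⟩ := memC0_iff.1 hg
  exact memC0_iff.2 ⟨fun s => by simp only [hfp s, hgp s], _, hC.add hD⟩

theorem MemC0.const_mul {α : ℝ≥0} {f : ℝ → ℝ} (hf : MemC0 α f) (a : ℝ) :
    MemC0 α fun s => a * f s := by
  obtain ⟨hfp, C, hC⟩ := memC0_iff.1 hf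
  exact memC0_iff.2 ⟨fun s => by simp only [hfp s], _, hC.const_mul a⟩

theorem MemC0.mul {α : ℝ≥0} (hα : 0 < α) {f g : ℝ → ℝ} (hf : MemC0 α f) (hg : MemC0 α g) :
    MemC0 α fun s => f s * g s := by
  have hα' : (0 : ℝ) < α := by exact_mod_cast hα
  obtain ⟨hfp, C, hC⟩ := memC0_iff.1 hf
  obtain ⟨hgp, D, hD⟩ := memC0_iff.1 hg
  obtain ⟨M, -, hM⟩ := exists_abs_le_of_periodic (hC.continuous hα') hfp
  obtain ⟨N, -, hN⟩ := exists_abs_le_of_periodic (hD.continuous hα') hgp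
  exact memC0_iff.2 ⟨fun s => by simp only [hfp s, hgp s], _, IsHolder.mul hC hD hM hN⟩

theorem MemC0.sum {α : ℝ≥0} {ι : Type*} (t : Finset ι) {f : ι → ℝ → ℝ}
    (hf : ∀ i ∈ t, MemC0 α (f i)) : MemC0 α fun s => ∑ i ∈ t, f i s := by
  classical
  induction t using Finset.induction_on with
  | empty => simpa using memC0_iff.2 ⟨fun _ => rfl, _, IsHolder.const 0 α⟩
  | insert i t hi ih =>
    simp only [Finset.sum_insert hi]
    exact (hf i (Finset.mem_insert_self i t)).add
      (ih fun j hj => hf j (Finset.mem_insert_of_mem hj))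

theorem MemC1.sub {α : ℝ≥0} {f g : ℝ → ℝ} (hf : MemC1 α f) (hg : MemC1 α g) :
    MemC1 α fun s => f s - g s := by
  have hd : deriv (fun s => f s - g s) = fun s => deriv f s + -1 * deriv g s := by
    funext s
    rw [((hf.hasDerivAt s).fun_sub (hg.hasDerivAt s)).deriv]
    ring
  refine ⟨fun s => by simp only [hf.1 s, hg.1 s], hf.2.1.sub hg.2.1, ?_⟩
  rw [hd]
  exact (MemC0.add ⟨hf.deriv_periodic, hf.2.2⟩
    (MemC0.const_mul ⟨hg.deriv_periodic, hg.2.2⟩ (-1))).2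

theorem memC1_of_hasDerivAt {α : ℝ≥0} {C : ℝ} (hα : 0 < α) {φ ψ : ℝ → ℝ}
    (hp : Function.Periodic φ (2 * Real.pi)) (hd : ∀ s, HasDerivAt φ (ψ s) s)
    (hψ : IsHolder C α ψ) : MemC1 α φ := by
  have e : deriv φ = ψ := funext fun s => (hd s).deriv
  have hp' : Function.Periodic (deriv φ) (2 * Real.pi) := fun s => by
    rw [← deriv_comp_add_const, show (fun y => φ (y + 2 * Real.pi)) = φ from funext hp]
  refine ⟨hp, contDiff_one_iff_deriv.2 ⟨fun s => (hd s).differentiableAt, ?_⟩,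
    (memC0_iff.2 ⟨hp', C, by rwa [e]⟩).2⟩
  rw [e]
  exact hψ.continuous (by exact_mod_cast hα)

/-- `H_n - L_n` maps `C^{1,α}` to `C^{0,α}`. -/
theorem IsBoundaryParam.memC0_H_sub_L {c κ : ℝ} (hc : 0 < c) (hκ : 0 < κ)
    {x : ℝ → EuclideanSpace ℝ (Fin 2)} (hx : IsBoundaryParam x)
    {α : ℝ≥0} (hα : 0 < α) (hα1 : α < 1) (n : ℕ) {φ : ℝ → ℝ} (hφ : MemC1 α φ) :
    MemC0 α fun s => H c κ x n φ s - L c κ x n φ s := by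
  have hα' : (0 : ℝ) < α := by exact_mod_cast hα
  have hα1' : (α : ℝ) < 1 := by exact_mod_cast hα1
  obtain ⟨N, N', hN, hPhi⟩ := hx.exists_regularPart hc hκ hα' hα1' n
  obtain ⟨K, -, hK⟩ := hx.exists_isHolder_regularOp hc hκ hα' hα1' n hN.holder'
  obtain ⟨K', -, hK'⟩ := exists_isHolder_hilb hα' hα1'
  obtain ⟨C, hC⟩ := hφ.exists_isHolder_deriv
  have hdc := hC.continuous hα'
  obtain ⟨m, hm0, hm⟩ := exists_abs_le_of_periodic hφ.2.1.continuous hφ.1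
  obtain ⟨m', hm0', hm'⟩ := exists_abs_le_of_periodic hdc hφ.deriv_periodic
  have hmm : 0 ≤ max m m' := le_max_of_le_left hm0
  have h1 := isHolder_of_abs_deriv_le hα' hα1' hφ.hasDerivAt
    (fun s => (hm s).trans (le_max_left m m')) fun s => (hm' s).trans (le_max_right m m')
  have h2 := (hK _ φ (deriv φ) h1 (fun s => (hm s).trans (by linarith [le_max_left m m'])) hφ.1 hdc
    fun s => (hm' s).trans (by linarith [le_max_right m m'])).1
  have hnorm : ContDiff ℝ 1 fun s => ‖deriv x s‖⁻¹ :=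
    (hx.contDiff_deriv.norm ℝ hx.regular).inv fun s => norm_ne_zero_iff.2 (hx.regular s)
  have hnp : Function.Periodic (fun s => ‖deriv x s‖⁻¹) (2 * Real.pi) := fun s => by
    simp only [hx.deriv_periodic s]
  obtain ⟨D, -, hD, -⟩ := exists_isHolder_of_contDiff hα' hα1' hnorm hnp
  have h3 : MemC0 α fun s => ‖deriv x s‖⁻¹ * (-1 * hilb (deriv φ) s
      + regularOp c κ x n N' φ (deriv φ) s) :=
    (memC0_iff.2 ⟨hnp, D, hD⟩).mul hα
      (((memC0_iff.2 ⟨hilb_periodic hφ.deriv_periodic, _, (hK' _ _ hC).1⟩).const_mul (-1)).add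
        (memC0_iff.2 ⟨hx.regularOp_periodic c κ n hN.holder'.periodic _ _, _, h2⟩))
  have e : (fun s => H c κ x n φ s - L c κ x n φ s) = fun s => ‖deriv x s‖⁻¹ *
      (-1 * hilb (deriv φ) s + regularOp c κ x n N' φ (deriv φ) s) := by
    funext s
    have h4 := hx.mul_H_sub_L hc hκ hα hα1 hN hPhi hφ s
    rw [neg_one_mul, ← h4, inv_mul_cancel_left₀ (norm_ne_zero_iff.2 (hx.regular s))]
  rw [e]
  exact h3

/-- `H_0 - L_0` maps `C^{1,α}` onto `C^{0,α}`. -/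
theorem IsBoundaryParam.exists_memC1 {c κ : ℝ} (hc : 0 < c) (hκ : 0 < κ)
    {x : ℝ → EuclideanSpace ℝ (Fin 2)} (hx : IsBoundaryParam x)
    {α : ℝ≥0} (hα : 0 < α) (hα1 : α < 1) {f : ℝ → ℝ} (hf : MemC0 α f) :
    ∃ φ, MemC1 α φ ∧ ∀ s, H c κ x 0 φ s - L c κ x 0 φ s = f s := by
  have hα' : (0 : ℝ) < α := by exact_mod_cast hα
  have hα1' : (α : ℝ) < 1 := by exact_mod_cast hα1
  obtain ⟨N, N', hN, hPhi⟩ := hx.exists_regularPart hc hκ hα' hα1' 0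
  have hnp : Function.Periodic (fun s => ‖deriv x s‖) (2 * Real.pi) := fun s => by
    simp only [hx.deriv_periodic s]
  obtain ⟨D, -, hD, -⟩ := exists_isHolder_of_contDiff hα' hα1'
    (hx.contDiff_deriv.norm ℝ hx.regular) hnp
  obtain ⟨hFp, C, hF⟩ := memC0_iff.1 (MemC0.mul hα (memC0_iff.2 ⟨hnp, D, hD⟩) hf)
  obtain ⟨φ, ψ, C', hp, hd, hψ, heq⟩ := hx.exists_solution hc hκ hα' hα1' hN hPhi hF hFp
  have hφ := memC1_of_hasDerivAt hα hp hd hψ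
  refine ⟨φ, hφ, fun s => ?_⟩
  have h1 := hx.mul_H_sub_L hc hκ hα hα1 hN hPhi hφ s
  rw [show deriv φ = ψ from funext fun s => (hd s).deriv, heq s] at h1
  exact mul_left_cancel₀ (norm_ne_zero_iff.2 (hx.regular s)) h1

/-- `H_0 - L_0` is one-to-one on `C^{1,α}`. -/
theorem IsBoundaryParam.eq_of_H_sub_L_eq {c κ : ℝ} (hc : 0 < c) (hκ : 0 < κ)
    {x : ℝ → EuclideanSpace ℝ (Fin 2)} (hx : IsBoundaryParam x)
    {α : ℝ≥0} (hα : 0 < α) (hα1 : α < 1) {f g : ℝ → ℝ} (hf : MemC1 α f) (hg : MemC1 α g)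
    (h : ∀ s ∈ Set.Icc 0 (2 * Real.pi),
      H c κ x 0 f s - L c κ x 0 f s = H c κ x 0 g s - L c κ x 0 g s) : f = g := by
  have hα' : (0 : ℝ) < α := by exact_mod_cast hα
  have hα1' : (α : ℝ) < 1 := by exact_mod_cast hα1
  obtain ⟨N, N', hN, hPhi⟩ := hx.exists_regularPart hc hκ hα' hα1' 0
  obtain ⟨C, hC⟩ := hf.exists_isHolder_deriv
  obtain ⟨D, hD⟩ := hg.exists_isHolder_deriv
  have hfg := hf.sub hg
  have hd : ∀ s, HasDerivAt (fun s => f s - g s) (deriv f s + -1 * deriv g s) s := fun s =>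
    ((hf.hasDerivAt s).fun_sub (hg.hasDerivAt s)).congr_deriv (by ring)
  have h0 := hx.eq_zero_of_energy hc hκ hα' hα1' hN hPhi hd (hC.add (hD.const_mul (-1))) hfg.1
    (fun s => by simp only [hf.deriv_periodic s, hg.deriv_periodic s]) (fun s hs => by
      have h1 := hx.mul_H_sub_L hc hκ hα hα1 hN hPhi hf s
      have h2 := hx.mul_H_sub_L hc hκ hα hα1 hN hPhi hg s
      rw [h s hs, h2] at h1
      have hgc : Continuous fun s => -1 * g s := continuous_const.mul hg.2.1.continuous
      have hgc' : Continuous fun s => -1 * deriv g s :=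
        continuous_const.mul (hD.continuous hα')
      have h3 := hx.regularOp_add hc hκ 0 hN.holder'.continuous hf.2.1.continuous hgc
        (hC.continuous hα') hgc' s
      rw [regularOp_const_mul] at h3
      simp only [sub_eq_add_neg, ← neg_one_mul (g _)]
      rw [h3, hC.hilb_add hα' hα1' (hD.const_mul (-1)), hilb_const_mul]
      linarith)
  exact funext fun s => sub_eq_zero.1 (h0 s)

/-- The sequence `u` with `u n = F n u'`, where `u'` agrees with `u` below `n` and is zero from `n`
on. -/
def recSeq (F : ℕ → (ℕ → ℝ → ℝ) → ℝ → ℝ) : ℕ → ℝ → ℝ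
  | n => F n fun m => if _h : m < n then recSeq F m else 0

end LaguerreBIE

end

theorem mainTheorem4 (c κ : ℝ) (hc : 0 < c) (hκ : 0 < κ)
    (x : ℝ → EuclideanSpace ℝ (Fin 2)) (hx : LaguerreBIE.IsBoundaryParam x)
    (α : ℝ≥0) (hα0 : 0 < α) (hα1 : α < 1) :
    -- the integrals that define `H_n φ` and `L_n φ` exist for every `φ` in `C^{1,α}`
    (∀ (n : ℕ) (φ : ℝ → ℝ), LaguerreBIE.MemC1 α φ → ∀ s : ℝ,
      (∃ l : ℝ, LaguerreBIE.HasPVIntegral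
        (fun σ => deriv φ σ * LaguerreBIE.Q c κ x n s σ) s l) ∧
      IntervalIntegrable (fun σ => φ σ * LaguerreBIE.Wtilde c κ x n s σ)
        volume 0 (2 * Real.pi)) ∧
    -- unique solvability of the sequence of equations
    ∀ f : ℕ → ℝ → ℝ, (∀ n, LaguerreBIE.MemC0 α (f n)) →
      ∃! ψ : ℕ → ℝ → ℝ, (∀ n, LaguerreBIE.MemC1 α (ψ n)) ∧
        ∀ n : ℕ, ∀ s ∈ Set.Icc 0 (2 * Real.pi),
          LaguerreBIE.H c κ x 0 (ψ n) s - LaguerreBIE.L c κ x 0 (ψ n) s =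
            f n s - ∑ m ∈ Finset.range n,
              (LaguerreBIE.H c κ x (n - m) (ψ m) s - LaguerreBIE.L c κ x (n - m) (ψ m) s) := by
  refine ⟨fun n φ hφ s => hx.exists_integrals hc hκ hα0 hα1 n hφ s, fun f hf => ?_⟩
  -- `S` is a right inverse of `H_0 - L_0`
  choose! S hS1 hS2 using fun (g : ℝ → ℝ) (hg : LaguerreBIE.MemC0 α g) =>
    hx.exists_memC1 hc hκ hα0 hα1 hg
  let rhs : ℕ → (ℕ → ℝ → ℝ) → ℝ → ℝ := fun n ψ s => f n s + -1 * ∑ m ∈ Finset.range n,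
    (LaguerreBIE.H c κ x (n - m) (ψ m) s - LaguerreBIE.L c κ x (n - m) (ψ m) s)
  set ψ := LaguerreBIE.recSeq fun n u => S (rhs n u) with hψ
  have hrhs : ∀ n, (∀ m < n, LaguerreBIE.MemC1 α (ψ m)) → LaguerreBIE.MemC0 α (rhs n ψ) :=
    fun n hn => (hf n).add ((LaguerreBIE.MemC0.sum _ fun m hm =>
      hx.memC0_H_sub_L hc hκ hα0 hα1 (n - m) (hn m (Finset.mem_range.1 hm))).const_mul (-1))
  have hrec : ∀ n, ψ n = S (rhs n ψ) := by
    intro n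
    rw [hψ, LaguerreBIE.recSeq]
    congr 1
    funext s
    simp only [rhs]
    congr 2
    refine Finset.sum_congr rfl fun m hm => ?_
    rw [dif_pos (Finset.mem_range.1 hm)]
  have hmem : ∀ n, LaguerreBIE.MemC1 α (ψ n) := by
    intro n
    induction n using Nat.strong_induction_on with
    | _ n ih =>
      rw [hrec n]
      exact hS1 _ (hrhs n ih)
  refine ⟨ψ, ⟨hmem, fun n s _ => ?_⟩, fun ψ' hψ' => funext fun n => ?_⟩
  · have h1 := hS2 _ (hrhs n fun m _ => hmem m) s
    rw [← hrec n] at h1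
    rw [h1, sub_eq_add_neg, ← neg_one_mul]
  · induction n using Nat.strong_induction_on with
    | _ n ih =>
      refine hx.eq_of_H_sub_L_eq hc hκ hα0 hα1 (hψ'.1 n) (hmem n) fun s hs => ?_
      have h1 := hS2 _ (hrhs n fun m _ => hmem m) s
      rw [← hrec n] at h1
      rw [hψ'.2 n s hs, h1, sub_eq_add_neg, ← neg_one_mul]
      simp only [rhs]
      congr 2
      exact Finset.sum_congr rfl fun m hm => by rw [ih m (Finset.mem_range.1 hm)]
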